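/- Let $\sigma>0$, $c\in\mathbb R$ and $\omega>c^2/4$. Let \[ \varphi(y)=\left(\frac{(\sigma+1)(4\omega-c^2)}{2\sqrt\omega\left(\cosh(\sigma\sqrt{4\omega-c^2}\,y)-\frac{c}{2\sqrt\omega}\right)}\right)^{1/(2\sigma)},\quad \theta(y)=\frac c2y-\frac1{2\sigma+2}\int_{-\infty}^y\varphi^{2\sigma}\,d\eta,\quad \phi=\varphi e^{i\theta}. \] Let $X=H^1(\mathbb R;\mathbb C)$, regarded as a real vector space with norm $\|u\|_X^2=\int_{\mathbb R}(|u_x|^2+|u|^2)\,dx$, and let $\langle f,u\rangle=\operatorname{Re}\int_{\mathbb R} f\bar u\,dx$ be the pairing between $X^*=H^{-1}(\mathbb R)$ and $X$. Let $H_\phi:X\to X^*$ be the real-linear operator \[ H_\phi u=-u_{xx}+\omega u+icu_x-i\sigma|\phi|^{2\sigma-2}\bar\phi\,\phi_x\,u-i|\phi|^{2\sigma}u_x-i\sigma|\phi|^{2\sigma-2}\phi\,\phi_x\,\bar u . \] Let \[ \widetilde L_{11}=-\partial_{yy}+\omega-\frac{c^2}4+\frac{c(2\sigma+1)}2\varphi^{2\sigma}-\frac{8\sigma^2+6\sigma+1}{4(\sigma+1)^2}\varphi^{4\sigma},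 \] acting on real functions with domain $H^2(\mathbb R)$. \textbf{Theorem.} The operator $\widetilde L_{11}$ has exactly one negative eigenvalue $-\lambda^2$, and it is simple; let $\chi_{11}$ be a real eigenfunction for it with $\|\chi_{11}\|_{L^2}=1$. The function $\varphi^{2\sigma-1}\chi_{11}$ is integrable, and there are real numbers $k_{12}$, $k_2$ such that, with \[ \chi_{12}=\varphi\left[-\frac{\sigma}{\sigma+1}\int_{-\infty}^y\varphi^{2\sigma-1}\chi_{11}\,ds+k_{12}\right], \] one has $\int\chi_{12}\varphi\,dy=0$ and $\int\left(k_2-\frac1{2\sigma+2}\varphi^{2\sigma}\right)\varphi^2\,dy=0$. The functions \[ \chi_-=(\chi_{11}+i\chi_{12})e^{i\theta},\qquad \chi_1=\left(\varphi_y+i\left(k_2-\tfrac1{2\sigma+2}\varphi^{2\sigma}\right)\varphi\right)e^{i\theta},\qquad \chi_2=i\varphi e^{i\theta} \] belong to $X$, and $X$ is the direct sum \[ X=N\oplus Z\oplus P \] of real subspaces such that: (i) $N=\operatorname{span}_{\mathbb R}\{\chi_-\}$ is one-dimensional, and $\langle H_\phi u,u\rangle<0$ for all $u\in N$, $u\ne0$;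 (ii) $Z=\operatorname{span}_{\mathbb R}\{\chi_1,\chi_2\}$ is two-dimensional and equals $\ker H_\phi$, both for $H_\phi:H^1\to H^{-1}$ and for $H_\phi$ acting on $H^2(\mathbb R)$; (iii) there is $\delta>0$ such that $\langle H_\phi p,p\rangle\ge\delta\|p\|_X^2$ for all $p\in P$. -/

import Mathlib

open MeasureTheory Set
open scoped ComplexConjugate

noncomputable section

namespace GDNLS

/-- The space `L²(ℝ)` of complex functions. -/
abbrev L2C : Type := Lp ℂ 2 (volume : Measure ℝ)

/-- `v` is the weak derivative of `u` on `ℝ`: `∫ ψ' u = - ∫ ψ v` for every smooth compactly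
supported `ψ`. It is only used when `u` and `v` are square integrable, so that both integrals
converge. -/
def HasWeakDeriv {F : Type*} [NormedAddCommGroup F] [NormedSpace ℝ F] (u v : ℝ → F) : Prop :=
  ∀ ψ : ℝ → ℝ, ContDiff ℝ (⊤ : ℕ∞) ψ → HasCompactSupport ψ →
    ∫ x, deriv ψ x • u x = -∫ x, ψ x • v x

theorem integrable_smul_L2C {ψ : ℝ → ℝ} (hc : Continuous ψ) (hs : HasCompactSupport ψ)
    (u : L2C) : Integrable (fun x => ψ x • u x) :=
  memLp_one_iff_integrable.1 (MemLp.smul (p := 2) (q := 2) (Lp.memLp u)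
    (hc.memLp_of_hasCompactSupport hs) :
    MemLp (ψ • (u : ℝ → ℂ)) 1 volume)

/-- The Sobolev space `X = H¹(ℝ)` of complex functions, as a real vector space: the graph of the
weak derivative, that is the pairs `(u, uₓ)` of elements of `L²`. Its norm is the `H¹` norm,
`‖u‖² = ‖u‖²_{L²} + ‖uₓ‖²_{L²}`. -/
def H1 : Submodule ℝ (WithLp 2 (L2C × L2C)) where
  carrier := {p | HasWeakDeriv (p.fst : ℝ → ℂ) (p.snd : ℝ → ℂ)}
  zero_mem' := by
    intro ψ _ _
    have h : ((0 : L2C) : ℝ → ℂ) =ᵐ[volume] 0 := Lp.coeFn_zero _ _ _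
    have h1 : ∫ x, deriv ψ x • (0 : L2C) x = 0 := by
      rw [← integral_zero ℝ ℂ]
      refine integral_congr_ae ?_
      filter_upwards with x
      simp
    have h2 : ∫ x, ψ x • (0 : L2C) x = 0 := by
      rw [← integral_zero ℝ ℂ]
      refine integral_congr_ae ?_
      filter_upwards with x
      simp
    simp only [WithLp.zero_fst, WithLp.zero_snd]
    rw [h1, h2, neg_zero]
  add_mem' := by
    intro p q hp hq ψ hψ hs
    have hdc : Continuous (deriv ψ) := hψ.continuous_deriv (by simp)
    have key : ∀ (g : ℝ → ℝ) (_ : Continuous g) (_ : HasCompactSupport g) (u v : L2C),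
        ∫ x, g x • (u + v) x = (∫ x, g x • u x) + ∫ x, g x • v x := by
      intro g hg hgs u v
      rw [← integral_add (integrable_smul_L2C hg hgs u) (integrable_smul_L2C hg hgs v)]
      refine integral_congr_ae ?_
      filter_upwards [Lp.coeFn_add u v] with x hx
      rw [hx, Pi.add_apply, smul_add]
    simp only [WithLp.add_fst, WithLp.add_snd]
    rw [key _ hdc hs.deriv, key _ hψ.continuous hs, hp ψ hψ hs, hq ψ hψ hs]
    ring
  smul_mem' := by
    intro a p hp ψ hψ hs
    have key : ∀ (g : ℝ → ℝ) (u : L2C),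
        ∫ x, g x • (a • u) x = a • ∫ x, g x • u x := by
      intro g u
      rw [← integral_smul]
      refine integral_congr_ae ?_
      filter_upwards [Lp.coeFn_smul a u] with x hx
      rw [hx, Pi.smul_apply, smul_comm]
    simp only [WithLp.smul_fst, WithLp.smul_snd]
    rw [key, key, hp ψ hψ hs, smul_neg]

/-- The underlying function of an element of `H¹`. -/
def fn (u : H1) : L2C := u.1.fst

/-- The weak derivative of an element of `H¹`. -/
def der (u : H1) : L2C := u.1.snd

/-! ### The soliton -/

/-- The positive profile `φ_{ω,c}` of the soliton. -/
def varphi (σ ω c : ℝ) (y : ℝ) : ℝ :=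
  ((σ + 1) * (4 * ω - c ^ 2) /
    (2 * √ω * (Real.cosh (σ * √(4 * ω - c ^ 2) * y) - c / (2 * √ω)))) ^ (1 / (2 * σ))

/-- The traveling phase. -/
def theta (σ ω c : ℝ) (y : ℝ) : ℝ :=
  c / 2 * y - 1 / (2 * σ + 2) * ∫ η in Iic y, varphi σ ω c η ^ (2 * σ)

/-- The phase factor `e^{iθ}`. -/
def phase (σ ω c : ℝ) (y : ℝ) : ℂ := Complex.exp (Complex.I * (theta σ ω c y : ℂ))

/-- The complex soliton `ϕ = φ e^{iθ}`. -/
def phi (σ ω c : ℝ) (y : ℝ) : ℂ := (varphi σ ω c y : ℂ) * phase σ ω c y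

/-! ### The linearized operator -/

/-- All the terms of order at most one of `H_ϕ u = (E''(ϕ) + ω Q''(ϕ) + c P''(ϕ)) u`, as a function
of `u` and of its derivative `ux`; the remaining term is `-uₓₓ`. Here
`E''(ϕ)u = -uₓₓ - iσ|ϕ|^{2σ-2} ϕ̄ ϕₓ u - i|ϕ|^{2σ} uₓ - iσ|ϕ|^{2σ-2} ϕ ϕₓ ū`,
`Q''(ϕ)u = u` and `P''(ϕ)u = i uₓ`. -/
def lowerOrder (σ ω c : ℝ) (u ux : ℝ → ℂ) (x : ℝ) : ℂ :=
  (ω : ℂ) * u x + Complex.I * (c : ℂ) * ux x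
    - Complex.I * (σ : ℂ) * ((‖phi σ ω c x‖ ^ (2 * σ - 2) : ℝ) : ℂ)
        * conj (phi σ ω c x) * deriv (phi σ ω c) x * u x
    - Complex.I * ((‖phi σ ω c x‖ ^ (2 * σ) : ℝ) : ℂ) * ux x
    - Complex.I * (σ : ℂ) * ((‖phi σ ω c x‖ ^ (2 * σ - 2) : ℝ) : ℂ)
        * phi σ ω c x * deriv (phi σ ω c) x * conj (u x)

/-- The pairing `⟨H_ϕ u, v⟩` of `H_ϕ u ∈ X* = H⁻¹` with `v ∈ X = H¹`, where
`⟨f, v⟩ = Re ∫ f v̄` and the term `-uₓₓ` of `H_ϕ u` acts on `v` by `Re ∫ uₓ v̄ₓ`. -/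
def pairingH (σ ω c : ℝ) (u v : H1) : ℝ :=
  (∫ x, (der u x * conj (der v x) + lowerOrder σ ω c (fn u) (der u) x * conj (fn v x))).re

/-- `u` belongs to `H²(ℝ)` and `H_ϕ u = 0` almost everywhere: here `fn w = uₓ` with `w ∈ H¹`, so that
`der w = uₓₓ`. -/
def IsStrongKernel (σ ω c : ℝ) (u : H1) : Prop :=
  ∃ w : H1, fn w = der u ∧
    ∀ᵐ x : ℝ, -der w x + lowerOrder σ ω c (fn u) (der u) x = 0

/-! ### The explicit functions spanning the negative space and the kernel -/

/-- The potential of the operator `L̃₁₁ = -∂_y² + V`. -/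
def potential (σ ω c : ℝ) (y : ℝ) : ℝ :=
  ω - c ^ 2 / 4 + c * (2 * σ + 1) / 2 * varphi σ ω c y ^ (2 * σ)
    - (8 * σ ^ 2 + 6 * σ + 1) / (4 * (σ + 1) ^ 2) * varphi σ ω c y ^ (4 * σ)

/-- `f` is an eigenfunction, in `H²(ℝ; ℝ)` and not zero, of `L̃₁₁` for the eigenvalue `μ`. -/
def IsEigenfunction (σ ω c μ : ℝ) (f : ℝ → ℝ) : Prop :=
  ¬ f =ᵐ[volume] 0 ∧
  ∃ f₁ f₂ : ℝ → ℝ, MemLp f 2 volume ∧ MemLp f₁ 2 volume ∧ MemLp f₂ 2 volume ∧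
    HasWeakDeriv f f₁ ∧ HasWeakDeriv f₁ f₂ ∧
    ∀ᵐ y : ℝ, -f₂ y + potential σ ω c y * f y = μ * f y

/-- `χ₁₂ = φ (-σ/(σ+1) ∫_{-∞}^y φ^{2σ-1} χ₁₁ ds + k₁₂)`. -/
def chi12 (σ ω c : ℝ) (χ₁₁ : ℝ → ℝ) (k₁₂ : ℝ) (y : ℝ) : ℝ :=
  varphi σ ω c y *
    (-(σ / (σ + 1)) * (∫ s in Iic y, varphi σ ω c s ^ (2 * σ - 1) * χ₁₁ s) + k₁₂)

/-- `χ₋ = (χ₁₁ + i χ₁₂) e^{iθ}`. -/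
def chiMinus (σ ω c : ℝ) (χ₁₁ : ℝ → ℝ) (k₁₂ : ℝ) (y : ℝ) : ℂ :=
  ((χ₁₁ y : ℂ) + Complex.I * (chi12 σ ω c χ₁₁ k₁₂ y : ℂ)) * phase σ ω c y

/-- The factor `k₂ - φ^{2σ}/(2σ+2)`. -/
def kernelFactor (σ ω c k₂ : ℝ) (y : ℝ) : ℝ :=
  k₂ - 1 / (2 * σ + 2) * varphi σ ω c y ^ (2 * σ)

/-- `χ₁ = (φ_y + i (k₂ - φ^{2σ}/(2σ+2)) φ) e^{iθ}`. -/
def chi1 (σ ω c k₂ : ℝ) (y : ℝ) : ℂ :=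
  (((deriv (varphi σ ω c) y : ℝ) : ℂ)
    + Complex.I * ((kernelFactor σ ω c k₂ y * varphi σ ω c y : ℝ) : ℂ)) * phase σ ω c y

/-- `χ₂ = i φ e^{iθ}`. -/
def chi2 (σ ω c : ℝ) (y : ℝ) : ℂ :=
  Complex.I * (varphi σ ω c y : ℂ) * phase σ ω c y

end GDNLS

end

/-! Write `u = (a + i b) e^{iθ}` with real `a`, `b`, and put `W = φ^{2σ}`, `r = φ'/φ`, `U = φ''/φ`.
Up to total derivatives the quadratic form of `H_ϕ` splits as the form of `L̃₁₁` at `a` plus `∫ T²`,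
where `T = φ (b/φ)' + σ/(σ+1) W a` (`pairingH_eq`, `twist`). The square vanishes when `b` solves a
first order linear equation driven by `a`, so the spectral picture of `H_ϕ` is that of `L̃₁₁`
together with the kernel direction `a = 0`, `b = φ`.

For `L̃₁₁ = -∂² + V`: differentiating `φ'' = U φ` gives `φ''' = V φ'`, so `φ'` is in the kernel, and
it vanishes only at the origin. Jacobi's substitution with `φ'` on each half line shows that the
form is nonnegative on functions vanishing at `0` (`energy_nonneg_of_zero`). This is a condition of
codimension one, so there is at most one negative direction. There is one because `φ` itself has
negative energy (`energy_φ_neg`), and `V` tends to `ω - c²/4 > 0`, so a minimizer of the Rayleigh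
quotient exists (`exists_minimizer`). The kernel is exactly `ℝ φ'`, by a Wronskian argument
(`eq_smul_of_energy_eq_zero`). Positivity off the ground state and `φ'` becomes coercivity by the
same compactness (`exists_coercive`).

For the imaginary part, `∫ (b' - r b)²` is the form of `-∂² + U`, which is nonnegative with kernel
`ℝ φ`, hence coercive on the orthogonal complement of `φ` (`exists_coercive_U`).

The functions `χ₋` and `χ₁` have real parts the ground state `e` and `φ'`, and imaginary parts
chosen so that `T = 0`. Hence `χ₋` has energy equal to the eigenvalue, and `χ₁`, `χ₂` lie in the
kernel. Conversely, for a kernel element `T` is orthogonal to the range of `∂ - r`, so it is a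
multiple of `1/φ` in `L²`, hence zero (`eq_zero_of_weak_adjoint`). The space `P` is cut out by `a ⊥
e`, `a ⊥ φ'`, `b ⊥ φ`. The constants `k₁₂`, `k₂` make these three functionals biorthogonal to `χ₋`,
`χ₁`, `χ₂`, which gives the direct sum, and the two coercivity bounds combine on `P`
(`exists_coercive_pairing`). -/

namespace GDNLS

/-! ### Primitives, weak derivatives and continuous representatives in real `H¹`. -/

section Sobolev

open Filter Topology
open scoped ContDiff

/-- `f` is a primitive of the locally integrable function `f'`. -/
structure IsPrim (f f' : ℝ → ℝ) : Prop where
  locInt : LocallyIntegrable f' volume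
  sub_eq : ∀ x y, f y - f x = ∫ t in x..y, f' t

namespace IsPrim

variable {f f' g g' : ℝ → ℝ}

theorem intervalIntegrable (h : IsPrim f f') (a b : ℝ) : IntervalIntegrable f' volume a b :=
  intervalIntegrable_iff.2
    ((h.locInt.integrableOn_isCompact isCompact_uIcc).mono_set uIoc_subset_uIcc)

theorem eq_add (h : IsPrim f f') (x : ℝ) : f = fun y => f x + ∫ t in x..y, f' t := by
  funext y
  rw [← h.sub_eq x y]; ring

theorem continuous (h : IsPrim f f') : Continuous f := by
  rw [h.eq_add 0]
  exact continuous_const.add (intervalIntegral.continuous_primitive h.intervalIntegrable 0)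

theorem ae_hasDerivAt (h : IsPrim f f') : ∀ᵐ x, HasDerivAt f (f' x) x := by
  filter_upwards [_root_.LocallyIntegrable.ae_hasDerivAt_integral h.locInt] with x hx
  rw [h.eq_add 0]
  exact (hx 0).const_add _

theorem hasDerivAt (h : IsPrim f f') (hc : Continuous f') (x : ℝ) : HasDerivAt f (f' x) x := by
  rw [h.eq_add 0]
  exact (intervalIntegral.integral_hasDerivAt_right (h.intervalIntegrable _ _)
    (hc.stronglyMeasurableAtFilter _ _) hc.continuousAt).const_add _

theorem absolutelyContinuous (h : IsPrim f f') (a b : ℝ) :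
    AbsolutelyContinuousOnInterval f a b := by
  have h1 := (h.intervalIntegrable a b).absolutelyContinuousOnInterval_intervalIntegral
    (c := a) (by simp)
  have h2 : AbsolutelyContinuousOnInterval (fun _ : ℝ => f a) a b :=
    (contDiff_const (n := 1)).contDiffOn.absolutelyContinuousOnInterval
  have h3 := h2.fun_add h1
  rwa [← h.eq_add a] at h3

theorem of_hasDerivAt (h : ∀ x, HasDerivAt f (f' x) x) (hc : Continuous f') : IsPrim f f' :=
  ⟨hc.locallyIntegrable, fun _ _ => (intervalIntegral.integral_eq_sub_of_hasDerivAt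
    (fun x _ => h x) (hc.intervalIntegrable _ _)).symm⟩

theorem integral (h : LocallyIntegrable f' volume) : IsPrim (fun x => ∫ t in (0 : ℝ)..x, f' t) f' :=
  have hi : ∀ a b, IntervalIntegrable f' volume a b := fun _ _ => intervalIntegrable_iff.2
    ((h.integrableOn_isCompact isCompact_uIcc).mono_set uIoc_subset_uIcc)
  ⟨h, fun _ _ => intervalIntegral.integral_interval_sub_left (hi _ _) (hi _ _)⟩

theorem congr_deriv (h : IsPrim f f') (hg : f' =ᵐ[volume] g') : IsPrim f g' :=
  ⟨h.locInt.congr hg, fun x y => by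
    rw [h.sub_eq x y]
    exact intervalIntegral.integral_congr_ae (hg.mono fun _ hx _ => hx)⟩

theorem add (hf : IsPrim f f') (hg : IsPrim g g') :
    IsPrim (fun x => f x + g x) (fun x => f' x + g' x) :=
  ⟨hf.locInt.add hg.locInt, fun x y => by
    rw [intervalIntegral.integral_add (hf.intervalIntegrable _ _) (hg.intervalIntegrable _ _),
      ← hf.sub_eq, ← hg.sub_eq]; ring⟩

theorem const_mul (hf : IsPrim f f') (c : ℝ) : IsPrim (fun x => c * f x) (fun x => c * f' x) :=
  ⟨hf.locInt.smul c, fun x y => by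
    rw [intervalIntegral.integral_const_mul, ← hf.sub_eq]; ring⟩

theorem sub (hf : IsPrim f f') (hg : IsPrim g g') :
    IsPrim (fun x => f x - g x) (fun x => f' x - g' x) := by
  convert! hf.add (hg.const_mul (-1)) using 2 <;> ring

/-- Primitives are absolutely continuous on compact intervals, so the product rule can be integrated
even though the derivatives exist only almost everywhere. -/
theorem mul (hf : IsPrim f f') (hg : IsPrim g g') :
    IsPrim (fun x => f x * g x) (fun x => f' x * g x + f x * g' x) := by
  refine ⟨?_, fun x y => ?_⟩
  · refine LocallyIntegrable.add ?_ ?_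
    · simpa [mul_comm] using hf.locInt.continuous_smul hg.continuous
    · simpa [mul_comm] using hg.locInt.continuous_smul hf.continuous
  · rw [← AbsolutelyContinuousOnInterval.integral_deriv_mul_eq_sub
      (hf.absolutelyContinuous x y) (hg.absolutelyContinuous x y)]
    refine intervalIntegral.integral_congr_ae ?_
    filter_upwards [hf.ae_hasDerivAt, hg.ae_hasDerivAt] with t h1 h2 _
    rw [h1.deriv, h2.deriv]

/-- Integrability of `f'` gives a limit at infinity, and integrability of `f` forces that limit to
be zero. -/
theorem tendsto_atTop (h : IsPrim f f') (hf : Integrable f) (hf' : Integrable f') :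
    Tendsto f atTop (𝓝 0) := by
  have h1 : Tendsto f atTop (𝓝 (f 0 + ∫ t in Ioi (0 : ℝ), f' t)) := by
    rw [h.eq_add 0]
    simpa using (intervalIntegral_tendsto_integral_Ioi 0 hf'.integrableOn tendsto_id).const_add _
  have h2 : f 0 + ∫ t in Ioi (0 : ℝ), f' t = 0 :=
    (hf.integrableAtFilter _).eq_zero_of_tendsto
      (fun s hs => by
        obtain ⟨a, ha⟩ := mem_atTop_sets.1 hs
        exact measure_mono_top (fun x hx => ha x hx) (Real.volume_Ici (a := a))) h1
  rwa [h2] at h1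

theorem tendsto_atBot (h : IsPrim f f') (hf : Integrable f) (hf' : Integrable f') :
    Tendsto f atBot (𝓝 0) := by
  have h1 : Tendsto f atBot (𝓝 (f 0 - ∫ t in Iic (0 : ℝ), f' t)) := by
    have h3 : f = fun y => f 0 - ∫ t in y..0, f' t := by
      funext y
      rw [← h.sub_eq y 0]; ring
    rw [h3]
    simpa using (intervalIntegral_tendsto_integral_Iic 0 hf'.integrableOn tendsto_id).const_sub _
  have h2 : f 0 - ∫ t in Iic (0 : ℝ), f' t = 0 :=
    (hf.integrableAtFilter _).eq_zero_of_tendsto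
      (fun s hs => by
        obtain ⟨a, ha⟩ := mem_atBot_sets.1 hs
        exact measure_mono_top (fun x hx => ha x hx) (Real.volume_Iic (a := a))) h1
  rwa [h2] at h1

theorem eq_integral_Iic (h : IsPrim f f') (hf : Integrable f) (hf' : Integrable f') (x : ℝ) :
    f x = ∫ t in Iic x, f' t := by
  have h1 := intervalIntegral_tendsto_integral_Iic x (hf'.integrableOn (s := Iic x)) tendsto_id
  have h2 : Tendsto (fun y => f x - f y) atBot (𝓝 (f x - 0)) :=
    (h.tendsto_atBot hf hf').const_sub _
  simp_rw [h.sub_eq _ x] at h2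
  rw [sub_zero] at h2
  exact tendsto_nhds_unique h2 h1

theorem integral_eq_zero (h : IsPrim f f') (hf : Integrable f) (hf' : Integrable f') :
    ∫ x, f' x = 0 := by
  have h1 := intervalIntegral_tendsto_integral_Ioi 0 (hf'.integrableOn (s := Ioi 0)) tendsto_id
  have h2 : Tendsto (fun y => f y - f 0) atTop (𝓝 (0 - f 0)) :=
    (h.tendsto_atTop hf hf').sub_const _
  simp_rw [h.sub_eq 0] at h2
  have h3 := tendsto_nhds_unique h1 h2
  rw [← intervalIntegral.integral_Iic_add_Ioi (b := 0) hf'.integrableOn hf'.integrableOn, h3,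
    ← h.eq_integral_Iic hf hf' 0]
  ring

theorem const_of_zero (h : IsPrim f fun _ => 0) (x y : ℝ) : f x = f y := by
  have := h.sub_eq y x
  simp at this
  linarith

theorem hasWeakDeriv (h : IsPrim f f') : HasWeakDeriv f f' := by
  intro ψ hψ hs
  have hd : Continuous (deriv ψ) := hψ.continuous_deriv (by simp)
  have h1 : IsPrim ψ (deriv ψ) :=
    of_hasDerivAt (fun x => ((hψ.differentiable (by simp)) x).hasDerivAt) hd
  have hi1 : Integrable (fun x => deriv ψ x * f x) :=
    (hd.mul h.continuous).integrable_of_hasCompactSupport hs.deriv.mul_right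
  have hi2 : Integrable (fun x => ψ x * f' x) := by
    have := h.locInt.integrable_smul_left_of_hasCompactSupport hψ.continuous hs
    simpa using this
  have h2 := (h1.mul h).integral_eq_zero
    ((hψ.continuous.mul h.continuous).integrable_of_hasCompactSupport hs.mul_right) (hi1.add hi2)
  rw [integral_add hi1 hi2] at h2
  simp only [smul_eq_mul]
  linarith

end IsPrim

/-- The primitive started to the left of the support vanishes there, and vanishes again to the right
of it because the total integral is zero. -/
theorem exists_compactSupport_primitive {g : ℝ → ℝ} (hg : ContDiff ℝ ∞ g)
    (hs : HasCompactSupport g) (h0 : ∫ x, g x = 0) :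
    ∃ G : ℝ → ℝ, ContDiff ℝ ∞ G ∧ HasCompactSupport G ∧ deriv G = g := by
  obtain ⟨R, hR⟩ := hs.isCompact.isBounded.subset_closedBall 0
  have hz : ∀ x, R < |x| → g x = 0 := fun x hx => by
    by_contra h
    have := hR (subset_tsupport g h)
    simp at this
    linarith
  have hi : Integrable g := hg.continuous.integrable_of_hasCompactSupport hs
  -- The absolute value covers a negative `R`, which can occur when the support is empty.
  set G : ℝ → ℝ := fun x => ∫ t in (-(|R| + 1))..x, g t with hG
  have hd : ∀ x, HasDerivAt G (g x) x := fun x =>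
    intervalIntegral.integral_hasDerivAt_right (hi.intervalIntegrable)
      (hg.continuous.stronglyMeasurableAtFilter _ _) hg.continuous.continuousAt
  have hdG : deriv G = g := funext fun x => (hd x).deriv
  refine ⟨G, ?_, ?_, hdG⟩
  · rw [contDiff_infty_iff_deriv, hdG]
    exact ⟨fun x => (hd x).differentiableAt, hg⟩
  · refine HasCompactSupport.of_support_subset_isCompact (isCompact_Icc (a := -(|R| + 1))
      (b := |R| + 1)) fun x hx => ?_
    have hR0 := le_abs_self R
    by_contra hn
    rw [mem_Icc, not_and_or, not_le, not_le] at hn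
    refine hx ?_
    rcases hn with hn | hn
    · simp only [hG]
      rw [intervalIntegral.integral_congr (g := fun _ => (0 : ℝ))]
      · simp
      · intro t ht
        rw [uIcc_of_ge hn.le] at ht
        refine hz t ?_
        have := neg_le_abs t
        linarith [ht.2]
    · simp only [hG]
      rw [← h0, ← setIntegral_eq_integral_of_forall_compl_eq_zero (s := Ioc (-(|R| + 1)) x),
        intervalIntegral.integral_of_le (by linarith [abs_nonneg R])]
      intro t ht
      rw [mem_Ioc, not_and_or, not_lt, not_le] at ht
      refine hz t ?_
      rcases ht with ht | ht
      · linarith [neg_le_abs t]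
      · linarith [le_abs_self t]

theorem integrable_test_mul {u ψ : ℝ → ℝ} (hu : LocallyIntegrable u volume) (hψ : Continuous ψ)
    (hs : HasCompactSupport ψ) : Integrable (fun x => ψ x * u x) := by
  simpa using hu.integrable_smul_left_of_hasCompactSupport hψ hs

/-- The du Bois-Reymond lemma: a test function `g` minus `(∫ g) η`, with `η` a bump of mass one, is
the derivative of a test function, so `∫ g w` depends on `g` only through `∫ g`. -/
theorem HasWeakDeriv.ae_eq_const {w : ℝ → ℝ} (hw : LocallyIntegrable w volume)
    (h : HasWeakDeriv w fun _ => 0) : ∃ c : ℝ, w =ᵐ[volume] fun _ => c := by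
  let b : ContDiffBump (0 : ℝ) := ⟨1, 2, one_pos, one_lt_two⟩
  set η : ℝ → ℝ := b.normed volume with hη
  have hηd : ContDiff ℝ ∞ η := b.contDiff_normed
  have hηs : HasCompactSupport η := b.hasCompactSupport_normed
  have hη1 : ∫ x, η x = 1 := b.integral_normed
  have hηi : Integrable η := hηd.continuous.integrable_of_hasCompactSupport hηs
  refine ⟨∫ x, η x * w x, ?_⟩
  refine ae_eq_of_integral_contDiff_smul_eq hw (locallyIntegrable_const _) fun g hg hgs => ?_
  have hgi : Integrable g := hg.continuous.integrable_of_hasCompactSupport hgs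
  obtain ⟨G, hG1, hG2, hG3⟩ := exists_compactSupport_primitive
    (g := fun x => g x - (∫ y, g y) * η x) (hg.sub (contDiff_const.mul hηd))
    (hgs.sub hηs.mul_left)
    (by rw [integral_sub hgi (hηi.const_mul _), integral_const_mul, hη1]; ring)
  have h1 := h G hG1 hG2
  rw [hG3] at h1
  simp only [smul_eq_mul, mul_zero, integral_zero, neg_zero] at h1 ⊢
  have h2 : ∫ x, (g x - (∫ y, g y) * η x) * w x
      = (∫ x, g x * w x) - (∫ y, g y) * ∫ x, η x * w x := by
    rw [← integral_const_mul, ← integral_sub (integrable_test_mul hw hg.continuous hgs)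
      ((integrable_test_mul hw hηd.continuous hηs).const_mul _)]
    congr 1; funext x; ring
  rw [integral_mul_const]
  linarith

/-- A locally integrable function with a locally integrable weak derivative is almost everywhere
equal to a primitive of it. -/
theorem HasWeakDeriv.exists_isPrim {u v : ℝ → ℝ} (hu : LocallyIntegrable u volume)
    (hv : LocallyIntegrable v volume) (h : HasWeakDeriv u v) :
    ∃ f : ℝ → ℝ, u =ᵐ[volume] f ∧ IsPrim f v := by
  have hV := IsPrim.integral hv
  set V : ℝ → ℝ := fun x => ∫ t in (0 : ℝ)..x, v t
  have hVl : LocallyIntegrable V volume := hV.continuous.locallyIntegrable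
  -- The difference of `u` and the primitive of `v` has zero weak derivative.
  obtain ⟨c, hc⟩ := HasWeakDeriv.ae_eq_const (hu.sub hVl) (by
    intro ψ hψ hs
    have hd : Continuous (deriv ψ) := hψ.continuous_deriv (by simp)
    have h1 := h ψ hψ hs
    have h2 := hV.hasWeakDeriv ψ hψ hs
    simp only [smul_eq_mul, mul_zero, integral_zero, neg_zero, Pi.sub_apply] at h1 h2 ⊢
    simp_rw [mul_sub]
    rw [integral_sub (integrable_test_mul hu hd hs.deriv) (integrable_test_mul hVl hd hs.deriv),
      h1, h2, sub_self])
  refine ⟨fun x => V x + c, ?_, ⟨hv, fun x y => by rw [← hV.sub_eq x y]; ring⟩⟩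
  filter_upwards [hc] with x hx
  rw [← hx, Pi.sub_apply]; ring

/-- `f` is the continuous representative of a function of `H¹(ℝ; ℝ)`, with weak derivative `f'`. -/
structure IsH1 (f f' : ℝ → ℝ) : Prop where
  prim : IsPrim f f'
  memLp : MemLp f 2 volume
  memLp_deriv : MemLp f' 2 volume

theorem integrable_mul_of_memLp {f g : ℝ → ℝ} (hf : MemLp f 2 volume) (hg : MemLp g 2 volume) :
    Integrable (fun x => f x * g x) :=
  hf.integrable_mul hg

theorem memLp_bdd_mul {m f : ℝ → ℝ} {C : ℝ} (hm : Continuous m) (hC : ∀ x, |m x| ≤ C)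
    (hf : MemLp f 2 volume) : MemLp (fun x => m x * f x) 2 volume :=
  hf.of_le_mul (c := C) (hm.aestronglyMeasurable.mul hf.aestronglyMeasurable)
    (Eventually.of_forall fun x => by
      rw [norm_mul]; exact mul_le_mul_of_nonneg_right (hC x) (norm_nonneg _))

theorem integrable_bdd_mul_mul {m f g : ℝ → ℝ} {C : ℝ} (hm : Continuous m) (hC : ∀ x, |m x| ≤ C)
    (hf : MemLp f 2 volume) (hg : MemLp g 2 volume) : Integrable (fun x => m x * f x * g x) :=
  integrable_mul_of_memLp (memLp_bdd_mul hm hC hf) hg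

theorem integrable_sq_of_memLp {f : ℝ → ℝ} (hf : MemLp f 2 volume) :
    Integrable (fun x => f x ^ 2) := by
  simpa [pow_two] using integrable_mul_of_memLp hf hf

theorem ae_eq_zero_of_integral_sq {f : ℝ → ℝ} (hf : MemLp f 2 volume)
    (h : ∫ x, f x ^ 2 = 0) : f =ᵐ[volume] 0 := by
  rw [integral_eq_zero_iff_of_nonneg (fun x => sq_nonneg _) (integrable_sq_of_memLp hf)] at h
  filter_upwards [h] with x hx
  simpa using hx

namespace IsH1

variable {f f' g g' : ℝ → ℝ}

theorem continuous (h : IsH1 f f') : Continuous f := h.prim.continuous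

theorem add (hf : IsH1 f f') (hg : IsH1 g g') :
    IsH1 (fun x => f x + g x) (fun x => f' x + g' x) :=
  ⟨hf.prim.add hg.prim, hf.memLp.add hg.memLp, hf.memLp_deriv.add hg.memLp_deriv⟩

theorem const_mul (hf : IsH1 f f') (c : ℝ) : IsH1 (fun x => c * f x) (fun x => c * f' x) :=
  ⟨hf.prim.const_mul c, hf.memLp.const_mul c, hf.memLp_deriv.const_mul c⟩

theorem sub (hf : IsH1 f f') (hg : IsH1 g g') :
    IsH1 (fun x => f x - g x) (fun x => f' x - g' x) :=
  ⟨hf.prim.sub hg.prim, hf.memLp.sub hg.memLp, hf.memLp_deriv.sub hg.memLp_deriv⟩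

theorem zero : IsH1 (fun _ => 0) (fun _ => 0) :=
  ⟨IsPrim.of_hasDerivAt (fun _ => hasDerivAt_const _ _) continuous_const, MemLp.zero', MemLp.zero'⟩

theorem congr_deriv (h : IsH1 f f') (hg : f' =ᵐ[volume] g') : IsH1 f g' :=
  ⟨h.prim.congr_deriv hg, h.memLp, h.memLp_deriv.ae_eq hg⟩

theorem bdd_mul {m m' : ℝ → ℝ} {C C' : ℝ} (hf : IsH1 f f') (hm : ∀ x, HasDerivAt m (m' x) x)
    (hm' : Continuous m') (hC : ∀ x, |m x| ≤ C) (hC' : ∀ x, |m' x| ≤ C') :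
    IsH1 (fun x => m x * f x) (fun x => m' x * f x + m x * f' x) := by
  have hc : Continuous m := continuous_iff_continuousAt.2 fun x => (hm x).continuousAt
  exact ⟨(IsPrim.of_hasDerivAt hm hm').mul hf.prim, memLp_bdd_mul hc hC hf.memLp,
    (memLp_bdd_mul hm' hC' hf.memLp).add (memLp_bdd_mul hc hC hf.memLp_deriv)⟩

theorem of_test {ψ : ℝ → ℝ} (hψ : ContDiff ℝ ∞ ψ) (hs : HasCompactSupport ψ) :
    IsH1 ψ (deriv ψ) := by
  have hd : Continuous (deriv ψ) := hψ.continuous_deriv (by simp)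
  exact ⟨IsPrim.of_hasDerivAt (fun x => ((hψ.differentiable (by simp)) x).hasDerivAt) hd,
    hψ.continuous.memLp_of_hasCompactSupport hs, hd.memLp_of_hasCompactSupport hs.deriv⟩

theorem integrable_mul (hf : IsH1 f f') (hg : IsH1 g g') : Integrable (fun x => f x * g x) :=
  integrable_mul_of_memLp hf.memLp hg.memLp

theorem integrable_mul_deriv (hf : IsH1 f f') (hg : IsH1 g g') :
    Integrable (fun x => f' x * g x + f x * g' x) :=
  (integrable_mul_of_memLp hf.memLp_deriv hg.memLp).add
    (integrable_mul_of_memLp hf.memLp hg.memLp_deriv)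

theorem by_parts (hf : IsH1 f f') (hg : IsH1 g g') :
    ∫ x, f' x * g x + f x * g' x = 0 :=
  (hf.prim.mul hg.prim).integral_eq_zero (hf.integrable_mul hg) (hf.integrable_mul_deriv hg)

theorem mul_tendsto_atTop (hf : IsH1 f f') (hg : IsH1 g g') :
    Tendsto (fun x => f x * g x) atTop (𝓝 0) :=
  (hf.prim.mul hg.prim).tendsto_atTop (hf.integrable_mul hg) (hf.integrable_mul_deriv hg)

/-- Integrate `(f²)' = 2 f f' ≤ f² + f'²` from `-∞`. The resulting uniform bound serves as the
domination in the compactness argument. -/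
theorem sq_le (hf : IsH1 f f') (x : ℝ) :
    f x ^ 2 ≤ (∫ y, f y ^ 2) + ∫ y, f' y ^ 2 := by
  have h1 := integrable_sq_of_memLp hf.memLp
  have h2 := integrable_sq_of_memLp hf.memLp_deriv
  rw [pow_two, (hf.prim.mul hf.prim).eq_integral_Iic (hf.integrable_mul hf)
    (hf.integrable_mul_deriv hf) x, ← integral_add h1 h2]
  refine le_trans (setIntegral_mono (hf.integrable_mul_deriv hf).integrableOn
    (h1.add h2).integrableOn fun y => ?_) (setIntegral_le_integral (h1.add h2)
      (Eventually.of_forall fun y => ?_))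
  · simp only [Pi.add_apply]
    nlinarith [sq_nonneg (f y - f' y)]
  · simp only [Pi.add_apply, Pi.zero_apply]
    positivity

theorem eq_zero_of_ae (hf : IsH1 f f') (h : f =ᵐ[volume] 0) (x : ℝ) : f x = 0 :=
  congrFun (hf.continuous.ae_eq_iff_eq volume continuous_const |>.1 h) x

theorem eq_zero_of_integral_sq (hf : IsH1 f f') (h : ∫ x, f x ^ 2 = 0) (x : ℝ) : f x = 0 :=
  hf.eq_zero_of_ae (ae_eq_zero_of_integral_sq hf.memLp h) x

theorem integral_sq_pos (hf : IsH1 f f') {x : ℝ} (hx : f x ≠ 0) : 0 < ∫ x, f x ^ 2 :=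
  lt_of_le_of_ne (integral_nonneg fun _ => sq_nonneg _)
    fun h => hx (hf.eq_zero_of_integral_sq h.symm x)

theorem deriv_ae_eq (hf : IsH1 f f') (hg : IsH1 f g') : f' =ᵐ[volume] g' := by
  filter_upwards [hf.prim.ae_hasDerivAt, hg.prim.ae_hasDerivAt] with x h1 h2
  exact h1.unique h2

end IsH1

theorem HasWeakDeriv.exists_isH1 {u v : ℝ → ℝ} (hu : MemLp u 2 volume) (hv : MemLp v 2 volume)
    (h : HasWeakDeriv u v) : ∃ f : ℝ → ℝ, u =ᵐ[volume] f ∧ IsH1 f v := by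
  obtain ⟨f, hf, hp⟩ := h.exists_isPrim (hu.locallyIntegrable (by norm_num))
    (hv.locallyIntegrable (by norm_num))
  exact ⟨f, hf, hp, hu.ae_eq hf, hv⟩

end Sobolev

end GDNLS

namespace GDNLS

/-! ### Weak sequential compactness in `L²` and `H¹`. -/

section Compactness

open Filter Topology

/-- Sequential Banach–Alaoglu, carried to `H` by the Riesz isomorphism. -/
theorem exists_weakly_convergent_subseq {H : Type*} [NormedAddCommGroup H] [InnerProductSpace ℝ H]
    [CompleteSpace H] [TopologicalSpace.SeparableSpace H] {u : ℕ → H} {C : ℝ}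
    (hu : ∀ n, ‖u n‖ ≤ C) :
    ∃ (f : H) (φ : ℕ → ℕ), StrictMono φ ∧
      ∀ g, Tendsto (fun n => inner ℝ (u (φ n)) g) atTop (𝓝 (inner ℝ f g)) := by
  obtain ⟨a, -, φ, hφ, ha⟩ := WeakDual.isSeqCompact_closedBall ℝ H 0 C
    (x := fun n => StrongDual.toWeakDual (InnerProductSpace.toDual ℝ H (u n)))
    (fun n => by simpa using hu n)
  refine ⟨(InnerProductSpace.toDual ℝ H).symm (WeakDual.toStrongDual a), φ, hφ, fun g => ?_⟩
  have h1 := (WeakDual.eval_continuous g).tendsto a |>.comp ha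
  rw [InnerProductSpace.toDual_symm_apply]
  exact h1

theorem exists_weakly_convergent_subseq_memLp {f : ℕ → ℝ → ℝ} {C : ℝ}
    (hf : ∀ n, MemLp (f n) 2 volume) (hC : ∀ n, ∫ x, f n x ^ 2 ≤ C) :
    ∃ (F : ℝ → ℝ) (φ : ℕ → ℕ), StrictMono φ ∧ MemLp F 2 volume ∧ ∀ g, MemLp g 2 volume →
      Tendsto (fun n => ∫ x, f (φ n) x * g x) atTop (𝓝 (∫ x, F x * g x)) := by
  have hin : ∀ (p q : Lp ℝ 2 (volume : Measure ℝ)), inner ℝ p q = ∫ x, p x * q x := by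
    intro p q
    rw [L2.inner_def]
    simp [mul_comm]
  have hn : ∀ n, ‖(hf n).toLp (f n)‖ ≤ √C := by
    intro n
    refine Real.le_sqrt_of_sq_le ?_
    rw [← real_inner_self_eq_norm_sq, hin]
    refine le_trans (le_of_eq (integral_congr_ae ?_)) (hC n)
    filter_upwards [(hf n).coeFn_toLp] with x hx
    rw [hx, pow_two]
  have : Fact ((2 : ENNReal) ≠ ⊤) := ⟨by norm_num⟩
  obtain ⟨F, φ, hφ, h⟩ := exists_weakly_convergent_subseq hn
  refine ⟨F, φ, hφ, Lp.memLp F, fun g hg => ?_⟩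
  have h1 := h (hg.toLp g)
  simp only [hin] at h1
  have h2 : ∀ n, ∫ x, (hf (φ n)).toLp (f (φ n)) x * hg.toLp g x = ∫ x, f (φ n) x * g x := by
    intro n
    refine integral_congr_ae ?_
    filter_upwards [(hf (φ n)).coeFn_toLp, hg.coeFn_toLp] with x h1 h2
    rw [h1, h2]
  have h3 : ∫ x, F x * hg.toLp g x = ∫ x, F x * g x := by
    refine integral_congr_ae ?_
    filter_upwards [hg.coeFn_toLp] with x h2
    rw [h2]
  simpa only [h2, h3] using h1

/-- The integrand is the derivative of `(t - (x - 1)) f t`, which vanishes at the left end and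
equals `f x` at the right end. -/
theorem IsPrim.eq_integral_window {f f' : ℝ → ℝ} (h : IsPrim f f') (x : ℝ) :
    f x = ∫ t in (x - 1)..x, f t + (t - (x - 1)) * f' t := by
  have h1 : IsPrim (fun t => t - (x - 1)) (fun _ => (1 : ℝ)) :=
    IsPrim.of_hasDerivAt (fun t => (hasDerivAt_id t).sub_const _) continuous_const
  have h2 := (h1.mul h).sub_eq (x - 1) x
  simpa using h2

/-- Point evaluation is a sum of `L²` pairings of `f` and `f'` with fixed functions, so weak
convergence of both yields pointwise convergence. -/
theorem IsH1.eq_integral_mul_window {f f' : ℝ → ℝ} (h : IsH1 f f') (x : ℝ) :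
    f x = (∫ t, f t * (Ioc (x - 1) x).indicator (fun _ => 1) t)
      + ∫ t, f' t * (Ioc (x - 1) x).indicator (fun t => t - (x - 1)) t := by
  have h1 : ∀ (p q : ℝ → ℝ), (fun t => p t * (Ioc (x - 1) x).indicator q t)
      = (Ioc (x - 1) x).indicator fun t => p t * q t := by
    intro p q
    funext t
    by_cases ht : t ∈ Ioc (x - 1) x <;> simp [ht]
  rw [h1, h1, integral_indicator measurableSet_Ioc, integral_indicator measurableSet_Ioc,
    h.prim.eq_integral_window x, intervalIntegral.integral_of_le (by linarith), ← integral_add]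
  · simp [mul_comm]
  · have := (h.continuous.intervalIntegrable (μ := volume) (x - 1) x).1
    simpa [IntegrableOn] using this
  · exact ((h.prim.intervalIntegrable (x - 1) x).mul_continuousOn
      (continuous_id.sub continuous_const).continuousOn).1

theorem memLp_indicator_Ioc {g : ℝ → ℝ} (hg : Continuous g) (a b : ℝ) :
    MemLp ((Ioc a b).indicator g) 2 volume := by
  rw [memLp_indicator_iff_restrict measurableSet_Ioc]
  obtain ⟨C, hC⟩ := (isCompact_Icc (a := a) (b := b)).exists_bound_of_continuousOn hg.continuousOn
  exact MemLp.of_bound hg.aestronglyMeasurable C ((ae_restrict_iff' measurableSet_Ioc).2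
    (Eventually.of_forall fun x hx => hC x (Ioc_subset_Icc_self hx)))

/-- Weak sequential compactness of bounded sets of `H¹(ℝ; ℝ)`, with pointwise convergence. -/
theorem exists_h1_subseq {f f' : ℕ → ℝ → ℝ} {C : ℝ} (hf : ∀ n, IsH1 (f n) (f' n))
    (hC : ∀ n, ∫ x, f n x ^ 2 ≤ C) (hC' : ∀ n, ∫ x, f' n x ^ 2 ≤ C) :
    ∃ (F F' : ℝ → ℝ) (φ : ℕ → ℕ), StrictMono φ ∧ IsH1 F F' ∧
      (∀ x, Tendsto (fun n => f (φ n) x) atTop (𝓝 (F x))) ∧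
      (∀ g, MemLp g 2 volume →
        Tendsto (fun n => ∫ x, f (φ n) x * g x) atTop (𝓝 (∫ x, F x * g x))) ∧
      (∀ g, MemLp g 2 volume →
        Tendsto (fun n => ∫ x, f' (φ n) x * g x) atTop (𝓝 (∫ x, F' x * g x))) := by
  obtain ⟨F, φ, hφ, hF, hl⟩ := exists_weakly_convergent_subseq_memLp (fun n => (hf n).memLp) hC
  obtain ⟨F', ψ, hψ, hF', hl'⟩ := exists_weakly_convergent_subseq_memLp
    (fun n => (hf (φ n)).memLp_deriv) (fun n => hC' (φ n))
  replace hl : ∀ g, MemLp g 2 volume →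
      Tendsto (fun n => ∫ x, f (φ (ψ n)) x * g x) atTop (𝓝 (∫ x, F x * g x)) :=
    fun g hg => (hl g hg).comp hψ.tendsto_atTop
  have hw : HasWeakDeriv F F' := by
    intro η hη hs
    have hd : Continuous (deriv η) := hη.continuous_deriv (by simp)
    have h1 := hl _ (hd.memLp_of_hasCompactSupport hs.deriv)
    have h2 := (hl' _ (hη.continuous.memLp_of_hasCompactSupport hs)).neg
    have h3 : ∀ n, ∫ x, f (φ (ψ n)) x * deriv η x = -∫ x, f' (φ (ψ n)) x * η x := by
      intro n
      have := (hf (φ (ψ n))).prim.hasWeakDeriv η hη hs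
      simpa [mul_comm] using this
    simp_rw [h3] at h1
    have := tendsto_nhds_unique h1 h2
    simpa [mul_comm] using this
  obtain ⟨G, hG, hGH⟩ := hw.exists_isH1 hF hF'
  have hl2 : ∀ g, MemLp g 2 volume →
      Tendsto (fun n => ∫ x, f (φ (ψ n)) x * g x) atTop (𝓝 (∫ x, G x * g x)) := by
    intro g hg
    have : ∫ x, G x * g x = ∫ x, F x * g x :=
      integral_congr_ae (by filter_upwards [hG] with x hx; rw [hx])
    rw [this]
    exact hl g hg
  refine ⟨G, F', φ ∘ ψ, hφ.comp hψ, hGH, fun x => ?_, hl2, hl'⟩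
  rw [hGH.eq_integral_mul_window x]
  simp_rw [fun n => (hf ((φ ∘ ψ) n)).eq_integral_mul_window x]
  exact (hl2 _ (memLp_indicator_Ioc continuous_const _ _)).add
    (hl' _ (memLp_indicator_Ioc (continuous_id.sub continuous_const) _ _))

end Compactness

/-! ### Variational theory of `-∂² + U` for a short range potential. -/

section Energy

open Filter Topology

/-- The bilinear form of `-∂² + U`. -/
noncomputable def energy (U f f' g g' : ℝ → ℝ) : ℝ := ∫ x, f' x * g' x + U x * f x * g x

/-- `U` is a continuous bounded potential and `k - U` is integrable. -/
structure IsShortRange (U : ℝ → ℝ) (k C : ℝ) : Prop where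
  continuous : Continuous U
  bound : ∀ x, |U x| ≤ C
  integrable : Integrable fun x => k - U x

variable {U : ℝ → ℝ} {k C : ℝ} {f f' g g' h h' : ℝ → ℝ}

theorem energy_comm : energy U f f' g g' = energy U g g' f f' := by
  unfold energy
  congr 1; funext x; ring

namespace IsShortRange

theorem integrable_energy (hU : IsShortRange U k C) (hf : IsH1 f f') (hg : IsH1 g g') :
    Integrable (fun x => f' x * g' x + U x * f x * g x) :=
  (integrable_mul_of_memLp hf.memLp_deriv hg.memLp_deriv).add
    (integrable_bdd_mul_mul hU.continuous hU.bound hf.memLp hg.memLp)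

theorem energy_add_left (hU : IsShortRange U k C) (hf : IsH1 f f') (hg : IsH1 g g')
    (hh : IsH1 h h') :
    energy U (fun x => f x + g x) (fun x => f' x + g' x) h h'
      = energy U f f' h h' + energy U g g' h h' := by
  unfold energy
  rw [← integral_add (hU.integrable_energy hf hh) (hU.integrable_energy hg hh)]
  congr 1; funext x; ring

theorem energy_const_mul_left (c : ℝ) :
    energy U (fun x => c * f x) (fun x => c * f' x) g g' = c * energy U f f' g g' := by
  unfold energy
  rw [← integral_const_mul]
  congr 1; funext x; ring

theorem energy_comb (hU : IsShortRange U k C) (hf : IsH1 f f') (hg : IsH1 g g') (s t : ℝ) :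
    energy U (fun x => s * f x + t * g x) (fun x => s * f' x + t * g' x)
      (fun x => s * f x + t * g x) (fun x => s * f' x + t * g' x)
      = s ^ 2 * energy U f f' f f' + 2 * s * t * energy U f f' g g'
        + t ^ 2 * energy U g g' g g' := by
  have hs := hf.const_mul s
  have ht := hg.const_mul t
  rw [hU.energy_add_left hs ht (hs.add ht), energy_const_mul_left, energy_const_mul_left,
    energy_comm, energy_comm (f := g), hU.energy_add_left hs ht hf, hU.energy_add_left hs ht hg]
  simp only [energy_const_mul_left]
  rw [energy_comm (f := g) (g := f)]
  ring

theorem energy_eq (hU : IsShortRange U k C) (hf : IsH1 f f') :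
    energy U f f' f f' = (∫ x, f' x ^ 2) + ∫ x, U x * f x ^ 2 := by
  unfold energy
  rw [← integral_add (integrable_sq_of_memLp hf.memLp_deriv)]
  · congr 1; funext x; ring
  · have := integrable_bdd_mul_mul hU.continuous hU.bound hf.memLp hf.memLp
    refine this.congr (Eventually.of_forall fun x => ?_)
    simp only; ring

theorem abs_integral_le (hU : IsShortRange U k C) (hf : IsH1 f f') :
    |∫ x, U x * f x ^ 2| ≤ C * ∫ x, f x ^ 2 := by
  rw [← integral_const_mul, ← Real.norm_eq_abs]
  refine norm_integral_le_of_norm_le ((integrable_sq_of_memLp hf.memLp).const_mul C)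
    (Eventually.of_forall fun x => ?_)
  rw [norm_mul, Real.norm_eq_abs, Real.norm_of_nonneg (sq_nonneg _)]
  exact mul_le_mul_of_nonneg_right (hU.bound x) (sq_nonneg _)

theorem nonneg (hU : IsShortRange U k C) : 0 ≤ C := (abs_nonneg _).trans (hU.bound 0)

theorem energy_ge (hU : IsShortRange U k C) (hf : IsH1 f f') :
    (∫ x, f' x ^ 2) - C * ∫ x, f x ^ 2 ≤ energy U f f' f f' := by
  rw [hU.energy_eq hf]
  linarith [(abs_le.1 (hU.abs_integral_le hf)).1]

theorem bound_sub (hU : IsShortRange U k C) (x : ℝ) : |k - U x| ≤ |k| + C :=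
  (abs_sub _ _).trans (by linarith [hU.bound x])

theorem energy_eq' (hU : IsShortRange U k C) (hf : IsH1 f f') :
    energy U f f' f f' = (∫ x, f' x ^ 2) + k * (∫ x, f x ^ 2) - ∫ x, (k - U x) * f x ^ 2 := by
  have h2 := (integrable_sq_of_memLp hf.memLp).const_mul k
  have h3 : Integrable fun x => (k - U x) * f x ^ 2 := by
    have := integrable_bdd_mul_mul (continuous_const.sub hU.continuous) hU.bound_sub
      hf.memLp hf.memLp
    refine this.congr (Eventually.of_forall fun x => ?_)
    simp only [Pi.sub_apply]; ring
  rw [hU.energy_eq hf, add_sub_assoc, ← integral_const_mul, ← integral_sub h2 h3]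
  congr 2; funext x; ring

/-- Integrability of `k - U` makes the potential term continuous along bounded pointwise convergent
sequences, so no tightness of the sequence is needed. -/
theorem tendsto_integral (hU : IsShortRange U k C) {f : ℕ → ℝ → ℝ} {F : ℝ → ℝ} {B : ℝ}
    (hf : ∀ n, Continuous (f n)) (hB : ∀ n x, f n x ^ 2 ≤ B)
    (hl : ∀ x, Tendsto (fun n => f n x) atTop (𝓝 (F x))) :
    Tendsto (fun n => ∫ x, (k - U x) * f n x ^ 2) atTop (𝓝 (∫ x, (k - U x) * F x ^ 2)) := by
  refine tendsto_integral_of_dominated_convergence (fun x => |k - U x| * B)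
    (fun n => ((continuous_const.sub hU.continuous).mul ((hf n).pow 2)).aestronglyMeasurable)
    (hU.integrable.abs.mul_const B) (fun n => Eventually.of_forall fun x => ?_)
    (Eventually.of_forall fun x => ((hl x).pow 2).const_mul _)
  rw [norm_mul, Real.norm_eq_abs, Real.norm_of_nonneg (sq_nonneg _)]
  exact mul_le_mul_of_nonneg_left (hB n x) (abs_nonneg _)

/-- Below the bottom `k` of the essential spectrum, the infimum of the Rayleigh quotient on the
orthogonal complement of `S` is attained. -/
theorem exists_minimizer (hU : IsShortRange U k C) {S : Set (ℝ → ℝ)}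
    (hS : ∀ s ∈ S, MemLp s 2 volume) {v v' : ℝ → ℝ} (hv : IsH1 v v')
    (hvS : ∀ s ∈ S, ∫ x, v x * s x = 0)
    (hlt : energy U v v' v v' < k * ∫ x, v x ^ 2) :
    ∃ u u' : ℝ → ℝ, IsH1 u u' ∧ (∀ s ∈ S, ∫ x, u x * s x = 0) ∧ ∫ x, u x ^ 2 = 1 ∧
      ∀ f f' : ℝ → ℝ, IsH1 f f' → (∀ s ∈ S, ∫ x, f x * s x = 0) →
        energy U u u' u u' * ∫ x, f x ^ 2 ≤ energy U f f' f f' := by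
  set E : Set ℝ := {e | ∃ f f' : ℝ → ℝ, IsH1 f f' ∧ (∀ s ∈ S, ∫ x, f x * s x = 0) ∧
    ∫ x, f x ^ 2 = 1 ∧ energy U f f' f f' = e} with hE
  have hnormalize : ∀ f f' : ℝ → ℝ, IsH1 f f' → (∀ s ∈ S, ∫ x, f x * s x = 0) →
      0 < ∫ x, f x ^ 2 → energy U f f' f f' / ∫ x, f x ^ 2 ∈ E := by
    intro f f' hf hfS hpos
    set c := (√(∫ x, f x ^ 2))⁻¹ with hc
    have hc2 : c ^ 2 = (∫ x, f x ^ 2)⁻¹ := by rw [hc, inv_pow, Real.sq_sqrt hpos.le]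
    refine ⟨_, _, hf.const_mul c, fun s hs => ?_, ?_, ?_⟩
    · simp_rw [mul_assoc]; rw [integral_const_mul, hfS s hs, mul_zero]
    · simp_rw [mul_pow]; rw [integral_const_mul, hc2, inv_mul_cancel₀ hpos.ne']
    · rw [energy_const_mul_left, energy_comm, energy_const_mul_left, ← mul_assoc, ← pow_two, hc2,
        div_eq_inv_mul]
  have hbdd : BddBelow E := ⟨-C, by
    rintro e ⟨f, f', hf, -, h1, rfl⟩
    have := hU.energy_ge hf
    rw [h1] at this
    have h2 : 0 ≤ ∫ x, f' x ^ 2 := integral_nonneg fun _ => sq_nonneg _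
    linarith⟩
  have hvpos : 0 < ∫ x, v x ^ 2 := by
    refine lt_of_le_of_ne (integral_nonneg fun _ => sq_nonneg _) fun h0 => ?_
    have h1 := hU.energy_ge hv
    have h2 : 0 ≤ ∫ x, v' x ^ 2 := integral_nonneg fun _ => sq_nonneg _
    rw [← h0] at h1 hlt
    linarith
  have hvE := hnormalize v v' hv hvS hvpos
  have hmk : sInf E < k := (csInf_le hbdd hvE).trans_lt ((div_lt_iff₀ hvpos).2 hlt)
  obtain ⟨e, -, hel, heE⟩ := exists_seq_tendsto_sInf ⟨_, hvE⟩ hbdd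
  set m := sInf E
  choose u u' hu huS hu1 hue using heE
  obtain ⟨B, hB⟩ := hel.bddAbove_range
  have hB' : ∀ n, e n ≤ B := fun n => hB ⟨n, rfl⟩
  have hC0 := hU.nonneg
  have hD : ∀ n, ∫ x, u' n x ^ 2 ≤ |B| + C := fun n => by
    have := hU.energy_ge (hu n)
    rw [hu1, hue] at this
    linarith [hB' n, le_abs_self B]
  obtain ⟨F, F', φ, hφ, hF, hp, hw, hw'⟩ := exists_h1_subseq (C := |B| + C + 1) hu
    (fun n => by rw [hu1]; linarith [abs_nonneg B]) (fun n => by linarith [hD n])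
  -- Weak lower semicontinuity of the `L²` norm, from `2 a A - A² ≤ a²`.
  have hsq : ∀ (a : ℕ → ℝ → ℝ) (A : ℝ → ℝ), (∀ n, MemLp (a n) 2 volume) → MemLp A 2 volume →
      Tendsto (fun n => ∫ x, a n x * A x) atTop (𝓝 (∫ x, A x * A x)) → ∀ L,
      Tendsto (fun n => ∫ x, a n x ^ 2) atTop (𝓝 L) → ∫ x, A x ^ 2 ≤ L := by
    intro a A ha hA h1 L h2
    have h3 : ∀ n, 2 * (∫ x, a n x * A x) - ∫ x, A x * A x ≤ ∫ x, a n x ^ 2 := by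
      intro n
      rw [← integral_const_mul, ← integral_sub ((integrable_mul_of_memLp (ha n) hA).const_mul 2)
        (integrable_mul_of_memLp hA hA)]
      refine integral_mono (((integrable_mul_of_memLp (ha n) hA).const_mul 2).sub
        (integrable_mul_of_memLp hA hA)) (integrable_sq_of_memLp (ha n)) fun x => ?_
      simp only
      nlinarith [sq_nonneg (a n x - A x)]
    have h4 := le_of_tendsto_of_tendsto' ((h1.const_mul 2).sub_const _) h2 h3
    simp_rw [pow_two]
    linarith
  have hFS : ∀ s ∈ S, ∫ x, F x * s x = 0 := fun s hs => by
    refine tendsto_nhds_unique (hw s (hS s hs)) ?_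
    simp_rw [fun n => huS n s hs]
    exact tendsto_const_nhds
  have hF1 : ∫ x, F x ^ 2 ≤ 1 :=
    hsq (fun n => u (φ n)) F (fun n => (hu _).memLp) hF.memLp (hw F hF.memLp) 1
      (by simp_rw [hu1]; exact tendsto_const_nhds)
  have hpot := hU.tendsto_integral (f := fun n => u (φ n)) (B := 1 + (|B| + C))
    (fun n => (hu _).continuous)
    (fun n x => ((hu _).sq_le x).trans (by rw [hu1]; linarith [hD (φ n)])) hp
  have hF'1 : ∫ x, F' x ^ 2 ≤ m - k + ∫ x, (k - U x) * F x ^ 2 := by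
    refine hsq (fun n => u' (φ n)) F' (fun n => (hu _).memLp_deriv)
      hF.memLp_deriv (hw' F' hF.memLp_deriv) _ ?_
    have h1 : ∀ n, ∫ x, u' (φ n) x ^ 2
        = e (φ n) - k + ∫ x, (k - U x) * u (φ n) x ^ 2 := fun n => by
      have := hU.energy_eq' (hu (φ n))
      rw [hue, hu1] at this
      linarith
    simp_rw [h1]
    exact ((hel.comp hφ.tendsto_atTop).sub_const k).add hpot
  have hEF := hU.energy_eq' hF
  have hFm : ∀ f f' : ℝ → ℝ, IsH1 f f' → (∀ s ∈ S, ∫ x, f x * s x = 0) →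
      m * ∫ x, f x ^ 2 ≤ energy U f f' f f' := by
    intro f f' hf hfS
    rcases (integral_nonneg fun x => sq_nonneg (f x) : 0 ≤ ∫ x, f x ^ 2).eq_or_lt with h0 | h0
    · have h1 := hU.energy_ge hf
      rw [← h0] at h1 ⊢
      have h2 : 0 ≤ ∫ x, f' x ^ 2 := integral_nonneg fun _ => sq_nonneg _
      linarith
    · rw [← le_div_iff₀ h0]
      exact csInf_le hbdd (hnormalize f f' hf hfS h0)
  have h1 := hFm F F' hF hFS
  -- No mass is lost: the two bounds on the energy of `F` give `m ∫ F² ≤ m - k + k ∫ F²`, that is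
  -- `(k - m)(1 - ∫ F²) ≤ 0`, while `m < k`.
  have hFone : ∫ x, F x ^ 2 = 1 := by
    refine le_antisymm hF1 ?_
    by_contra hn
    rw [not_le] at hn
    nlinarith
  refine ⟨F, F', hF, hFS, hFone, fun f f' hf hfS => le_trans ?_ (hFm f f' hf hfS)⟩
  refine mul_le_mul_of_nonneg_right ?_ (integral_nonneg fun _ => sq_nonneg _)
  rw [hFone] at hEF
  linarith

/-- A form that is positive on the orthogonal complement of `S` is coercive on it. -/
theorem exists_coercive (hU : IsShortRange U k C) (hk : 0 < k) {S : Set (ℝ → ℝ)}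
    (hS : ∀ s ∈ S, MemLp s 2 volume)
    (hpos : ∀ f f' : ℝ → ℝ, IsH1 f f' → (∀ s ∈ S, ∫ x, f x * s x = 0) →
      0 < ∫ x, f x ^ 2 → 0 < energy U f f' f f') :
    ∃ δ : ℝ, 0 < δ ∧ ∀ f f' : ℝ → ℝ, IsH1 f f' → (∀ s ∈ S, ∫ x, f x * s x = 0) →
      δ * ((∫ x, f x ^ 2) + ∫ x, f' x ^ 2) ≤ energy U f f' f f' := by
  obtain ⟨m, hm, hmE⟩ : ∃ m : ℝ, 0 < m ∧ ∀ f f' : ℝ → ℝ, IsH1 f f' →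
      (∀ s ∈ S, ∫ x, f x * s x = 0) → m * ∫ x, f x ^ 2 ≤ energy U f f' f f' := by
    -- Either the Rayleigh quotient goes below `k`, and then its infimum is attained and hence
    -- positive, or `k` itself is a lower bound.
    by_cases hex : ∃ v v' : ℝ → ℝ, IsH1 v v' ∧ (∀ s ∈ S, ∫ x, v x * s x = 0) ∧
        energy U v v' v v' < k * ∫ x, v x ^ 2
    · obtain ⟨v, v', hv, hvS, hlt⟩ := hex
      obtain ⟨u, u', hu, huS, hu1, hmin⟩ := hU.exists_minimizer hS hv hvS hlt
      exact ⟨_, hpos u u' hu huS (by rw [hu1]; exact one_pos), hmin⟩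
    · push Not at hex
      exact ⟨k, hk, hex⟩
  have hC := hU.nonneg
  -- The constant comes from `∫ f² + ∫ f'² ≤ E + (C + 1) ∫ f² ≤ (1 + (C + 1)/m) E`, with `E` the
  -- energy of `f`.
  have hq : 0 < 1 + (C + 1) / m := by positivity
  refine ⟨(1 + (C + 1) / m)⁻¹, inv_pos.2 hq, fun f f' hf hfS => ?_⟩
  rw [inv_mul_le_iff₀ hq]
  have h1 := hmE f f' hf hfS
  have h2 := hU.energy_ge hf
  have h3 : (C + 1) / m * (m * ∫ x, f x ^ 2) ≤ (C + 1) / m * energy U f f' f f' :=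
    mul_le_mul_of_nonneg_left h1 (by positivity)
  have h4 : (C + 1) / m * (m * ∫ x, f x ^ 2) = (C + 1) * ∫ x, f x ^ 2 := by
    field_simp
  linarith

/-- A weak solution of `-f'' + U f = μ f` has a derivative in `H¹`. -/
theorem exists_isH1_deriv (hU : IsShortRange U k C) (hf : IsH1 f f') (μ : ℝ)
    (h : ∀ g g' : ℝ → ℝ, IsH1 g g' → energy U f f' g g' = μ * ∫ x, f x * g x) :
    ∃ f₁ : ℝ → ℝ, IsH1 f f₁ ∧ IsH1 f₁ fun x => (U x - μ) * f x := by
  have hm : MemLp (fun x => (U x - μ) * f x) 2 volume :=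
    memLp_bdd_mul (C := C + |μ|) (hU.continuous.sub continuous_const)
      (fun x => (abs_sub _ _).trans (by linarith [hU.bound x])) hf.memLp
  -- Testing the equation against smooth compactly supported functions reads off the weak derivative
  -- of `f'`; `f₁` is then the continuous representative of `f'`.
  have hw : HasWeakDeriv f' fun x => (U x - μ) * f x := by
    intro ψ hψ hs
    have hψ1 := IsH1.of_test hψ hs
    have h1 := h ψ (deriv ψ) hψ1
    have hi : Integrable fun x => U x * f x * ψ x :=
      integrable_bdd_mul_mul hU.continuous hU.bound hf.memLp hψ1.memLp
    rw [energy, integral_add (integrable_mul_of_memLp hf.memLp_deriv hψ1.memLp_deriv) hi,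
      ← integral_const_mul] at h1
    simp only [smul_eq_mul]
    have h2 : ∫ x, ψ x * ((U x - μ) * f x)
        = (∫ x, U x * f x * ψ x) - ∫ x, μ * (f x * ψ x) := by
      rw [← integral_sub hi ((hf.integrable_mul hψ1).const_mul μ)]
      congr 1; funext x; ring
    rw [h2]
    simp_rw [mul_comm (deriv ψ _)]
    linarith
  obtain ⟨f₁, hae, hf₁⟩ := hw.exists_isH1 hf.memLp_deriv hm
  exact ⟨f₁, hf.congr_deriv hae, hf₁⟩

/-- A minimizer on the orthogonal complement of `S` is a critical point there. -/
theorem energy_eq_of_minimizer (hU : IsShortRange U k C) (hf : IsH1 f f') (hg : IsH1 g g') {m : ℝ}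
    (hfm : energy U f f' f f' = m * ∫ x, f x ^ 2)
    (h : ∀ t : ℝ, m * ∫ x, (f x + t * g x) ^ 2 ≤ energy U (fun x => f x + t * g x)
      (fun x => f' x + t * g' x) (fun x => f x + t * g x) (fun x => f' x + t * g' x)) :
    energy U f f' g g' = m * ∫ x, f x * g x := by
  have h1 : ∀ t : ℝ, 0 ≤ 2 * (energy U f f' g g' - m * ∫ x, f x * g x) * t
      + (energy U g g' g g' - m * ∫ x, g x ^ 2) * t ^ 2 := by
    intro t
    have h2 := h t
    have h3 := hU.energy_comb hf hg 1 t
    simp only [one_mul] at h3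
    have h4 : ∫ x, (f x + t * g x) ^ 2
        = (∫ x, f x ^ 2) + 2 * t * (∫ x, f x * g x) + t ^ 2 * ∫ x, g x ^ 2 := by
      have i1 := integrable_sq_of_memLp hf.memLp
      have i2 := (hf.integrable_mul hg).const_mul (2 * t)
      have i3 := (integrable_sq_of_memLp hg.memLp).const_mul (t ^ 2)
      rw [← integral_const_mul, ← integral_const_mul, ← integral_add i1 i2,
        ← integral_add (by exact i1.add i2) i3]
      congr 1; funext x; ring
    rw [h3, h4, hfm] at h2
    linarith
  set p := energy U f f' g g' - m * ∫ x, f x * g x with hp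
  set q := energy U g g' g g' - m * ∫ x, g x ^ 2
  suffices p = 0 by linarith
  -- A quadratic `2 p t + q t²` that is nonnegative for all `t` has `p = 0`. This small `t`, of sign
  -- opposite to `p`, makes the linear term dominate whatever the sign of `q`.
  have h5 := h1 (-p / (|q| + 1))
  have h6 : 0 < |q| + 1 := by positivity
  have h7 : 2 * p * (-p / (|q| + 1)) + q * (-p / (|q| + 1)) ^ 2
      = -(p ^ 2 * (2 * (|q| + 1) - q)) / (|q| + 1) ^ 2 := by
    field_simp
    ring
  rw [h7, le_div_iff₀ (by positivity), zero_mul] at h5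
  have h8 : 0 < 2 * (|q| + 1) - q := by linarith [le_abs_self q, abs_nonneg q]
  have h9 : p ^ 2 ≤ 0 := by
    by_contra hn
    rw [not_le] at hn
    nlinarith [mul_pos hn h8]
  exact pow_eq_zero_iff (two_ne_zero) |>.1 (le_antisymm h9 (sq_nonneg p))

end IsShortRange

end Energy

end GDNLS

namespace GDNLS

/-! ### The soliton profile and its differential identities. -/

section Profile

open Filter Topology

/-- The potential of `L̃₁₁` in terms of `W = φ^{2σ}`. -/
noncomputable def potV (σ ω c : ℝ) (W : ℝ → ℝ) (y : ℝ) : ℝ :=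
  ω - c ^ 2 / 4 + c * (2 * σ + 1) / 2 * W y
    - (8 * σ ^ 2 + 6 * σ + 1) / (4 * (σ + 1) ^ 2) * W y ^ 2

/-- The potential `φ'' / φ` in terms of `W = φ^{2σ}`. -/
noncomputable def potU (σ ω c : ℝ) (W : ℝ → ℝ) (y : ℝ) : ℝ :=
  ω - c ^ 2 / 4 + c / 2 * W y - (2 * σ + 1) / (4 * (σ + 1) ^ 2) * W y ^ 2

/-- The properties of the profile `φ`, of `W = φ^{2σ}` and of `r = φ' / φ`. -/
structure IsSoliton (σ ω c : ℝ) (φ W r : ℝ → ℝ) : Prop where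
  σ_pos : 0 < σ
  lt_ω : c ^ 2 / 4 < ω
  φ_pos : ∀ y, 0 < φ y
  W_eq : ∀ y, W y = φ y ^ (2 * σ)
  hasDerivAt_φ : ∀ y, HasDerivAt φ (r y * φ y) y
  hasDerivAt_r : ∀ y,
    HasDerivAt r (σ * c / (2 * (σ + 1)) * W y - σ / (2 * (σ + 1) ^ 2) * W y ^ 2) y
  r_sq : ∀ y, r y ^ 2
    = ω - c ^ 2 / 4 + c / (2 * (σ + 1)) * W y - 1 / (4 * (σ + 1) ^ 2) * W y ^ 2
  r_neg : ∀ y, 0 < y → r y < 0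
  r_odd : ∀ y, r (-y) = -r y
  φ_even : ∀ y, φ (-y) = φ y
  deriv_r_zero_neg : σ * c / (2 * (σ + 1)) * W 0 - σ / (2 * (σ + 1) ^ 2) * W 0 ^ 2 < 0
  W_le : ∃ C, ∀ y, W y ≤ C
  W_integrable : Integrable W
  W_tendsto : Tendsto W atTop (𝓝 0)
  φ_sq_integrable : Integrable fun y => φ y ^ 2

namespace IsSoliton

variable {σ ω c : ℝ} {φ W r : ℝ → ℝ}

theorem W_pos (h : IsSoliton σ ω c φ W r) (y : ℝ) : 0 < W y := by
  rw [h.W_eq]; exact Real.rpow_pos_of_pos (h.φ_pos y) _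

theorem W_even (h : IsSoliton σ ω c φ W r) (y : ℝ) : W (-y) = W y := by
  rw [h.W_eq, h.W_eq, h.φ_even]

theorem hasDerivAt_W (h : IsSoliton σ ω c φ W r) (y : ℝ) :
    HasDerivAt W (2 * σ * r y * W y) y := by
  have h1 : W = fun y => φ y ^ (2 * σ) := funext h.W_eq
  rw [h1]
  have h2 := (h.hasDerivAt_φ y).rpow_const (p := 2 * σ) (Or.inl (h.φ_pos y).ne')
  convert h2 using 1
  rw [Real.rpow_sub_one (h.φ_pos y).ne']
  have := (h.φ_pos y).ne'
  field_simp

theorem continuous_φ (h : IsSoliton σ ω c φ W r) : Continuous φ :=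
  continuous_iff_continuousAt.2 fun y => (h.hasDerivAt_φ y).continuousAt

theorem continuous_W (h : IsSoliton σ ω c φ W r) : Continuous W :=
  continuous_iff_continuousAt.2 fun y => (h.hasDerivAt_W y).continuousAt

theorem continuous_r (h : IsSoliton σ ω c φ W r) : Continuous r :=
  continuous_iff_continuousAt.2 fun y => (h.hasDerivAt_r y).continuousAt

theorem W_bound (h : IsSoliton σ ω c φ W r) : ∃ C, 0 ≤ C ∧ ∀ y, |W y| ≤ C := by
  obtain ⟨C, hC⟩ := h.W_le
  exact ⟨C, (h.W_pos 0).le.trans (hC 0), fun y => by rw [abs_of_pos (h.W_pos y)]; exact hC y⟩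

theorem quad_bound (h : IsSoliton σ ω c φ W r) (a b d : ℝ) :
    ∃ C, 0 ≤ C ∧ ∀ y, |a + b * W y + d * W y ^ 2| ≤ C := by
  obtain ⟨C, hC0, hC⟩ := h.W_bound
  refine ⟨|a| + |b| * C + |d| * C ^ 2, by positivity, fun y => ?_⟩
  have h1 : |W y ^ 2| ≤ C ^ 2 := by
    rw [abs_pow]; exact pow_le_pow_left₀ (abs_nonneg _) (hC y) 2
  calc |a + b * W y + d * W y ^ 2| ≤ |a| + |b * W y| + |d * W y ^ 2| := abs_add_three _ _ _
    _ ≤ _ := by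
      rw [abs_mul, abs_mul]
      gcongr
      exact hC y

theorem r_bound (h : IsSoliton σ ω c φ W r) : ∃ C, 0 ≤ C ∧ ∀ y, |r y| ≤ C := by
  obtain ⟨C, hC0, hC⟩ := h.quad_bound (ω - c ^ 2 / 4) (c / (2 * (σ + 1))) (-(1 / (4 * (σ + 1) ^ 2)))
  refine ⟨C + 1, by positivity, fun y => abs_le_of_sq_le_sq ?_ (by positivity)⟩
  have h1 := (le_abs_self _).trans (hC y)
  rw [h.r_sq]
  nlinarith

theorem W_sq_integrable (h : IsSoliton σ ω c φ W r) : Integrable fun y => W y ^ 2 := by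
  obtain ⟨C, -, hC⟩ := h.W_bound
  have := h.W_integrable.bdd_mul (c := C) h.continuous_W.aestronglyMeasurable
    (Eventually.of_forall hC)
  simpa [pow_two] using this

theorem isShortRange_quad (h : IsSoliton σ ω c φ W r) (b d : ℝ) :
    ∃ C, IsShortRange (fun y => ω - c ^ 2 / 4 + b * W y - d * W y ^ 2) (ω - c ^ 2 / 4) C := by
  obtain ⟨C, -, hC⟩ := h.quad_bound (ω - c ^ 2 / 4) b (-d)
  have hc := h.continuous_W
  refine ⟨C, by fun_prop, fun y => ?_, ?_⟩
  · have := hC y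
    rwa [neg_mul, ← sub_eq_add_neg] at this
  · refine ((h.W_sq_integrable.const_mul d).sub (h.W_integrable.const_mul b)).congr
      (Eventually.of_forall fun y => ?_)
    simp only [Pi.sub_apply]; ring

theorem isShortRange_V (h : IsSoliton σ ω c φ W r) :
    ∃ C, IsShortRange (potV σ ω c W) (ω - c ^ 2 / 4) C := h.isShortRange_quad _ _

theorem isShortRange_U (h : IsSoliton σ ω c φ W r) :
    ∃ C, IsShortRange (potU σ ω c W) (ω - c ^ 2 / 4) C := h.isShortRange_quad _ _

/-- The Riccati equation `r' + r² = φ'' / φ`. -/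
theorem hasDerivAt_r' (h : IsSoliton σ ω c φ W r) (y : ℝ) :
    HasDerivAt r (potU σ ω c W y - r y ^ 2) y := by
  convert h.hasDerivAt_r y using 1
  rw [h.r_sq, potU]
  have := h.σ_pos
  field_simp
  ring

theorem φ_memLp (h : IsSoliton σ ω c φ W r) : MemLp φ 2 volume :=
  (memLp_two_iff_integrable_sq h.continuous_φ.aestronglyMeasurable).2 h.φ_sq_integrable

/-- `φ' = r φ`. -/
theorem isH1_φ (h : IsSoliton σ ω c φ W r) : IsH1 φ fun y => r y * φ y := by
  obtain ⟨C, -, hC⟩ := h.r_bound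
  exact ⟨IsPrim.of_hasDerivAt h.hasDerivAt_φ (h.continuous_r.mul h.continuous_φ), h.φ_memLp,
    memLp_bdd_mul h.continuous_r hC h.φ_memLp⟩

/-- `φ'' = U φ`. -/
theorem isH1_rφ (h : IsSoliton σ ω c φ W r) :
    IsH1 (fun y => r y * φ y) fun y => potU σ ω c W y * φ y := by
  obtain ⟨C, hC⟩ := h.isShortRange_U
  refine ⟨IsPrim.of_hasDerivAt (fun y => ?_) (hC.continuous.mul h.continuous_φ),
    h.isH1_φ.memLp_deriv, memLp_bdd_mul hC.continuous hC.bound h.φ_memLp⟩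
  refine ((h.hasDerivAt_r' y).fun_mul (h.hasDerivAt_φ y)).congr_deriv ?_
  ring

/-- `φ''' = V φ'`. -/
theorem isH1_Uφ (h : IsSoliton σ ω c φ W r) :
    IsH1 (fun y => potU σ ω c W y * φ y) fun y => potV σ ω c W y * (r y * φ y) := by
  obtain ⟨C, hC⟩ := h.isShortRange_U
  obtain ⟨C', hC'⟩ := h.isShortRange_V
  refine ⟨IsPrim.of_hasDerivAt (fun y => ?_)
    (hC'.continuous.mul (h.continuous_r.mul h.continuous_φ)),
    h.isH1_rφ.memLp_deriv, memLp_bdd_mul hC'.continuous hC'.bound h.isH1_φ.memLp_deriv⟩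
  -- Since `W' = 2σ r W`, differentiating `U φ` gives `(U + 2σ W ∂U/∂W) r φ`, and the bracket is `V`
  -- because `(2σ + 1)(4σ + 1) = 8σ² + 6σ + 1`.
  have h1 := ((((h.hasDerivAt_W y).const_mul (c / 2)).const_add (ω - c ^ 2 / 4)).fun_sub
    (((h.hasDerivAt_W y).fun_pow 2).const_mul ((2 * σ + 1) / (4 * (σ + 1) ^ 2)))).fun_mul
    (h.hasDerivAt_φ y)
  refine h1.congr_deriv ?_
  have := h.σ_pos
  simp only [potV]
  field_simp
  ring

theorem φ_integral_sq_pos (h : IsSoliton σ ω c φ W r) : 0 < ∫ y, φ y ^ 2 :=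
  h.isH1_φ.integral_sq_pos (h.φ_pos 0).ne'

theorem r_zero (h : IsSoliton σ ω c φ W r) : r 0 = 0 := by
  have := h.r_odd 0
  rw [neg_zero] at this
  linarith

theorem U_zero_neg (h : IsSoliton σ ω c φ W r) : potU σ ω c W 0 < 0 := by
  have h1 := (h.hasDerivAt_r' 0).unique (h.hasDerivAt_r 0)
  rw [h.r_zero] at h1
  have := h.deriv_r_zero_neg
  linarith

theorem V_even (h : IsSoliton σ ω c φ W r) (y : ℝ) : potV σ ω c W (-y) = potV σ ω c W y := by
  simp only [potV, h.W_even]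

theorem rφ_integral_sq_pos (h : IsSoliton σ ω c φ W r) : 0 < ∫ y, (r y * φ y) ^ 2 :=
  h.isH1_rφ.integral_sq_pos (x := 1) (mul_ne_zero (h.r_neg 1 one_pos).ne (h.φ_pos 1).ne')

end IsSoliton

theorem integrable_exp_neg_mul_abs {b : ℝ} (hb : 0 < b) :
    Integrable fun y : ℝ => Real.exp (-(b * |y|)) := by
  have h1 : IntegrableOn (fun y : ℝ => Real.exp (-(b * |y|))) (Ioi 0) :=
    (exp_neg_integrableOn_Ioi 0 hb).congr_fun (fun y (hy : 0 < y) => by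
      simp only [abs_of_pos hy, neg_mul]) measurableSet_Ioi
  have h2 : IntegrableOn (fun y : ℝ => Real.exp (-(b * |y|))) (Iio 0) := by
    have := IntegrableOn.comp_neg_Iio (c := (0 : ℝ))
      (f := fun y : ℝ => Real.exp (-(b * |y|))) (μ := volume) (by rwa [neg_zero])
    simpa only [abs_neg] using this
  rw [← integrableOn_univ, ← Iio_union_Ici (a := (0 : ℝ))]
  exact h2.union ((integrableOn_Ici_iff_integrableOn_Ioi (by simp)).2 h1)

/-- The logarithmic derivative `φ' / φ` of the profile. -/
noncomputable def logDerivProfile (σ ω c y : ℝ) : ℝ :=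
  -(√(4 * ω - c ^ 2) / 2) * (2 * √ω * Real.sinh (σ * √(4 * ω - c ^ 2) * y))
    / (2 * √ω * Real.cosh (σ * √(4 * ω - c ^ 2) * y) - c)

/-- Here `W = (σ + 1) κ² / D` with `κ² = 4ω - c²` and `D = 2√ω cosh(σκy) - c`. As `|c| < 2√ω` and
`cosh ≥ 1`, `D ≥ (2√ω - |c|) cosh`, which gives positivity and exponential decay; the differential
identities follow from `cosh² - sinh² = 1`. -/
theorem isSoliton_varphi {σ ω c : ℝ} (hσ : 0 < σ) (hω : c ^ 2 / 4 < ω) :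
    IsSoliton σ ω c (varphi σ ω c) (fun y => varphi σ ω c y ^ (2 * σ))
      (logDerivProfile σ ω c) := by
  have hω0 : 0 < ω := lt_of_le_of_lt (by positivity) hω
  set κ := √(4 * ω - c ^ 2) with hκ
  have hκ2 : κ ^ 2 = 4 * ω - c ^ 2 := Real.sq_sqrt (by linarith)
  have hκ0 : 0 < κ := Real.sqrt_pos.2 (by linarith)
  set m := √ω with hm
  have hm2 : m ^ 2 = ω := Real.sq_sqrt hω0.le
  have hm0 : 0 < m := Real.sqrt_pos.2 hω0
  have hcm : |c| < 2 * m := abs_lt_of_sq_lt_sq (by nlinarith) (by positivity)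
  set D : ℝ → ℝ := fun y => 2 * m * Real.cosh (σ * κ * y) - c with hD
  have hDge : ∀ y, (2 * m - |c|) * Real.cosh (σ * κ * y) ≤ D y := fun y => by
    have h1 := Real.one_le_cosh (σ * κ * y)
    have h2 := le_abs_self c
    have h3 := abs_nonneg c
    simp only [hD]
    nlinarith
  have hDpos : ∀ y, 0 < D y := fun y =>
    lt_of_lt_of_le (mul_pos (by linarith) (Real.cosh_pos _)) (hDge y)
  set w : ℝ → ℝ := fun y => (σ + 1) * κ ^ 2 / D y with hw
  have hwpos : ∀ y, 0 < w y := fun y => by have := hDpos y; positivity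
  have hφw : ∀ y, varphi σ ω c y = w y ^ (1 / (2 * σ)) := fun y => by
    change ((σ + 1) * (4 * ω - c ^ 2) / (2 * m * (Real.cosh (σ * κ * y) - c / (2 * m))))
      ^ (1 / (2 * σ)) = _
    simp only [hw, hD, ← hκ2]
    congr 2
    field_simp
  have hWw : ∀ y, varphi σ ω c y ^ (2 * σ) = w y := fun y => by
    rw [hφw, ← Real.rpow_mul (hwpos y).le, one_div_mul_cancel (by positivity), Real.rpow_one]
  have hr : ∀ y, logDerivProfile σ ω c y
      = -(κ / 2) * (2 * m * Real.sinh (σ * κ * y)) / D y := fun y => rfl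
  have hdl : ∀ y : ℝ, HasDerivAt (fun y => σ * κ * y) (σ * κ) y := fun y => by
    simpa using (hasDerivAt_id y).const_mul (σ * κ)
  have hdD : ∀ y, HasDerivAt D (2 * m * (Real.sinh (σ * κ * y) * (σ * κ))) y := fun y =>
    (((hdl y).cosh).const_mul (2 * m)).sub_const c
  have hcosh : ∀ y, 2 * m * Real.cosh (σ * κ * y) = D y + c := fun y => by simp only [hD]; ring
  -- This is `(D + c)² - 4ω`, expanded with `4ω = κ² + c²`.
  have hsinh : ∀ y, (2 * m * Real.sinh (σ * κ * y)) ^ 2 = D y ^ 2 + 2 * c * D y - κ ^ 2 := by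
    intro y
    have h1 := Real.cosh_sq (σ * κ * y)
    have h2 := hcosh y
    have h3 : (D y + c) ^ 2 = 4 * m ^ 2 * (Real.sinh (σ * κ * y) ^ 2 + 1) := by
      rw [← h2, ← h1]; ring
    rw [hκ2]
    rw [hm2] at h3
    nlinarith
  have hdw : ∀ y, HasDerivAt w (2 * σ * logDerivProfile σ ω c y * w y) y := fun y => by
    have := (hasDerivAt_const y ((σ + 1) * κ ^ 2)).div (hdD y) (hDpos y).ne'
    convert! this using 1
    have := (hDpos y).ne'
    rw [hr]
    simp only [hw]
    field_simp
    ring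
  have hdφ : ∀ y, HasDerivAt (varphi σ ω c) (logDerivProfile σ ω c y * varphi σ ω c y) y := by
    intro y
    rw [funext hφw]
    have h2 := (hdw y).rpow_const (p := 1 / (2 * σ)) (Or.inl (hwpos y).ne')
    convert h2 using 1
    rw [Real.rpow_sub_one (hwpos y).ne']
    have := (hwpos y).ne'
    field_simp
  have hdr : ∀ y, HasDerivAt (logDerivProfile σ ω c)
      (σ * c / (2 * (σ + 1)) * w y - σ / (2 * (σ + 1) ^ 2) * w y ^ 2) y := fun y => by
    rw [funext hr]
    have h1 := ((((hdl y).sinh).const_mul (2 * m)).const_mul (-(κ / 2))).div (hdD y) (hDpos y).ne'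
    convert! h1 using 1
    have h2 := (hDpos y).ne'
    have h3 : -(κ / 2) * (2 * m * (Real.cosh (σ * κ * y) * (σ * κ))) * D y
        - -(κ / 2) * (2 * m * Real.sinh (σ * κ * y)) * (2 * m * (Real.sinh (σ * κ * y) * (σ * κ)))
        = σ * κ ^ 2 / 2 * (c * D y - κ ^ 2) := by
      calc _ = -(σ * κ ^ 2 / 2) * ((2 * m * Real.cosh (σ * κ * y)) * D y
            - (2 * m * Real.sinh (σ * κ * y)) ^ 2) := by ring
        _ = _ := by rw [hcosh, hsinh]; ring
    rw [h3]
    simp only [hw]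
    field_simp
  have hle : ∀ y, w y ≤ 2 * ((σ + 1) * κ ^ 2 / (2 * m - |c|)) * Real.exp (-(σ * κ * |y|)) := by
    intro y
    have h1 : 0 < 2 * m - |c| := by linarith
    have h2 : Real.exp (σ * κ * |y|) / 2 ≤ Real.cosh (σ * κ * y) := by
      rw [← Real.cosh_abs, abs_mul, abs_of_pos (by positivity : 0 < σ * κ), Real.cosh_eq]
      have := Real.exp_pos (-(σ * κ * |y|))
      linarith
    have h3 : (2 * m - |c|) * (Real.exp (σ * κ * |y|) / 2) ≤ D y :=
      (mul_le_mul_of_nonneg_left h2 h1.le).trans (hDge y)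
    calc w y ≤ (σ + 1) * κ ^ 2 / ((2 * m - |c|) * (Real.exp (σ * κ * |y|) / 2)) := by
          simp only [hw]
          gcongr
      _ = _ := by
          rw [Real.exp_neg]
          field_simp
  set K := 2 * ((σ + 1) * κ ^ 2 / (2 * m - |c|)) with hK
  have hK0 : 0 < K := by
    have h1 : 0 < 2 * m - |c| := by linarith
    positivity
  have hwc : Continuous w := continuous_iff_continuousAt.2 fun y => (hdw y).continuousAt
  have hφc : Continuous (varphi σ ω c) :=
    continuous_iff_continuousAt.2 fun y => (hdφ y).continuousAt
  have hσκ : 0 < σ * κ := by positivity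
  rw [funext hWw]
  refine ⟨hσ, hω, fun y => ?_, fun y => (hWw y).symm, hdφ, hdr, fun y => ?_, fun y hy => ?_,
    fun y => ?_, fun y => ?_, ?_, ⟨K, fun y => ?_⟩, ?_, ?_, ?_⟩
  · rw [hφw]; exact Real.rpow_pos_of_pos (hwpos y) _
  · have h2 := (hDpos y).ne'
    have h3 : ω - c ^ 2 / 4 = κ ^ 2 / 4 := by rw [hκ2]; ring
    rw [hr, h3, div_pow, mul_pow, hsinh]
    simp only [hw]
    field_simp
    ring
  · rw [hr]
    have h1 := Real.sinh_pos_iff.2 (mul_pos hσκ hy)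
    refine div_neg_of_neg_of_pos ?_ (hDpos y)
    have : 0 < κ / 2 * (2 * m * Real.sinh (σ * κ * y)) := by positivity
    linarith
  · rw [hr, hr]
    simp only [hD, mul_neg, Real.sinh_neg, Real.cosh_neg]
    ring
  · rw [hφw, hφw]
    simp only [hw, hD, mul_neg, Real.cosh_neg]
  · have h1 : D 0 = 2 * m - c := by simp [hD]
    have h2 := hDpos 0
    have h3 : σ * c / (2 * (σ + 1)) * w 0 - σ / (2 * (σ + 1) ^ 2) * w 0 ^ 2
        = σ * κ ^ 2 / (2 * D 0 ^ 2) * (c * D 0 - κ ^ 2) := by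
      simp only [hw]
      field_simp
    rw [h3]
    refine mul_neg_of_pos_of_neg (by positivity) ?_
    have h4 : c * D 0 - κ ^ 2 = -(2 * m * D 0) := by rw [hκ2, h1, ← hm2]; ring
    rw [h4]
    have : 0 < 2 * m * D 0 := by positivity
    linarith
  · refine (hle y).trans (mul_le_of_le_one_right hK0.le (Real.exp_le_one_iff.2 ?_))
    have := abs_nonneg y
    nlinarith
  · exact ((integrable_exp_neg_mul_abs hσκ).const_mul K).mono' hwc.aestronglyMeasurable
      (Eventually.of_forall fun y => by
        rw [Real.norm_of_nonneg (hwpos y).le]; exact hle y)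
  · have h1 : Tendsto (fun y : ℝ => K * Real.exp (-(σ * κ * |y|))) atTop (𝓝 (K * 0)) :=
      ((Real.tendsto_exp_neg_atTop_nhds_zero.comp
        (tendsto_abs_atTop_atTop.const_mul_atTop hσκ))).const_mul K
    rw [mul_zero] at h1
    exact squeeze_zero (fun y => (hwpos y).le) hle h1
  · refine ((integrable_exp_neg_mul_abs hκ0).const_mul (K ^ (1 / σ))).mono'
      (hφc.pow 2).aestronglyMeasurable (Eventually.of_forall fun y => ?_)
    rw [Real.norm_of_nonneg (sq_nonneg _), hφw, ← Real.rpow_natCast, ← Real.rpow_mul (hwpos y).le]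
    -- `φ²` is the power `1/σ` of `W`, so decay of `W` like `e^{-σκ|y|}` becomes decay like
    -- `e^{-κ|y|}`.
    have h1 : 1 / (2 * σ) * ((2 : ℕ) : ℝ) = 1 / σ := by push_cast; field_simp
    rw [h1]
    calc w y ^ (1 / σ) ≤ (K * Real.exp (-(σ * κ * |y|))) ^ (1 / σ) :=
          Real.rpow_le_rpow (hwpos y).le (hle y) (by positivity)
      _ = _ := by
          rw [Real.mul_rpow hK0.le (Real.exp_pos _).le, ← Real.exp_mul]
          congr 2
          field_simp

end Profile

end GDNLS

namespace GDNLS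

/-! ### Spectral analysis of `L̃₁₁` and of `-∂² + φ''/φ`. -/

section Spectral

open Filter Topology

theorem IsPrim.comp_neg {f f' : ℝ → ℝ} (h : IsPrim f f') :
    IsPrim (fun x => f (-x)) (fun x => -f' (-x)) := by
  refine ⟨?_, fun x y => ?_⟩
  · have h1 : LocallyIntegrable (fun x => f' (-x)) volume := by
      rw [locallyIntegrable_iff]
      intro K hK
      have h2 := h.locInt.integrableOn_isCompact (hK.neg)
      have h3 := (Measure.measurePreserving_neg (volume : Measure ℝ)).integrableOn_comp_preimage
        (Homeomorph.neg ℝ).measurableEmbedding (f := f') (s := -K)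
      have h4 := h3.2 h2
      simpa [Function.comp_def] using h4
    exact h1.neg
  · rw [h.sub_eq, intervalIntegral.integral_neg, intervalIntegral.integral_comp_neg,
      intervalIntegral.integral_symm]

theorem IsH1.comp_neg {f f' : ℝ → ℝ} (h : IsH1 f f') :
    IsH1 (fun x => f (-x)) (fun x => -f' (-x)) :=
  ⟨h.prim.comp_neg, h.memLp.comp_measurePreserving (Measure.measurePreserving_neg volume),
    (h.memLp_deriv.comp_measurePreserving (Measure.measurePreserving_neg volume)).neg⟩

theorem contDiff_one_of_hasDerivAt {f f' : ℝ → ℝ} (h : ∀ x, HasDerivAt f (f' x) x)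
    (hc : Continuous f') : ContDiff ℝ 1 f := by
  rw [contDiff_one_iff_deriv]
  refine ⟨fun x => (h x).differentiableAt, ?_⟩
  rwa [funext fun x => (h x).deriv]

/-- Jacobi's inequality: `∫ a'² + V a²` is bounded below by boundary terms on an interval where
the solution `q` of `q'' = V q` does not vanish. -/
theorem jacobi_le {a a' q q₁ V : ℝ → ℝ} (ha : IsH1 a a') (hV : Continuous V)
    (hq : ∀ x, HasDerivAt q (q₁ x) x) (hq₁ : ∀ x, HasDerivAt q₁ (V x * q x) x) {s t : ℝ}
    (hst : s ≤ t) (h0 : ∀ x ∈ Icc s t, q x ≠ 0) :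
    q₁ t / q t * a t ^ 2 - q₁ s / q s * a s ^ 2 ≤ ∫ x in s..t, a' x ^ 2 + V x * a x ^ 2 := by
  have hqc : Continuous q := continuous_iff_continuousAt.2 fun x => (hq x).continuousAt
  have hq₁c : Continuous q₁ := continuous_iff_continuousAt.2 fun x => (hq₁ x).continuousAt
  have hac := ha.continuous
  have hρ : AbsolutelyContinuousOnInterval (fun x => q₁ x / q x) s t := by
    refine ContDiffOn.absolutelyContinuousOnInterval ?_
    rw [uIcc_of_le hst]
    exact (contDiff_one_of_hasDerivAt hq₁ (hV.mul hqc)).contDiffOn.div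
      (contDiff_one_of_hasDerivAt hq hq₁c).contDiffOn h0
  have hcρ : ContinuousOn (fun x => q₁ x / q x) (uIcc s t) := by
    rw [uIcc_of_le hst]
    exact hq₁c.continuousOn.div hqc.continuousOn h0
  have haa := ha.prim.mul ha.prim
  have h1 := AbsolutelyContinuousOnInterval.integral_deriv_mul_eq_sub
    (haa.absolutelyContinuous s t) hρ
  have ha2 : IntervalIntegrable (fun x => a' x ^ 2) volume s t :=
    (integrable_sq_of_memLp ha.memLp_deriv).intervalIntegrable
  have hi : IntervalIntegrable (fun x => a' x ^ 2 + V x * a x ^ 2) volume s t :=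
    ha2.add ((hV.mul (hac.pow 2)).intervalIntegrable _ _)
  have h2 : ∫ x in s..t, deriv (fun x => a x * a x) x * (q₁ x / q x)
        + a x * a x * deriv (fun x => q₁ x / q x) x
      = ∫ x in s..t, 2 * a' x * (a x * (q₁ x / q x))
        + (a x * a x * V x - (a x * (q₁ x / q x)) ^ 2) := by
    refine intervalIntegral.integral_congr_ae ?_
    filter_upwards [haa.ae_hasDerivAt] with x hx hxs
    rw [uIoc_of_le hst] at hxs
    have hne := h0 x (Ioc_subset_Icc_self hxs)
    rw [hx.deriv, ((hq₁ x).fun_div (hq x) hne).deriv]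
    field_simp
    ring
  have hca : ContinuousOn (fun x => a x * (q₁ x / q x)) (uIcc s t) := hac.continuousOn.mul hcρ
  have hj : IntervalIntegrable (fun x => 2 * a' x * (a x * (q₁ x / q x))
      + (a x * a x * V x - (a x * (q₁ x / q x)) ^ 2)) volume s t :=
    (((ha.prim.intervalIntegrable s t).const_mul 2).mul_continuousOn hca).add
      ((((hac.mul hac).mul hV).continuousOn.sub (hca.pow 2)).intervalIntegrable)
  have h3 : q₁ t / q t * a t ^ 2 - q₁ s / q s * a s ^ 2
      = a t * a t * (q₁ t / q t) - a s * a s * (q₁ s / q s) := by ring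
  rw [h3, ← h1, h2]
  -- With `ρ = q'/q`, the Riccati equation `ρ' = V - ρ²` gives `a'² + V a² = (a² ρ)' + (a' - ρ a)²`.
  refine intervalIntegral.integral_mono_on hst hj hi fun x _ => ?_
  nlinarith [sq_nonneg (a' x - a x * (q₁ x / q x))]

/-- Cauchy–Schwarz on `[0, x]`, obtained by expanding the square of `a'` minus its mean `a x / x`.
-/
theorem IsH1.sq_le_mul_integral {a a' : ℝ → ℝ} (ha : IsH1 a a') (h0 : a 0 = 0) {x : ℝ}
    (hx : 0 < x) : a x ^ 2 ≤ x * ∫ t in (0 : ℝ)..x, a' t ^ 2 := by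
  have i1 : IntervalIntegrable (fun x => a' x ^ 2) volume 0 x :=
    (integrable_sq_of_memLp ha.memLp_deriv).intervalIntegrable
  have i2 := (ha.prim.intervalIntegrable 0 x).const_mul (2 * (a x / x))
  have h1 : 0 ≤ ∫ t in (0 : ℝ)..x, (a' t - a x / x) ^ 2 :=
    intervalIntegral.integral_nonneg hx.le fun _ _ => sq_nonneg _
  have h2 : ∫ t in (0 : ℝ)..x, (a' t - a x / x) ^ 2
      = (∫ t in (0 : ℝ)..x, a' t ^ 2) - 2 * (a x / x) * (∫ t in (0 : ℝ)..x, a' t)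
        + (a x / x) ^ 2 * x := by
    have i3 : IntervalIntegrable (fun _ : ℝ => (a x / x) ^ 2) volume 0 x :=
      intervalIntegrable_const
    have h3 : (a x / x) ^ 2 * x = ∫ _ in (0 : ℝ)..x, (a x / x) ^ 2 := by simp [mul_comm]
    rw [h3, ← intervalIntegral.integral_const_mul, ← intervalIntegral.integral_sub i1 i2,
      ← intervalIntegral.integral_add (by exact i1.sub i2) i3]
    congr 1; funext t; ring
  rw [h2, ← ha.prim.sub_eq, h0, sub_zero] at h1
  have h4 : (a x / x) * a x = a x ^ 2 / x := by ring
  have h5 : (a x / x) ^ 2 * x = a x ^ 2 / x := by field_simp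
  have h6 : a x ^ 2 / x ≤ ∫ t in (0 : ℝ)..x, a' t ^ 2 := by nlinarith
  rw [div_le_iff₀ hx] at h6
  linarith

/-- Uniqueness for the initial value problem `d'' = V d`, `d(0) = d'(0) = 0`. -/
theorem eq_zero_of_linear_ode {d d₁ V : ℝ → ℝ} {C : ℝ} (hV : ∀ x, |V x| ≤ C)
    (hd : ∀ x, HasDerivAt d (d₁ x) x) (hd₁ : ∀ x, HasDerivAt d₁ (V x * d x) x) (h0 : d 0 = 0)
    (h1 : d₁ 0 = 0) (x : ℝ) : d x = 0 := by
  have hC : 0 ≤ C := (abs_nonneg _).trans (hV 0)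
  have hlip : ∀ t, LipschitzOnWith (Real.toNNReal (1 + C))
      (fun p : ℝ × ℝ => ((p.2, V t * p.1) : ℝ × ℝ)) univ := by
    intro t
    refine LipschitzOnWith.of_dist_le_mul fun p _ q _ => ?_
    rw [Real.coe_toNNReal _ (by positivity), Prod.dist_eq, Prod.dist_eq]
    have hm1 := le_max_left (dist p.1 q.1) (dist p.2 q.2)
    have hm2 := le_max_right (dist p.1 q.1) (dist p.2 q.2)
    have hm0 : 0 ≤ max (dist p.1 q.1) (dist p.2 q.2) := dist_nonneg.trans hm1
    refine max_le ?_ ?_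
    · simp only
      nlinarith
    · simp only
      rw [Real.dist_eq, ← mul_sub, abs_mul, ← Real.dist_eq]
      have h2 : |V t| * dist p.1 q.1 ≤ C * max (dist p.1 q.1) (dist p.2 q.2) :=
        mul_le_mul (hV t) hm1 dist_nonneg hC
      linarith
  have key := ODE_solution_unique_univ (v := fun t (p : ℝ × ℝ) => ((p.2, V t * p.1) : ℝ × ℝ))
    (s := fun _ => univ) (K := Real.toNNReal (1 + C)) (t₀ := 0)
    (f := fun x => (d x, d₁ x)) (g := fun _ => (0, 0)) hlip
    (fun t => ⟨(hd t).prodMk (hd₁ t), mem_univ _⟩)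
    (fun t => ⟨by simpa [← Prod.mk_zero_zero] using hasDerivAt_const t ((0, 0) : ℝ × ℝ),
      mem_univ _⟩)
    (by simp [h0, h1])
  exact congrArg Prod.fst (congrFun key x)

/-- A normalized eigenfunction `e` of `-∂² + V` for a negative eigenvalue `m`, with `e' = e₁`. -/
structure IsGroundState (V : ℝ → ℝ) (m : ℝ) (e e₁ : ℝ → ℝ) : Prop where
  neg : m < 0
  isH1 : IsH1 e e₁
  isH1_deriv : IsH1 e₁ fun y => (V y - m) * e y
  integral_sq : ∫ y, e y ^ 2 = 1
  energy_eq : ∀ g g' : ℝ → ℝ, IsH1 g g' → energy V e e₁ g g' = m * ∫ y, e y * g y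

namespace IsSoliton

variable {σ ω c : ℝ} {φ W r : ℝ → ℝ}

theorem energy_rφ (h : IsSoliton σ ω c φ W r) {g g' : ℝ → ℝ} (hg : IsH1 g g') :
    energy (potV σ ω c W) (fun y => r y * φ y) (fun y => potU σ ω c W y * φ y) g g' = 0 := by
  rw [← h.isH1_Uφ.by_parts hg, energy]
  congr 1; funext x; ring

/-- Since `∫ (φ φ')' = 0`, any multiple of `r² + U` may be subtracted from the integrand `(r² + V)
φ²`; a suitable multiple leaves a pointwise negative integrand. -/
theorem energy_φ_neg (h : IsSoliton σ ω c φ W r) :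
    energy (potV σ ω c W) φ (fun y => r y * φ y) φ (fun y => r y * φ y) < 0 := by
  obtain ⟨C, hC⟩ := h.isShortRange_V
  have hσ := h.σ_pos
  have hω := h.lt_ω
  -- The ratio of the coefficients of `W` in `r² + V` and `r² + U`, so that the term of indefinite
  -- sign, carrying `c`, cancels.
  set t := (2 * σ ^ 2 + 3 * σ + 2) / (2 + σ) with ht
  have h1 := h.isH1_φ.by_parts h.isH1_rφ
  have i1 := hC.integrable_energy h.isH1_φ h.isH1_φ
  have i2 := (h.isH1_φ.integrable_mul_deriv h.isH1_rφ).const_mul t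
  have h2 : energy (potV σ ω c W) φ (fun y => r y * φ y) φ (fun y => r y * φ y)
      = ∫ y, (r y * φ y * (r y * φ y) + potV σ ω c W y * φ y * φ y)
        - t * (r y * φ y * (r y * φ y) + φ y * (potU σ ω c W y * φ y)) := by
    rw [integral_sub i1 i2, integral_const_mul, h1, energy]
    ring
  set α := 4 * σ * (σ + 1) / (2 + σ) * (ω - c ^ 2 / 4) with hα
  have hα0 : 0 < α := by
    have : 0 < ω - c ^ 2 / 4 := by linarith
    positivity
  have h3 : energy (potV σ ω c W) φ (fun y => r y * φ y) φ (fun y => r y * φ y)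
      ≤ ∫ y, -α * φ y ^ 2 := by
    rw [h2]
    refine integral_mono (i1.sub i2) (h.φ_sq_integrable.const_mul _) fun y => ?_
    have h4 : (r y * φ y * (r y * φ y) + potV σ ω c W y * φ y * φ y)
        - t * (r y * φ y * (r y * φ y) + φ y * (potU σ ω c W y * φ y))
        = (r y ^ 2 + potV σ ω c W y - t * (r y ^ 2 + potU σ ω c W y)) * φ y ^ 2 := by ring
    have h5 : r y ^ 2 + potV σ ω c W y - t * (r y ^ 2 + potU σ ω c W y)
        = -α - (4 * σ ^ 3 + 12 * σ ^ 2 + 4 * σ) / ((2 + σ) * (4 * (σ + 1) ^ 2)) * W y ^ 2 := by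
      rw [h.r_sq, potV, potU, ht, hα]
      field_simp
      ring
    simp only
    rw [h4, h5]
    refine mul_le_mul_of_nonneg_right ?_ (sq_nonneg _)
    have : 0 ≤ (4 * σ ^ 3 + 12 * σ ^ 2 + 4 * σ) / ((2 + σ) * (4 * (σ + 1) ^ 2)) * W y ^ 2 := by
      positivity
    linarith
  rw [integral_const_mul] at h3
  nlinarith [h.φ_integral_sq_pos]

theorem tendsto_r_sq_atTop (h : IsSoliton σ ω c φ W r) :
    Tendsto (fun y => r y ^ 2) atTop (𝓝 (ω - c ^ 2 / 4)) := by
  have h1 := ((h.W_tendsto.const_mul (c / (2 * (σ + 1)))).const_add (ω - c ^ 2 / 4)).sub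
    ((h.W_tendsto.pow 2).const_mul (1 / (4 * (σ + 1) ^ 2)))
  simp only [mul_zero, add_zero, ne_eq, OfNat.ofNat_ne_zero, not_false_eq_true, zero_pow,
    sub_zero] at h1
  exact h1.congr fun y => (h.r_sq y).symm

/-- The form of `L̃₁₁` on the half line is nonnegative on functions vanishing at the origin. -/
theorem half_energy_nonneg (h : IsSoliton σ ω c φ W r) {a a' : ℝ → ℝ} (ha : IsH1 a a')
    (h0 : a 0 = 0) : 0 ≤ ∫ x in Ioi (0 : ℝ), a' x ^ 2 + potV σ ω c W x * a x ^ 2 := by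
  obtain ⟨C, hC⟩ := h.isShortRange_V
  obtain ⟨CU, hCU⟩ := h.isShortRange_U
  have hq : ∀ x, HasDerivAt (fun y => r y * φ y) (potU σ ω c W x * φ x) x :=
    h.isH1_rφ.prim.hasDerivAt (hCU.continuous.mul h.continuous_φ)
  have hq₁ : ∀ x, HasDerivAt (fun y => potU σ ω c W y * φ y)
      (potV σ ω c W x * (r x * φ x)) x :=
    h.isH1_Uφ.prim.hasDerivAt (hC.continuous.mul (h.continuous_r.mul h.continuous_φ))
  have hρ : ∀ x, potU σ ω c W x * φ x / (r x * φ x) = potU σ ω c W x / r x := fun x =>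
    mul_div_mul_right _ _ (h.φ_pos x).ne'
  have hGi : Integrable fun x => a' x ^ 2 + potV σ ω c W x * a x ^ 2 := by
    refine (hC.integrable_energy ha ha).congr (Eventually.of_forall fun x => ?_)
    simp only; ring
  set G : ℝ → ℝ := fun x => a' x ^ 2 + potV σ ω c W x * a x ^ 2 with hG
  have hJ : ∀ s t, 0 < s → s ≤ t → potU σ ω c W t / r t * a t ^ 2
      - potU σ ω c W s / r s * a s ^ 2 ≤ ∫ x in s..t, G x := fun s t hs hst => by
    have := jacobi_le ha hC.continuous hq hq₁ hst fun x hx =>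
      mul_ne_zero (h.r_neg x (hs.trans_le hx.1)).ne (h.φ_pos x).ne'
    simpa only [hρ] using this
  have hA : 0 < ω - c ^ 2 / 4 := by linarith [h.lt_ω]
  -- At infinity `U` is bounded and `|r|` is bounded away from zero, while `a² → 0`.
  have htop : Tendsto (fun t => potU σ ω c W t / r t * a t ^ 2) atTop (𝓝 0) := by
    have ha2 : Tendsto (fun t => a t * a t) atTop (𝓝 0) := ha.mul_tendsto_atTop ha
    have hev : ∀ᶠ t in atTop, (ω - c ^ 2 / 4) / 2 < r t ^ 2 :=
      h.tendsto_r_sq_atTop.eventually_const_lt (by linarith)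
    refine squeeze_zero_norm' (a := fun t => CU / √((ω - c ^ 2 / 4) / 2) * (a t * a t)) ?_
      (by simpa only [mul_zero] using ha2.const_mul (CU / √((ω - c ^ 2 / 4) / 2)))
    filter_upwards [hev] with t ht
    have h1 : √((ω - c ^ 2 / 4) / 2) ≤ |r t| := by
      rw [← Real.sqrt_sq_eq_abs]; exact Real.sqrt_le_sqrt ht.le
    have h2 : 0 < √((ω - c ^ 2 / 4) / 2) := Real.sqrt_pos.2 (by linarith)
    rw [norm_mul, norm_div, Real.norm_eq_abs, Real.norm_eq_abs, Real.norm_of_nonneg (sq_nonneg _),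
      pow_two]
    refine mul_le_mul_of_nonneg_right ?_ (mul_self_nonneg _)
    exact div_le_div₀ hCU.nonneg (hCU.bound t) h2 h1
  have hJ2 : ∀ s, 0 < s → -(potU σ ω c W s / r s * a s ^ 2) + (∫ x in (0 : ℝ)..s, G x)
      ≤ ∫ x in Ioi (0 : ℝ), G x := by
    intro s hs
    have h1 := intervalIntegral_tendsto_integral_Ioi s (hGi.integrableOn (s := Ioi s)) tendsto_id
    have h2 := htop.sub_const (potU σ ω c W s / r s * a s ^ 2)
    have h3 := le_of_tendsto_of_tendsto h2 h1 (by
      filter_upwards [eventually_ge_atTop s] with t ht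
      exact hJ s t hs ht)
    rw [← intervalIntegral.integral_Ioi_sub_Ioi hGi.integrableOn hs.le]
    linarith
  have hprim : ∀ F : ℝ → ℝ, Integrable F →
      Tendsto (fun s => ∫ x in (0 : ℝ)..s, F x) (𝓝[>] 0) (𝓝 0) := fun F hF => by
    have := (intervalIntegral.continuous_primitive (fun _ _ => hF.intervalIntegrable) 0).tendsto
      (0 : ℝ)
    rw [intervalIntegral.integral_same] at this
    exact this.mono_left nhdsWithin_le_nhds
  -- As `r 0 = 0`, the Riccati equation gives `r'(0) = U(0) ≠ 0`, so `U/r` behaves like `1/s` near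
  -- the origin.
  have hslope : Tendsto (fun s => potU σ ω c W s / (r s / s)) (𝓝[>] 0) (𝓝 1) := by
    have h1 := (h.hasDerivAt_r' 0).tendsto_slope
    rw [h.r_zero] at h1
    have h2 : Tendsto (fun s => r s / s) (𝓝[>] 0) (𝓝 (potU σ ω c W 0)) := by
      have h3 := h1.mono_left (nhdsWithin_mono 0 (fun x (hx : 0 < x) => hx.ne'))
      simp only [slope_fun_def, h.r_zero, sub_zero, vsub_eq_sub, smul_eq_mul, ne_eq,
        OfNat.ofNat_ne_zero, not_false_eq_true, zero_pow] at h3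
      exact h3.congr fun s => by rw [div_eq_inv_mul]
    have h4 := ((hCU.continuous.tendsto 0).mono_left nhdsWithin_le_nhds).div h2 h.U_zero_neg.ne
    rwa [div_self h.U_zero_neg.ne] at h4
  -- The singularity `1/s` is beaten by `a²/s ≤ ∫₀ˢ a'²`, which tends to zero because `a 0 = 0`.
  have hbot : Tendsto (fun s => potU σ ω c W s / r s * a s ^ 2) (𝓝[>] 0) (𝓝 0) := by
    have h1 : Tendsto (fun s => a s ^ 2 / s) (𝓝[>] 0) (𝓝 0) := by
      refine squeeze_zero' (g := fun s => ∫ t in (0 : ℝ)..s, a' t ^ 2) ?_ ?_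
        (hprim _ (integrable_sq_of_memLp ha.memLp_deriv))
      · filter_upwards [self_mem_nhdsWithin] with s (hs : 0 < s)
        positivity
      · filter_upwards [self_mem_nhdsWithin] with s (hs : 0 < s)
        rw [div_le_iff₀ hs, mul_comm]
        exact ha.sq_le_mul_integral h0 hs
    have h2 := hslope.mul h1
    rw [mul_zero] at h2
    refine h2.congr' ?_
    filter_upwards [self_mem_nhdsWithin] with s (hs : 0 < s)
    have := (h.r_neg s hs).ne
    field_simp
  have h5 := (hbot.neg).add (hprim G hGi)
  rw [neg_zero, add_zero] at h5
  exact le_of_tendsto h5 (by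
    filter_upwards [self_mem_nhdsWithin] with s hs
    exact hJ2 s hs)

/-- Evenness of `V` transfers the half line bound to the negative side by reflection. -/
theorem energy_nonneg_of_zero (h : IsSoliton σ ω c φ W r) {a a' : ℝ → ℝ} (ha : IsH1 a a')
    (h0 : a 0 = 0) : 0 ≤ energy (potV σ ω c W) a a' a a' := by
  obtain ⟨C, hC⟩ := h.isShortRange_V
  have h1 := h.half_energy_nonneg ha h0
  have h2 := h.half_energy_nonneg ha.comp_neg (by simpa using h0)
  have h3 := integral_comp_neg_Ioi 0 (fun x => a' x ^ 2 + potV σ ω c W x * a x ^ 2)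
  simp only [h.V_even, neg_zero] at h3
  simp only [neg_sq] at h2
  rw [h3] at h2
  have hGi : Integrable fun x => a' x ^ 2 + potV σ ω c W x * a x ^ 2 := by
    refine (hC.integrable_energy ha ha).congr (Eventually.of_forall fun x => ?_)
    simp only; ring
  have h4 : energy (potV σ ω c W) a a' a a' = ∫ x, a' x ^ 2 + potV σ ω c W x * a x ^ 2 := by
    unfold energy
    congr 1; funext x; ring
  rw [h4, ← intervalIntegral.integral_Iic_add_Ioi (b := 0) hGi.integrableOn hGi.integrableOn]
  exact add_nonneg h2 h1

/-- The energy of `φ` is negative, hence below the level `ω - c²/4`, so the unconstrained Rayleigh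
quotient has a minimizer; its Euler–Lagrange equation is the eigenvalue equation. -/
theorem exists_groundState (h : IsSoliton σ ω c φ W r) :
    ∃ (m : ℝ) (e e₁ : ℝ → ℝ), IsGroundState (potV σ ω c W) m e e₁ := by
  obtain ⟨C, hC⟩ := h.isShortRange_V
  have hA : 0 < ω - c ^ 2 / 4 := by linarith [h.lt_ω]
  have hφ := h.energy_φ_neg
  have hφ2 := h.φ_integral_sq_pos
  obtain ⟨e, e', he, -, he1, hmin⟩ := hC.exists_minimizer (S := ∅) (by simp) h.isH1_φ (by simp)
    (hφ.trans (by positivity))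
  set m := energy (potV σ ω c W) e e' e e' with hm
  have hm0 : m < 0 := by
    have := hmin _ _ h.isH1_φ (by simp)
    by_contra hn
    rw [not_lt] at hn
    nlinarith
  have hE : ∀ g g' : ℝ → ℝ, IsH1 g g' →
      energy (potV σ ω c W) e e' g g' = m * ∫ y, e y * g y := fun g g' hg =>
    hC.energy_eq_of_minimizer he hg (by rw [he1, mul_one]) fun t =>
      hmin _ _ (he.add (hg.const_mul t)) (by simp)
  obtain ⟨e₁, h1, h2⟩ := hC.exists_isH1_deriv he m hE
  refine ⟨m, e, e₁, hm0, h1, h2, he1, fun g g' hg => ?_⟩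
  rw [← hE g g' hg]
  refine integral_congr_ae ?_
  filter_upwards [he.deriv_ae_eq h1] with x hx
  rw [hx]

variable {m : ℝ} {e e₁ : ℝ → ℝ}

/-- The combination `e(0) a - a(0) e` vanishes at the origin and has energy `e(0)² E(a) + m a(0)²`.
If `E(a) < 0`, its nonnegativity forces `a(0) = 0`, and then `E(a) ≥ 0` directly. -/
theorem energy_nonneg_of_orthogonal (h : IsSoliton σ ω c φ W r)
    (he : IsGroundState (potV σ ω c W) m e e₁) {a a' : ℝ → ℝ} (ha : IsH1 a a')
    (hae : ∫ y, a y * e y = 0) : 0 ≤ energy (potV σ ω c W) a a' a a' := by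
  obtain ⟨C, hC⟩ := h.isShortRange_V
  have hv := (ha.const_mul (e 0)).add (he.isH1.const_mul (-a 0))
  have h1 := h.energy_nonneg_of_zero hv (by ring)
  have hee : energy (potV σ ω c W) e e₁ e e₁ = m := by
    rw [he.energy_eq _ _ he.isH1]
    simp_rw [← pow_two]
    rw [he.integral_sq, mul_one]
  have hae' : energy (potV σ ω c W) a a' e e₁ = 0 := by
    rw [energy_comm, he.energy_eq _ _ ha]
    simp_rw [mul_comm (e _)]
    rw [hae, mul_zero]
  rw [hC.energy_comb ha he.isH1, hee, hae'] at h1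
  by_contra hn
  rw [not_le] at hn
  have hm := he.neg
  have h2 : a 0 = 0 := by
    by_contra h2
    have : 0 < a 0 ^ 2 := by positivity
    nlinarith [sq_nonneg (e 0)]
  exact absurd (h.energy_nonneg_of_zero ha h2) (not_le.2 hn)

/-- The kernel of `L̃₁₁` is spanned by `φ'`. -/
theorem eq_smul_of_energy_eq_zero (h : IsSoliton σ ω c φ W r) {a a' : ℝ → ℝ} (ha : IsH1 a a')
    (hker : ∀ g g' : ℝ → ℝ, IsH1 g g' → energy (potV σ ω c W) a a' g g' = 0) :
    ∃ k : ℝ, ∀ y, a y = k * (r y * φ y) := by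
  obtain ⟨C, hC⟩ := h.isShortRange_V
  obtain ⟨CU, hCU⟩ := h.isShortRange_U
  obtain ⟨a₁, h1, h2⟩ := hC.exists_isH1_deriv ha 0 (fun g g' hg => by
    rw [hker g g' hg, zero_mul])
  -- The Wronskian of `a` and `φ'` is constant and decays, so it vanishes. At the origin, where `φ'`
  -- vanishes and `φ''` does not, this gives `a 0 = 0`.
  have hF := (h1.prim.mul h.isH1_Uφ.prim).sub (h2.prim.mul h.isH1_rφ.prim)
  have hF0 : IsPrim _ (fun _ : ℝ => (0 : ℝ)) :=
    hF.congr_deriv (Eventually.of_forall fun x => by simp only; ring)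
  have ht : Tendsto (fun x => a x * (potU σ ω c W x * φ x) - a₁ x * (r x * φ x)) atTop
      (𝓝 (0 - 0)) := (h1.mul_tendsto_atTop h.isH1_Uφ).sub (h2.mul_tendsto_atTop h.isH1_rφ)
  have hz : a 0 * (potU σ ω c W 0 * φ 0) - a₁ 0 * (r 0 * φ 0) = 0 - 0 :=
    tendsto_nhds_unique (tendsto_const_nhds.congr fun x => hF0.const_of_zero 0 x) ht
  have hUφ : potU σ ω c W 0 * φ 0 ≠ 0 := mul_ne_zero h.U_zero_neg.ne (h.φ_pos 0).ne'
  have ha0 : a 0 = 0 := by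
    rw [h.r_zero, zero_mul, mul_zero, sub_zero, sub_zero] at hz
    exact (mul_eq_zero.1 hz).resolve_right hUφ
  -- Chosen so that `a - k φ'` has zero Cauchy data at the origin.
  set k := a₁ 0 / (potU σ ω c W 0 * φ 0) with hk
  refine ⟨k, fun y => ?_⟩
  have hd := h1.sub (h.isH1_rφ.const_mul k)
  have hd₁ := h2.sub (h.isH1_Uφ.const_mul k)
  have := eq_zero_of_linear_ode (d := fun y => a y - k * (r y * φ y))
    (d₁ := fun y => a₁ y - k * (potU σ ω c W y * φ y)) hC.bound
    (fun x => hd.prim.hasDerivAt hd₁.continuous x)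
    (fun x => by
      have h3 := hd₁.prim.hasDerivAt (by
        have := hC.continuous
        have := h1.continuous
        have := h.continuous_r
        have := h.continuous_φ
        fun_prop) x
      convert h3 using 1
      ring)
    (by rw [ha0, h.r_zero]; ring)
    (by rw [hk, div_mul_cancel₀ _ hUφ, sub_self]) y
  linarith

/-- A function of zero energy minimizes the form on the complement of `e`, hence is critical there.
It is then critical in every direction, since it is also orthogonal to the eigenfunction `e`, so it
lies in the kernel `ℝ φ'`, and orthogonality to `φ'` kills it. -/
theorem energy_pos (h : IsSoliton σ ω c φ W r) (he : IsGroundState (potV σ ω c W) m e e₁)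
    {a a' : ℝ → ℝ} (ha : IsH1 a a') (hae : ∫ y, a y * e y = 0)
    (haφ : ∫ y, a y * (r y * φ y) = 0) (hne : 0 < ∫ y, a y ^ 2) :
    0 < energy (potV σ ω c W) a a' a a' := by
  obtain ⟨C, hC⟩ := h.isShortRange_V
  refine lt_of_le_of_ne (h.energy_nonneg_of_orthogonal he ha hae) fun h0 => ?_
  have h1 : ∀ g g' : ℝ → ℝ, IsH1 g g' → ∫ y, g y * e y = 0 →
      energy (potV σ ω c W) a a' g g' = 0 := fun g g' hg hge => by
    rw [hC.energy_eq_of_minimizer (m := 0) ha hg (by rw [← h0, zero_mul]) fun t => ?_, zero_mul]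
    rw [zero_mul]
    refine h.energy_nonneg_of_orthogonal he (ha.add (hg.const_mul t)) ?_
    have i1 := ha.integrable_mul he.isH1
    have i2 := (hg.integrable_mul he.isH1).const_mul t
    calc ∫ y, (a y + t * g y) * e y = ∫ y, a y * e y + t * (g y * e y) := by
          congr 1; funext y; ring
      _ = 0 := by rw [integral_add i1 i2, integral_const_mul, hae, hge]; ring
  have h2 : ∀ g g' : ℝ → ℝ, IsH1 g g' → energy (potV σ ω c W) a a' g g' = 0 := fun g g' hg => by
    set t := ∫ y, g y * e y with ht
    have hg2 := hg.add (he.isH1.const_mul (-t))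
    have h3 := h1 _ _ hg2 (by
      have i1 := hg.integrable_mul he.isH1
      have i2 := (integrable_sq_of_memLp he.isH1.memLp).const_mul (-t)
      calc ∫ y, (g y + -t * e y) * e y = ∫ y, g y * e y + -t * e y ^ 2 := by
            congr 1; funext y; ring
        _ = 0 := by rw [integral_add i1 i2, integral_const_mul, he.integral_sq, ← ht]; ring)
    rw [energy_comm, hC.energy_add_left hg (he.isH1.const_mul (-t)) ha,
      IsShortRange.energy_const_mul_left, he.energy_eq _ _ ha] at h3
    simp_rw [mul_comm (e _)] at h3
    rw [hae] at h3
    rw [energy_comm]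
    linarith
  obtain ⟨k, hk⟩ := h.eq_smul_of_energy_eq_zero ha h2
  have h3 : ∫ y, a y * (r y * φ y) = k * ∫ y, (r y * φ y) ^ 2 := by
    rw [← integral_const_mul]
    congr 1; funext y; rw [hk]; ring
  rw [haφ] at h3
  have hk0 : k = 0 := (mul_eq_zero.1 h3.symm).resolve_right h.rφ_integral_sq_pos.ne'
  simp [hk, hk0] at hne

/-- Coercivity of `L̃₁₁` on the orthogonal complement of its ground state and its kernel. -/
theorem exists_coercive_V (h : IsSoliton σ ω c φ W r)
    (he : IsGroundState (potV σ ω c W) m e e₁) :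
    ∃ δ : ℝ, 0 < δ ∧ ∀ a a' : ℝ → ℝ, IsH1 a a' → ∫ y, a y * e y = 0 →
      ∫ y, a y * (r y * φ y) = 0 →
      δ * ((∫ x, a x ^ 2) + ∫ x, a' x ^ 2) ≤ energy (potV σ ω c W) a a' a a' := by
  obtain ⟨C, hC⟩ := h.isShortRange_V
  obtain ⟨δ, hδ, H⟩ := hC.exists_coercive (by linarith [h.lt_ω]) (S := {e, fun y => r y * φ y})
    (by
      rintro s (rfl | rfl)
      exacts [he.isH1.memLp, h.isH1_rφ.memLp])
    (fun f f' hf hfS hpos => h.energy_pos he hf (hfS _ (by simp)) (hfS _ (by simp)) hpos)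
  refine ⟨δ, hδ, fun a a' ha h1 h2 => H a a' ha ?_⟩
  rintro s (rfl | rfl)
  exacts [h1, h2]

theorem isH1_r_mul (h : IsSoliton σ ω c φ W r) {b b' : ℝ → ℝ} (hb : IsH1 b b') :
    IsH1 (fun y => r y * b y) fun y => (potU σ ω c W y - r y ^ 2) * b y + r y * b' y := by
  obtain ⟨C, -, hC⟩ := h.r_bound
  obtain ⟨CU, hCU⟩ := h.isShortRange_U
  exact hb.bdd_mul h.hasDerivAt_r' (hCU.continuous.sub (h.continuous_r.pow 2)) hC
    (C' := CU + C ^ 2) fun x => (abs_sub _ _).trans (add_le_add (hCU.bound x) (by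
      rw [abs_pow]; exact pow_le_pow_left₀ (abs_nonneg _) (hC x) 2))

theorem memLp_sub_r_mul (h : IsSoliton σ ω c φ W r) {b b' : ℝ → ℝ} (hb : IsH1 b b') :
    MemLp (fun y => b' y - r y * b y) 2 volume :=
  hb.memLp_deriv.sub (h.isH1_r_mul hb).memLp

/-- The factorization `-∂² + U = (-∂ - r)(∂ - r)`, a consequence of `U = r' + r²`; the two
integrands differ by `(r b g)'`. -/
theorem energy_U_eq (h : IsSoliton σ ω c φ W r) {b b' g g' : ℝ → ℝ} (hb : IsH1 b b')
    (hg : IsH1 g g') : energy (potU σ ω c W) b b' g g'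
      = ∫ y, (b' y - r y * b y) * (g' y - r y * g y) := by
  obtain ⟨C, hC⟩ := h.isShortRange_U
  have h1 := (h.isH1_r_mul hb).by_parts hg
  have i1 := (h.isH1_r_mul hb).integrable_mul_deriv hg
  have i2 := integrable_mul_of_memLp (h.memLp_sub_r_mul hb) (h.memLp_sub_r_mul hg)
  rw [← sub_zero (energy _ _ _ _ _), ← h1, energy, ← integral_sub (hC.integrable_energy hb hg) i1]
  congr 1; funext y; ring

theorem isPrim_div_φ (h : IsSoliton σ ω c φ W r) {b b' : ℝ → ℝ} (hb : IsPrim b b') :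
    IsPrim (fun y => b y * (φ y)⁻¹) fun y => (b' y - r y * b y) * (φ y)⁻¹ := by
  have hφ : Continuous fun y => (φ y)⁻¹ := h.continuous_φ.inv₀ fun y => (h.φ_pos y).ne'
  have h1 : IsPrim (fun y => (φ y)⁻¹) (fun y => -r y * (φ y)⁻¹) :=
    IsPrim.of_hasDerivAt (fun y => by
      refine ((h.hasDerivAt_φ y).inv (h.φ_pos y).ne').congr_deriv ?_
      have := (h.φ_pos y).ne'
      field_simp) (h.continuous_r.neg.mul hφ)
  refine (hb.mul h1).congr_deriv (Eventually.of_forall fun y => ?_)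
  simp only; ring

/-- The equation `b' = r b` says that `b/φ` has zero derivative. -/
theorem eq_smul_φ (h : IsSoliton σ ω c φ W r) {b b' : ℝ → ℝ} (hb : IsPrim b b')
    (hz : (fun y => b' y - r y * b y) =ᵐ[volume] 0) : ∃ k : ℝ, ∀ y, b y = k * φ y := by
  have h1 := (h.isPrim_div_φ hb).congr_deriv (g' := fun _ => 0) (by
    filter_upwards [hz] with y hy
    rw [hy]; simp)
  refine ⟨b 0 * (φ 0)⁻¹, fun y => ?_⟩
  rw [← h1.const_of_zero y 0, inv_mul_cancel_right₀ (h.φ_pos y).ne']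

/-- Coercivity of `-∂² + φ'' / φ` on the orthogonal complement of `φ`. -/
theorem exists_coercive_U (h : IsSoliton σ ω c φ W r) :
    ∃ δ : ℝ, 0 < δ ∧ ∀ b b' : ℝ → ℝ, IsH1 b b' → ∫ y, b y * φ y = 0 →
      δ * ((∫ x, b x ^ 2) + ∫ x, b' x ^ 2) ≤ ∫ y, (b' y - r y * b y) ^ 2 := by
  obtain ⟨C, hC⟩ := h.isShortRange_U
  have hE : ∀ b b' : ℝ → ℝ, IsH1 b b' → energy (potU σ ω c W) b b' b b'
      = ∫ y, (b' y - r y * b y) ^ 2 := fun b b' hb => by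
    rw [h.energy_U_eq hb hb]
    simp_rw [pow_two]
  obtain ⟨δ, hδ, H⟩ := hC.exists_coercive (by linarith [h.lt_ω]) (S := {φ})
    (by rintro s rfl; exact h.φ_memLp)
    (fun b b' hb hbS hpos => by
      rw [hE b b' hb]
      refine lt_of_le_of_ne (integral_nonneg fun _ => sq_nonneg _) fun h0 => ?_
      obtain ⟨k, hk⟩ := h.eq_smul_φ hb.prim
        (ae_eq_zero_of_integral_sq (h.memLp_sub_r_mul hb) h0.symm)
      have h1 := hbS φ rfl
      have h2 : ∫ y, b y * φ y = k * ∫ y, φ y ^ 2 := by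
        rw [← integral_const_mul]
        congr 1; funext y; rw [hk]; ring
      rw [h1] at h2
      have hk0 : k = 0 := (mul_eq_zero.1 h2.symm).resolve_right h.φ_integral_sq_pos.ne'
      simp [hk, hk0] at hpos)
  refine ⟨δ, hδ, fun b b' hb h1 => ?_⟩
  rw [← hE b b' hb]
  refine H b b' hb ?_
  rintro s rfl
  exact h1

/-- The negative eigenvalue is unique and simple. -/
theorem eigenfunction_unique (h : IsSoliton σ ω c φ W r)
    (he : IsGroundState (potV σ ω c W) m e e₁) {μ : ℝ} (hμ : μ < 0) {f f₁ : ℝ → ℝ}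
    (hf : IsH1 f f₁) (hne : 0 < ∫ y, f y ^ 2)
    (hE : ∀ g g' : ℝ → ℝ, IsH1 g g' →
      energy (potV σ ω c W) f f₁ g g' = μ * ∫ y, f y * g y) :
    μ = m ∧ ∃ k : ℝ, ∀ y, f y = k * e y := by
  obtain ⟨C, hC⟩ := h.isShortRange_V
  have h1 : m * ∫ y, e y * f y = μ * ∫ y, e y * f y := by
    rw [← he.energy_eq _ _ hf, energy_comm, hE _ _ he.isH1]
    simp_rw [mul_comm (e _)]
  -- The form is nonnegative on the complement of `e`, so no nonzero function there has energy `μ ∫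
  -- u²` with `μ < 0`.
  have hneg : ∀ (u u' : ℝ → ℝ), IsH1 u u' → ∫ y, u y * e y = 0 →
      (energy (potV σ ω c W) u u' u u' = μ * ∫ y, u y ^ 2) → ∀ y, u y = 0 := by
    intro u u' hu hue huE y
    by_contra hy
    have h2 := h.energy_nonneg_of_orthogonal he hu hue
    rw [huE] at h2
    nlinarith [hu.integral_sq_pos hy]
  have hff : energy (potV σ ω c W) f f₁ f f₁ = μ * ∫ y, f y ^ 2 := by
    rw [hE _ _ hf]; simp_rw [pow_two]
  have hμm : μ = m := by
    by_contra hn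
    have h2 : ∫ y, e y * f y = 0 := by
      by_contra h3
      exact hn (mul_right_cancel₀ h3 h1).symm
    simp_rw [mul_comm (e _)] at h2
    have h3 := hneg f f₁ hf h2 hff
    simp [h3] at hne
  refine ⟨hμm, ∫ y, f y * e y, fun y => ?_⟩
  set k := ∫ y, f y * e y with hk
  have hee : energy (potV σ ω c W) e e₁ e e₁ = m := by
    rw [he.energy_eq _ _ he.isH1]
    simp_rw [← pow_two]
    rw [he.integral_sq, mul_one]
  have i0 := integrable_sq_of_memLp hf.memLp
  have i1 := hf.integrable_mul he.isH1
  have i2 := integrable_sq_of_memLp he.isH1.memLp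
  have hu := (hf.const_mul 1).add (he.isH1.const_mul (-k))
  -- Simplicity: `f - k e` is orthogonal to `e` and still has energy `μ` times its squared norm.
  have h4 := hneg _ _ hu (by
      calc ∫ y, (1 * f y + -k * e y) * e y = ∫ y, f y * e y + -k * e y ^ 2 := by
            congr 1; funext y; ring
        _ = 0 := by
            rw [integral_add i1 (i2.const_mul _), integral_const_mul, he.integral_sq, ← hk]; ring)
    (by
      rw [hC.energy_comb hf he.isH1, hff, hE _ _ he.isH1, hee, ← hk]
      calc _ = μ * ((∫ y, f y ^ 2) + -(2 * k) * (∫ y, f y * e y) + k ^ 2 * ∫ y, e y ^ 2) := by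
            rw [← hk, he.integral_sq, hμm]; ring
        _ = _ := by
            rw [← integral_const_mul (-(2 * k)), ← integral_const_mul (k ^ 2),
              ← integral_add i0 (i1.const_mul _), ← integral_add
                (by exact i0.add (i1.const_mul _)) (i2.const_mul _)]
            congr 2; funext y; ring) y
  linarith

/-- A comparison argument: `e (e' - r e)` has derivative `(e' - r e)² + (V - U - m) e²`, nonnegative
for large `y` because `V - U → 0` and `m < 0`. As it tends to zero it is nonpositive there, so
`(e/φ)²` is eventually nonincreasing. -/
theorem exists_half_bound (h : IsSoliton σ ω c φ W r) (hm : m < 0) (he : IsH1 e e₁)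
    (he₁ : IsH1 e₁ fun y => (potV σ ω c W y - m) * e y) :
    ∃ C, ∀ y, 0 ≤ y → |e y| ≤ C * φ y := by
  have hp := he₁.sub (h.isH1_r_mul he)
  have hF := he.prim.mul hp.prim
  have hFd : ∀ y, e₁ y * (e₁ y - r y * e y) + e y * ((potV σ ω c W y - m) * e y
      - ((potU σ ω c W y - r y ^ 2) * e y + r y * e₁ y))
      = (e₁ y - r y * e y) ^ 2 + (potV σ ω c W y - potU σ ω c W y - m) * e y ^ 2 := fun y => by
    ring
  have hlim : Tendsto (fun y => potV σ ω c W y - potU σ ω c W y - m) atTop (𝓝 (-m)) := by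
    have h1 : Tendsto (fun y => (c * (2 * σ + 1) / 2 - c / 2) * W y
        - ((8 * σ ^ 2 + 6 * σ + 1) / (4 * (σ + 1) ^ 2) - (2 * σ + 1) / (4 * (σ + 1) ^ 2))
          * W y ^ 2 - m) atTop (𝓝 ((c * (2 * σ + 1) / 2 - c / 2) * 0
        - ((8 * σ ^ 2 + 6 * σ + 1) / (4 * (σ + 1) ^ 2) - (2 * σ + 1) / (4 * (σ + 1) ^ 2))
          * 0 ^ 2 - m)) :=
      ((h.W_tendsto.const_mul _).sub ((h.W_tendsto.pow 2).const_mul _)).sub_const _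
    have h2 : (c * (2 * σ + 1) / 2 - c / 2) * 0
        - ((8 * σ ^ 2 + 6 * σ + 1) / (4 * (σ + 1) ^ 2) - (2 * σ + 1) / (4 * (σ + 1) ^ 2))
          * 0 ^ 2 - m = -m := by ring
    rw [h2] at h1
    refine h1.congr fun y => ?_
    simp only [potV, potU]; ring
  obtain ⟨R, hR⟩ := eventually_atTop.1 (hlim.eventually_const_lt (by linarith : (0 : ℝ) < -m))
  have hFneg : ∀ y, R ≤ y → e y * (e₁ y - r y * e y) ≤ 0 := by
    intro y hy
    refine ge_of_tendsto (he.mul_tendsto_atTop hp) ?_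
    filter_upwards [eventually_ge_atTop y] with z hz
    rw [← sub_nonneg, hF.sub_eq y z]
    refine intervalIntegral.integral_nonneg hz fun x hx => ?_
    rw [hFd]
    have := hR x (hy.trans hx.1)
    positivity
  have hφ : Continuous fun y => (φ y)⁻¹ := h.continuous_φ.inv₀ fun y => (h.φ_pos y).ne'
  have hhc : Continuous fun y => e y * (φ y)⁻¹ := he.continuous.mul hφ
  have hhd : ∀ y, HasDerivAt (fun y => e y * (φ y)⁻¹) ((e₁ y - r y * e y) * (φ y)⁻¹) y :=
    (h.isPrim_div_φ he.prim).hasDerivAt (hp.continuous.mul hφ)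
  have hanti : AntitoneOn (fun y => (e y * (φ y)⁻¹) ^ 2) (Ici R) := by
    refine antitoneOn_of_deriv_nonpos (convex_Ici R) (hhc.pow 2).continuousOn
      (fun y _ => ((hhd y).fun_pow 2).differentiableAt.differentiableWithinAt) fun y hy => ?_
    rw [interior_Ici] at hy
    rw [((hhd y).fun_pow 2).deriv]
    have h1 := hFneg y (le_of_lt hy)
    have h2 : 0 ≤ (φ y)⁻¹ ^ 2 := sq_nonneg _
    simp only [Nat.cast_ofNat, Nat.add_one_sub_one, pow_one]
    nlinarith [mul_nonneg h2 (neg_nonneg.2 h1)]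
  obtain ⟨C, hC⟩ := (isCompact_Icc (a := (0 : ℝ)) (b := |R|)).exists_bound_of_continuousOn
    hhc.continuousOn
  refine ⟨C, fun y hy => ?_⟩
  suffices |e y * (φ y)⁻¹| ≤ C by
    rw [abs_mul, abs_of_pos (inv_pos.2 (h.φ_pos y)), ← div_eq_mul_inv,
      div_le_iff₀ (h.φ_pos y)] at this
    exact this
  rcases le_or_gt y |R| with hyR | hyR
  · exact hC y ⟨hy, hyR⟩
  · have h1 := hanti (le_abs_self R) ((le_abs_self R).trans hyR.le) hyR.le
    exact (sq_le_sq.1 h1).trans (hC |R| ⟨abs_nonneg R, le_rfl⟩)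

/-- The ground state is bounded by a multiple of `φ`. -/
theorem exists_groundState_bound (h : IsSoliton σ ω c φ W r)
    (he : IsGroundState (potV σ ω c W) m e e₁) : ∃ C, ∀ y, |e y| ≤ C * φ y := by
  obtain ⟨C, hC⟩ := h.exists_half_bound he.neg he.isH1 he.isH1_deriv
  have h1 : IsH1 (fun y => -e₁ (-y)) fun y => (potV σ ω c W y - m) * e (-y) := by
    have h2 := he.isH1_deriv.comp_neg.const_mul (-1)
    simp only [h.V_even, neg_mul, one_mul, neg_neg] at h2
    exact h2
  obtain ⟨C', hC'⟩ := h.exists_half_bound he.neg he.isH1.comp_neg h1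
  refine ⟨max C C', fun y => ?_⟩
  rcases le_total 0 y with hy | hy
  · exact (hC y hy).trans (mul_le_mul_of_nonneg_right (le_max_left _ _) (h.φ_pos y).le)
  · have h2 := hC' (-y) (by linarith)
    rw [neg_neg, h.φ_even] at h2
    exact h2.trans (mul_le_mul_of_nonneg_right (le_max_right _ _) (h.φ_pos y).le)

/-- The exponent `2σ - 1` may be negative, so square integrability of `e` is not enough; `|e| ≤ C φ`
bounds the product by `C W`. -/
theorem integrable_rpow_mul_groundState (h : IsSoliton σ ω c φ W r)
    (he : IsGroundState (potV σ ω c W) m e e₁) :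
    Integrable fun y => φ y ^ (2 * σ - 1) * e y := by
  obtain ⟨C, hC⟩ := h.exists_groundState_bound he
  have hc : Continuous fun y => φ y ^ (2 * σ - 1) :=
    h.continuous_φ.rpow_const fun y => Or.inl (h.φ_pos y).ne'
  refine (h.W_integrable.const_mul C).mono' (hc.mul he.isH1.continuous).aestronglyMeasurable
    (Eventually.of_forall fun y => ?_)
  have h1 := Real.rpow_pos_of_pos (h.φ_pos y) (2 * σ - 1)
  rw [norm_mul, Real.norm_of_nonneg h1.le, Real.norm_eq_abs, h.W_eq]
  calc φ y ^ (2 * σ - 1) * |e y| ≤ φ y ^ (2 * σ - 1) * (C * φ y) :=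
        mul_le_mul_of_nonneg_left (hC y) h1.le
    _ = C * φ y ^ (2 * σ) := by
        rw [Real.rpow_sub_one (h.φ_pos y).ne']
        have := (h.φ_pos y).ne'
        field_simp

end IsSoliton

end Spectral

end GDNLS

namespace GDNLS

/-! ### Complex `H¹` in polar form, and direct sums from dual functionals. -/

section ComplexH1

open Filter Topology

/-- Biorthogonality gives both independence and the explicit projections `(lᵢ x / lᵢ xᵢ) xᵢ`, whose
remainder lies in the common kernel. -/
theorem isInternal_of_dual_functionals {V : Type*} [AddCommGroup V] [Module ℝ V] {x₁ x₂ x₃ : V}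
    {l₁ l₂ l₃ : V →ₗ[ℝ] ℝ} (h11 : l₁ x₁ ≠ 0) (h12 : l₁ x₂ = 0) (h13 : l₁ x₃ = 0)
    (h21 : l₂ x₁ = 0) (h22 : l₂ x₂ ≠ 0) (h23 : l₂ x₃ = 0)
    (h31 : l₃ x₁ = 0) (h32 : l₃ x₂ = 0) (h33 : l₃ x₃ ≠ 0) :
    DirectSum.IsInternal ![Submodule.span ℝ {x₁}, Submodule.span ℝ {x₂, x₃},
      l₁.ker ⊓ l₂.ker ⊓ l₃.ker] := by
  refine DirectSum.isInternal_submodule_of_iSupIndep_of_iSup_eq_top ?_ ?_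
  · have hN : Submodule.span ℝ {x₁} ≤ l₂.ker ⊓ l₃.ker := by
      rw [Submodule.span_singleton_le_iff_mem]
      exact ⟨h21, h31⟩
    have hZ : Submodule.span ℝ {x₂, x₃} ≤ l₁.ker := by
      rw [Submodule.span_le]
      rintro x (rfl | rfl)
      exacts [h12, h13]
    have hd0 : Disjoint (Submodule.span ℝ {x₁}) l₁.ker := by
      rw [Submodule.disjoint_def]
      intro x hx hk
      obtain ⟨a, rfl⟩ := Submodule.mem_span_singleton.1 hx
      rw [LinearMap.mem_ker, map_smul, smul_eq_mul] at hk
      rw [(mul_eq_zero.1 hk).resolve_right h11, zero_smul]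
    have hd1 : Disjoint (Submodule.span ℝ {x₂, x₃}) (l₂.ker ⊓ l₃.ker) := by
      rw [Submodule.disjoint_def]
      intro x hx hk
      obtain ⟨a, b, rfl⟩ := Submodule.mem_span_pair.1 hx
      obtain ⟨hk2, hk3⟩ := hk
      simp only [SetLike.mem_coe, LinearMap.mem_ker, map_add, map_smul, h23, h32, mul_zero,
        add_zero, zero_add, smul_eq_mul, mul_eq_zero, h22, h33, or_false] at hk2 hk3
      rw [hk2, hk3, zero_smul, zero_smul, add_zero]
    have hd2 : Disjoint (l₁.ker ⊓ l₂.ker ⊓ l₃.ker)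
        (Submodule.span ℝ {x₁} ⊔ Submodule.span ℝ {x₂, x₃}) := by
      rw [Submodule.disjoint_def]
      rintro x ⟨⟨hk1, hk2⟩, hk3⟩ hx
      obtain ⟨y, hy, z, hz, rfl⟩ := Submodule.mem_sup.1 hx
      have hy0 : y = 0 := Submodule.disjoint_def.1 hd0 y hy (by
        have := hZ hz
        rw [LinearMap.mem_ker] at this ⊢
        rwa [SetLike.mem_coe, LinearMap.mem_ker, map_add, this, add_zero] at hk1)
      rw [hy0, zero_add] at hk2 hk3 ⊢
      exact Submodule.disjoint_def.1 hd1 z hz ⟨hk2, hk3⟩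
    intro i
    fin_cases i
    · refine hd0.mono_right (iSup₂_le fun j hj => ?_)
      fin_cases j
      exacts [absurd rfl hj, hZ, inf_le_left.trans inf_le_left]
    · refine hd1.mono_right (iSup₂_le fun j hj => ?_)
      fin_cases j
      exacts [hN, absurd rfl hj, le_inf (inf_le_left.trans inf_le_right) inf_le_right]
    · refine hd2.mono_right (iSup₂_le fun j hj => ?_)
      fin_cases j
      exacts [le_sup_left, le_sup_right, absurd rfl hj]
  · rw [eq_top_iff]
    intro x _
    set y := (l₁ x / l₁ x₁) • x₁ with hy
    set z := (l₂ x / l₂ x₂) • x₂ + (l₃ x / l₃ x₃) • x₃ with hz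
    have hyN : y ∈ Submodule.span ℝ {x₁} :=
      Submodule.smul_mem _ _ (Submodule.mem_span_singleton_self _)
    have hzZ : z ∈ Submodule.span ℝ {x₂, x₃} := Submodule.mem_span_pair.2 ⟨_, _, rfl⟩
    have hp : x - y - z ∈ l₁.ker ⊓ l₂.ker ⊓ l₃.ker := by
      refine ⟨⟨?_, ?_⟩, ?_⟩ <;>
      simp [hy, hz, h11, h12, h13, h21, h22, h23, h31, h32, h33]
    have h1 := Submodule.mem_iSup_of_mem (p := ![Submodule.span ℝ {x₁}, Submodule.span ℝ {x₂, x₃},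
      l₁.ker ⊓ l₂.ker ⊓ l₃.ker]) 0 hyN
    have h2 := Submodule.mem_iSup_of_mem (p := ![Submodule.span ℝ {x₁}, Submodule.span ℝ {x₂, x₃},
      l₁.ker ⊓ l₂.ker ⊓ l₃.ker]) 1 hzZ
    have h3 := Submodule.mem_iSup_of_mem (p := ![Submodule.span ℝ {x₁}, Submodule.span ℝ {x₂, x₃},
      l₁.ker ⊓ l₂.ker ⊓ l₃.ker]) 2 hp
    have h4 := Submodule.add_mem _ (Submodule.add_mem _ h1 h2) h3
    convert h4 using 1
    abel

theorem fn_add (u v : H1) : fn (u + v) =ᵐ[volume] fun x => fn u x + fn v x :=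
  Lp.coeFn_add (fn u) (fn v)

theorem der_add (u v : H1) : der (u + v) =ᵐ[volume] fun x => der u x + der v x :=
  Lp.coeFn_add (der u) (der v)

theorem fn_smul (t : ℝ) (u : H1) : fn (t • u) =ᵐ[volume] fun x => t * fn u x := by
  filter_upwards [Lp.coeFn_smul t (fn u)] with x hx
  rw [← Complex.real_smul]; exact hx

theorem der_smul (t : ℝ) (u : H1) : der (t • u) =ᵐ[volume] fun x => t * der u x := by
  filter_upwards [Lp.coeFn_smul t (der u)] with x hx
  rw [← Complex.real_smul]; exact hx

theorem H1_ext {u v : H1} (h : fn u =ᵐ[volume] fn v) (h' : der u =ᵐ[volume] der v) : u = v := by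
  have h1 : fn u = fn v := Lp.ext h
  have h2 : der u = der v := Lp.ext h'
  exact Subtype.ext ((WithLp.equiv 2 _).injective (Prod.ext h1 h2))

theorem memLp_ofReal_add_I {f g : ℝ → ℝ} (hf : MemLp f 2 volume) (hg : MemLp g 2 volume) :
    MemLp (fun x => (f x : ℂ) + Complex.I * g x) 2 volume := by
  have key : ∀ h : ℝ → ℝ, MemLp h 2 volume → MemLp (fun x => (h x : ℂ)) 2 volume := fun h hh =>
    hh.of_le (Complex.continuous_ofReal.comp_aestronglyMeasurable hh.1)
      (Eventually.of_forall fun x => by simp)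
  exact (key f hf).add ((key g hg).const_mul Complex.I)

/-- An element of `H¹` with given weakly differentiable real and imaginary parts. -/
theorem exists_H1_of_isH1 {f f' g g' : ℝ → ℝ} (hf : IsH1 f f') (hg : IsH1 g g') :
    ∃ u : H1, (fn u =ᵐ[volume] fun x => (f x : ℂ) + Complex.I * g x) ∧
      der u =ᵐ[volume] fun x => (f' x : ℂ) + Complex.I * g' x := by
  have h1 := memLp_ofReal_add_I hf.memLp hg.memLp
  have h2 := memLp_ofReal_add_I hf.memLp_deriv hg.memLp_deriv
  refine ⟨⟨WithLp.toLp 2 (h1.toLp _, h2.toLp _), ?_⟩, h1.coeFn_toLp, h2.coeFn_toLp⟩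
  intro ψ hψ hs
  have hd : Continuous (deriv ψ) := hψ.continuous_deriv (by simp)
  have key : ∀ (η p q : ℝ → ℝ), Continuous η → HasCompactSupport η → MemLp p 2 volume →
      MemLp q 2 volume → ∀ F : ℝ → ℂ, (F =ᵐ[volume] fun x => (p x : ℂ) + Complex.I * q x) →
      ∫ x, η x • F x = ((∫ x, η x * p x : ℝ) : ℂ) + Complex.I * (∫ x, η x * q x : ℝ) := by
    intro η p q hη hηs hp hq F hF
    have i1 : Integrable (fun x => ((η x * p x : ℝ) : ℂ)) :=
      (integrable_mul_of_memLp (hη.memLp_of_hasCompactSupport hηs) hp).ofReal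
    have i2 : Integrable (fun x => ((η x * q x : ℝ) : ℂ)) :=
      (integrable_mul_of_memLp (hη.memLp_of_hasCompactSupport hηs) hq).ofReal
    rw [← integral_complex_ofReal, ← integral_complex_ofReal, ← integral_const_mul,
      ← integral_add i1 (i2.const_mul _)]
    refine integral_congr_ae ?_
    filter_upwards [hF] with x hx
    rw [hx, Complex.real_smul]
    push_cast
    ring
  have hw1 := hf.prim.hasWeakDeriv ψ hψ hs
  have hw2 := hg.prim.hasWeakDeriv ψ hψ hs
  simp only [smul_eq_mul] at hw1 hw2
  change ∫ x, deriv ψ x • h1.toLp _ x = -∫ x, ψ x • h2.toLp _ x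
  rw [key _ f g hd hs.deriv hf.memLp hg.memLp _ h1.coeFn_toLp,
    key _ f' g' hψ.continuous hs hf.memLp_deriv hg.memLp_deriv _ h2.coeFn_toLp, hw1, hw2]
  push_cast
  ring

theorem exists_isH1_of_H1 (u : H1) : ∃ f f' g g' : ℝ → ℝ, IsH1 f f' ∧ IsH1 g g' ∧
    (fn u =ᵐ[volume] fun x => (f x : ℂ) + Complex.I * g x) ∧
      der u =ᵐ[volume] fun x => (f' x : ℂ) + Complex.I * g' x := by
  have hw : HasWeakDeriv (fn u : ℝ → ℂ) (der u) := u.2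
  have hre : HasWeakDeriv (fun x => (fn u x).re) (fun x => (der u x).re) := by
    intro ψ hψ hs
    have h1 := congrArg Complex.reCLM (hw ψ hψ hs)
    rw [map_neg, ← Complex.reCLM.integral_comp_comm
      (integrable_smul_L2C (hψ.continuous_deriv (by simp)) hs.deriv _),
      ← Complex.reCLM.integral_comp_comm (integrable_smul_L2C hψ.continuous hs _)] at h1
    simpa using h1
  have him : HasWeakDeriv (fun x => (fn u x).im) (fun x => (der u x).im) := by
    intro ψ hψ hs
    have h1 := congrArg Complex.imCLM (hw ψ hψ hs)
    rw [map_neg, ← Complex.imCLM.integral_comp_comm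
      (integrable_smul_L2C (hψ.continuous_deriv (by simp)) hs.deriv _),
      ← Complex.imCLM.integral_comp_comm (integrable_smul_L2C hψ.continuous hs _)] at h1
    simpa using h1
  have hu := Lp.memLp (fn u)
  have hd := Lp.memLp (der u)
  obtain ⟨f, hf, hfH⟩ := hre.exists_isH1 hu.re hd.re
  obtain ⟨g, hg, hgH⟩ := him.exists_isH1 hu.im hd.im
  refine ⟨f, fun x => (der u x).re, g, fun x => (der u x).im, hfH, hgH, ?_, ?_⟩
  · filter_upwards [hf, hg] with x h1 h2
    rw [← h1, ← h2, mul_comm]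
    exact (Complex.re_add_im _).symm
  · filter_upwards with x
    rw [mul_comm, Complex.re_add_im]

theorem integrable_mul_conj {u v : ℝ → ℂ} (hu : MemLp u 2 volume) (hv : MemLp v 2 volume) :
    Integrable fun x => u x * conj (v x) := by
  have h1 : MemLp (fun x => conj (v x)) 2 volume :=
    hv.of_le (Complex.continuous_conj.comp_aestronglyMeasurable hv.1)
      (Eventually.of_forall fun x => by simp)
  exact hu.integrable_mul h1

theorem integral_H1_by_parts (w v : H1) :
    (∫ x, fn w x * conj (der v x) + der w x * conj (fn v x)).re = 0 := by
  obtain ⟨f, f', g, g', hf, hg, h1, h2⟩ := exists_isH1_of_H1 w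
  obtain ⟨p, p', q, q', hp, hq, h3, h4⟩ := exists_isH1_of_H1 v
  have hi := (integrable_mul_conj (Lp.memLp (fn w)) (Lp.memLp (der v))).add
    (integrable_mul_conj (Lp.memLp (der w)) (Lp.memLp (fn v)))
  have h5 := Complex.reCLM.integral_comp_comm hi
  simp only [Complex.reCLM_apply, Pi.add_apply] at h5
  rw [← h5]
  calc _ = ∫ x, (f' x * p x + f x * p' x) + (g' x * q x + g x * q' x) := by
        refine integral_congr_ae ?_
        filter_upwards [h1, h2, h3, h4] with x h1 h2 h3 h4
        rw [h1, h2, h3, h4]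
        simp
        ring
    _ = 0 := by
        rw [integral_add (hf.integrable_mul_deriv hp) (hg.integrable_mul_deriv hq),
          hf.by_parts hp, hg.by_parts hq, add_zero]

theorem norm_sq_L2C (f : L2C) : ‖f‖ ^ 2 = ∫ x, ‖f x‖ ^ 2 := by
  rw [← real_inner_self_eq_norm_sq, L2.inner_def]
  simp_rw [real_inner_self_eq_norm_sq]

theorem norm_sq_H1 (u : H1) : ‖u‖ ^ 2 = (∫ x, ‖fn u x‖ ^ 2) + ∫ x, ‖der u x‖ ^ 2 := by
  rw [← norm_sq_L2C, ← norm_sq_L2C]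
  exact WithLp.prod_norm_sq_eq_of_L2 u.1

/-- `θ` has the bounded continuous derivative `τ`. -/
structure IsPhase (θ τ : ℝ → ℝ) : Prop where
  hasDerivAt : ∀ x, HasDerivAt θ (τ x) x
  continuous_deriv : Continuous τ
  bound : ∃ C, ∀ x, |τ x| ≤ C

/-- `u = (a + i b) e^{iθ}` with `a`, `b` in `H¹(ℝ; ℝ)`. -/
structure IsPolar (θ τ : ℝ → ℝ) (u : H1) (a a' b b' : ℝ → ℝ) : Prop where
  re : IsH1 a a'
  im : IsH1 b b'
  fn_eq : fn u =ᵐ[volume] fun x =>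
    ((a x : ℂ) + Complex.I * b x) * Complex.exp (Complex.I * (θ x : ℂ))
  der_eq : der u =ᵐ[volume] fun x =>
    (((a' x - τ x * b x : ℝ) : ℂ) + Complex.I * ((b' x + τ x * a x : ℝ) : ℂ))
      * Complex.exp (Complex.I * (θ x : ℂ))

theorem exp_I_mul_ofReal (t : ℝ) :
    Complex.exp (Complex.I * (t : ℂ)) = (Real.cos t : ℂ) + Complex.I * (Real.sin t : ℂ) := by
  rw [mul_comm, Complex.exp_mul_I, Complex.ofReal_cos, Complex.ofReal_sin]
  ring

namespace IsPhase

variable {θ τ : ℝ → ℝ}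

theorem isH1_cos_mul (hθ : IsPhase θ τ) {f f' : ℝ → ℝ} (hf : IsH1 f f') :
    IsH1 (fun x => Real.cos (θ x) * f x)
      (fun x => -Real.sin (θ x) * τ x * f x + Real.cos (θ x) * f' x) := by
  obtain ⟨C, hC⟩ := hθ.bound
  have hc : Continuous θ := continuous_iff_continuousAt.2 fun x => (hθ.hasDerivAt x).continuousAt
  have hτ := hθ.continuous_deriv
  refine hf.bdd_mul (C := 1) (C' := C) (fun x => (hθ.hasDerivAt x).cos) (by fun_prop)
    (fun x => Real.abs_cos_le_one _) fun x => ?_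
  rw [abs_mul, abs_neg]
  exact (mul_le_of_le_one_left (abs_nonneg _) (Real.abs_sin_le_one _)).trans (hC x)

theorem isH1_sin_mul (hθ : IsPhase θ τ) {f f' : ℝ → ℝ} (hf : IsH1 f f') :
    IsH1 (fun x => Real.sin (θ x) * f x)
      (fun x => Real.cos (θ x) * τ x * f x + Real.sin (θ x) * f' x) := by
  obtain ⟨C, hC⟩ := hθ.bound
  have hc : Continuous θ := continuous_iff_continuousAt.2 fun x => (hθ.hasDerivAt x).continuousAt
  have hτ := hθ.continuous_deriv
  refine hf.bdd_mul (C := 1) (C' := C) (fun x => (hθ.hasDerivAt x).sin) (by fun_prop)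
    (fun x => Real.abs_sin_le_one _) fun x => ?_
  rw [abs_mul]
  exact (mul_le_of_le_one_left (abs_nonneg _) (Real.abs_cos_le_one _)).trans (hC x)

theorem exists_isPolar (hθ : IsPhase θ τ) (u : H1) :
    ∃ a a' b b' : ℝ → ℝ, IsPolar θ τ u a a' b b' := by
  obtain ⟨f, f', g, g', hf, hg, h1, h2⟩ := exists_isH1_of_H1 u
  -- The real and imaginary parts of `e^{-iθ} u`.
  refine ⟨_, _, _, _, (hθ.isH1_cos_mul hf).add (hθ.isH1_sin_mul hg),
    (hθ.isH1_cos_mul hg).sub (hθ.isH1_sin_mul hf), ?_, ?_⟩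
  · filter_upwards [h1] with x hx
    have hcs := Real.sin_sq_add_cos_sq (θ x)
    rw [hx, exp_I_mul_ofReal]
    generalize Real.cos (θ x) = C at *
    generalize Real.sin (θ x) = S at *
    apply Complex.ext <;> simp
    · linear_combination -f x * hcs
    · linear_combination -g x * hcs
  · filter_upwards [h2] with x hx
    have hcs := Real.sin_sq_add_cos_sq (θ x)
    rw [hx, exp_I_mul_ofReal]
    generalize Real.cos (θ x) = C at *
    generalize Real.sin (θ x) = S at *
    apply Complex.ext <;> simp
    · linear_combination -f' x * hcs
    · linear_combination -g' x * hcs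

theorem exists_of_isH1 (hθ : IsPhase θ τ) {a a' b b' : ℝ → ℝ} (ha : IsH1 a a') (hb : IsH1 b b') :
    ∃ u : H1, IsPolar θ τ u a a' b b' := by
  obtain ⟨u, h1, h2⟩ := exists_H1_of_isH1 ((hθ.isH1_cos_mul ha).sub (hθ.isH1_sin_mul hb))
    ((hθ.isH1_cos_mul hb).add (hθ.isH1_sin_mul ha))
  refine ⟨u, ha, hb, ?_, ?_⟩
  · filter_upwards [h1] with x hx
    rw [hx, exp_I_mul_ofReal]
    generalize Real.cos (θ x) = C at *
    generalize Real.sin (θ x) = S at *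
    apply Complex.ext <;> simp <;> ring
  · filter_upwards [h2] with x hx
    rw [hx, exp_I_mul_ofReal]
    generalize Real.cos (θ x) = C at *
    generalize Real.sin (θ x) = S at *
    apply Complex.ext <;> simp <;> ring

end IsPhase

namespace IsPolar

variable {θ τ : ℝ → ℝ} {u v : H1} {a a' b b' p p' q q' : ℝ → ℝ}

theorem add (hu : IsPolar θ τ u a a' b b') (hv : IsPolar θ τ v p p' q q') :
    IsPolar θ τ (u + v) (fun x => a x + p x) (fun x => a' x + p' x) (fun x => b x + q x)
      (fun x => b' x + q' x) := by
  refine ⟨hu.re.add hv.re, hu.im.add hv.im, ?_, ?_⟩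
  · filter_upwards [fn_add u v, hu.fn_eq, hv.fn_eq] with x h1 h2 h3
    rw [h1, h2, h3]; push_cast; ring
  · filter_upwards [der_add u v, hu.der_eq, hv.der_eq] with x h1 h2 h3
    rw [h1, h2, h3]; push_cast; ring

theorem smul (hu : IsPolar θ τ u a a' b b') (t : ℝ) :
    IsPolar θ τ (t • u) (fun x => t * a x) (fun x => t * a' x) (fun x => t * b x)
      (fun x => t * b' x) := by
  refine ⟨hu.re.const_mul t, hu.im.const_mul t, ?_, ?_⟩
  · filter_upwards [fn_smul t u, hu.fn_eq] with x h1 h2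
    rw [h1, h2]; push_cast; ring
  · filter_upwards [der_smul t u, hu.der_eq] with x h1 h2
    rw [h1, h2]; push_cast; ring

theorem ext (hu : IsPolar θ τ u a a' b b') (hv : IsPolar θ τ v p p' q q') (h1 : ∀ x, a x = p x)
    (h2 : ∀ x, b x = q x) : u = v := by
  obtain rfl : a = p := funext h1
  obtain rfl : b = q := funext h2
  refine H1_ext (hu.fn_eq.trans hv.fn_eq.symm) ?_
  filter_upwards [hu.der_eq, hv.der_eq, hu.re.deriv_ae_eq hv.re, hu.im.deriv_ae_eq hv.im]
    with x h3 h4 h5 h6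
  rw [h3, h4, h5, h6]

theorem norm_exp_I (t : ℝ) : ‖Complex.exp (Complex.I * (t : ℂ))‖ = 1 := by
  rw [mul_comm, Complex.norm_exp_ofReal_mul_I]

theorem norm_sq_re_im (s t : ℝ) : ‖(s : ℂ) + Complex.I * t‖ ^ 2 = s ^ 2 + t ^ 2 := by
  rw [mul_comm, Complex.sq_norm, Complex.normSq_add_mul_I]

theorem norm_sq_le (hu : IsPolar θ τ u a a' b b') {C : ℝ} (hτ : Continuous τ)
    (hC : ∀ x, |τ x| ≤ C) :
    ‖u‖ ^ 2 ≤ (2 + 2 * C ^ 2) * (((∫ x, a x ^ 2) + ∫ x, a' x ^ 2)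
      + ((∫ x, b x ^ 2) + ∫ x, b' x ^ 2)) := by
  have i1 := integrable_sq_of_memLp hu.re.memLp
  have i2 := integrable_sq_of_memLp hu.re.memLp_deriv
  have i3 := integrable_sq_of_memLp hu.im.memLp
  have i4 := integrable_sq_of_memLp hu.im.memLp_deriv
  have e1 : ∫ x, ‖fn u x‖ ^ 2 = (∫ x, a x ^ 2) + ∫ x, b x ^ 2 := by
    rw [← integral_add i1 i3]
    refine integral_congr_ae ?_
    filter_upwards [hu.fn_eq] with x hx
    rw [hx, norm_mul, norm_exp_I, mul_one, norm_sq_re_im]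
  have e2 : ∫ x, ‖der u x‖ ^ 2 ≤ 2 * (∫ x, a' x ^ 2) + 2 * C ^ 2 * (∫ x, b x ^ 2)
      + (2 * (∫ x, b' x ^ 2) + 2 * C ^ 2 * ∫ x, a x ^ 2) := by
    have m1 := integrable_sq_of_memLp
      (hu.re.memLp_deriv.sub (memLp_bdd_mul hτ hC hu.im.memLp))
    have m2 := integrable_sq_of_memLp
      (hu.im.memLp_deriv.add (memLp_bdd_mul hτ hC hu.re.memLp))
    have e3 : ∫ x, ‖der u x‖ ^ 2
        = ∫ x, (a' x - τ x * b x) ^ 2 + (b' x + τ x * a x) ^ 2 := by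
      refine integral_congr_ae ?_
      filter_upwards [hu.der_eq] with x hx
      rw [hx, norm_mul, norm_exp_I, mul_one, norm_sq_re_im]
    rw [e3, ← integral_const_mul, ← integral_const_mul, ← integral_const_mul,
      ← integral_const_mul, ← integral_add (i2.const_mul _) (i3.const_mul _),
      ← integral_add (i4.const_mul _) (i1.const_mul _),
      ← integral_add (by exact (i2.const_mul _).add (i3.const_mul _))
        (by exact (i4.const_mul _).add (i1.const_mul _))]
    refine integral_mono (m1.add m2) (((i2.const_mul _).add (i3.const_mul _)).add
      ((i4.const_mul _).add (i1.const_mul _))) fun x => ?_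
    have h1 : τ x ^ 2 ≤ C ^ 2 := sq_le_sq' (by linarith [(abs_le.1 (hC x)).1])
      (le_of_abs_le (hC x))
    simp only
    nlinarith [sq_nonneg (a' x + τ x * b x), sq_nonneg (b' x - τ x * a x),
      mul_le_mul_of_nonneg_right h1 (sq_nonneg (b x)),
      mul_le_mul_of_nonneg_right h1 (sq_nonneg (a x))]
  have p1 : 0 ≤ ∫ x, a x ^ 2 := integral_nonneg fun _ => sq_nonneg _
  have p2 : 0 ≤ ∫ x, a' x ^ 2 := integral_nonneg fun _ => sq_nonneg _
  have p3 : 0 ≤ ∫ x, b x ^ 2 := integral_nonneg fun _ => sq_nonneg _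
  have p4 : 0 ≤ ∫ x, b' x ^ 2 := integral_nonneg fun _ => sq_nonneg _
  rw [norm_sq_H1, e1]
  nlinarith [mul_nonneg (sq_nonneg C) p2, mul_nonneg (sq_nonneg C) p4]

/-- The real `L²` pairing with `(p + i q) e^{iθ}` as a linear functional. -/
theorem exists_functional (hθ : Continuous θ) {p q : ℝ → ℝ} (hp : MemLp p 2 volume)
    (hq : MemLp q 2 volume) : ∃ l : H1 →ₗ[ℝ] ℝ, ∀ (u : H1) (a a' b b' : ℝ → ℝ),
      IsPolar θ τ u a a' b b' → l u = (∫ x, a x * p x) + ∫ x, b x * q x := by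
  have hm : MemLp (fun x => ((p x : ℂ) + Complex.I * q x) * Complex.exp (Complex.I * (θ x : ℂ)))
      2 volume := by
    have h1 := memLp_ofReal_add_I hp hq
    refine h1.of_le (h1.1.mul (by fun_prop : Continuous fun x =>
      Complex.exp (Complex.I * (θ x : ℂ))).aestronglyMeasurable)
      (Eventually.of_forall fun x => ?_)
    rw [norm_mul, norm_exp_I, mul_one]
  let G : L2C := hm.toLp _
  refine ⟨{ toFun := fun u => inner ℝ G (fn u)
            map_add' := fun u v => inner_add_right G (fn u) (fn v)
            map_smul' := fun t u => inner_smul_right G (fn u) t }, fun u a a' b b' hu => ?_⟩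
  change inner ℝ G (fn u) = _
  rw [L2.inner_def, ← integral_add (integrable_mul_of_memLp hu.re.memLp hp)
    (integrable_mul_of_memLp hu.im.memLp hq)]
  refine integral_congr_ae ?_
  filter_upwards [hm.coeFn_toLp, hu.fn_eq] with x h1 h2
  have hcs := Real.sin_sq_add_cos_sq (θ x)
  rw [h2, h1, exp_I_mul_ofReal, Complex.inner]
  generalize Real.cos (θ x) = C at *
  generalize Real.sin (θ x) = S at *
  simp
  linear_combination (a x * p x + b x * q x) * hcs

end IsPolar

end ComplexH1

end GDNLS

namespace GDNLS

/-! ### Polar form of `H_ϕ` and its kernel. -/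

section Linearization

open Filter Topology

theorem hasDerivAt_integral_Iic {f : ℝ → ℝ} (hf : Integrable f) (hc : Continuous f) (y : ℝ) :
    HasDerivAt (fun y => ∫ t in Iic y, f t) (f y) y := by
  have h1 : (fun y => ∫ t in Iic y, f t) = fun y => (∫ t in Iic (0 : ℝ), f t)
      + ∫ t in (0 : ℝ)..y, f t := by
    funext y
    rw [← intervalIntegral.integral_Iic_sub_Iic hf.integrableOn hf.integrableOn]
    ring
  rw [h1]
  exact (intervalIntegral.integral_hasDerivAt_right hf.intervalIntegrable
    (hc.stronglyMeasurableAtFilter _ _) hc.continuousAt).const_add _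

theorem abs_integral_Iic_le {f : ℝ → ℝ} (hf : Integrable f) (y : ℝ) :
    |∫ t in Iic y, f t| ≤ ∫ t, |f t| :=
  (abs_integral_le_integral_abs).trans
    (setIntegral_le_integral hf.abs (Eventually.of_forall fun _ => abs_nonneg _))

/-- The derivative of the phase, in terms of `W = φ^{2σ}`. -/
noncomputable def phaseDeriv (σ c : ℝ) (W : ℝ → ℝ) (y : ℝ) : ℝ := c / 2 - 1 / (2 * σ + 2) * W y

/-- The function `φ (b / φ)' + σ / (σ + 1) φ^{2σ} a`. -/
noncomputable def twist (σ : ℝ) (W r a b b' : ℝ → ℝ) (y : ℝ) : ℝ :=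
  b' y - r y * b y + σ / (σ + 1) * (W y * a y)

theorem memLp_mul_exp_I {F : ℝ → ℂ} (hF : MemLp F 2 volume) {θ : ℝ → ℝ} (hθ : Continuous θ) :
    MemLp (fun x => F x * Complex.exp (Complex.I * (θ x : ℂ))) 2 volume :=
  hF.of_le (hF.1.mul (by fun_prop : Continuous fun x =>
      Complex.exp (Complex.I * (θ x : ℂ))).aestronglyMeasurable)
    (Eventually.of_forall fun x => by rw [norm_mul, IsPolar.norm_exp_I, mul_one])

namespace IsSoliton

variable {σ ω c : ℝ} {φ W r : ℝ → ℝ}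

theorem hasDerivAt_phaseDeriv (h : IsSoliton σ ω c φ W r) (y : ℝ) :
    HasDerivAt (phaseDeriv σ c W) (-(1 / (2 * σ + 2) * (2 * σ * r y * W y))) y :=
  ((h.hasDerivAt_W y).const_mul (1 / (2 * σ + 2))).const_sub (c / 2)

theorem continuous_phaseDeriv (h : IsSoliton σ ω c φ W r) : Continuous (phaseDeriv σ c W) :=
  continuous_iff_continuousAt.2 fun y => (h.hasDerivAt_phaseDeriv y).continuousAt

theorem phaseDeriv_bound (h : IsSoliton σ ω c φ W r) : ∃ C, ∀ y, |phaseDeriv σ c W y| ≤ C := by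
  obtain ⟨C, -, hC⟩ := h.quad_bound (c / 2) (-(1 / (2 * σ + 2))) 0
  refine ⟨C, fun y => ?_⟩
  convert hC y using 2
  rw [phaseDeriv]; ring

theorem rW_bound (h : IsSoliton σ ω c φ W r) (t : ℝ) : ∃ C, ∀ y, |t * (r y * W y)| ≤ C := by
  obtain ⟨C, hC0, hC⟩ := h.W_bound
  obtain ⟨C', hC'0, hC'⟩ := h.r_bound
  refine ⟨|t| * (C' * C), fun y => ?_⟩
  rw [abs_mul, abs_mul]
  exact mul_le_mul_of_nonneg_left (mul_le_mul (hC' y) (hC y) (abs_nonneg _) hC'0) (abs_nonneg _)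

theorem isH1_W_mul (h : IsSoliton σ ω c φ W r) {b b' : ℝ → ℝ} (hb : IsH1 b b') :
    IsH1 (fun y => W y * b y) fun y => 2 * σ * r y * W y * b y + W y * b' y := by
  obtain ⟨C, -, hC⟩ := h.W_bound
  obtain ⟨C', hC'⟩ := h.rW_bound (2 * σ)
  exact hb.bdd_mul h.hasDerivAt_W ((continuous_const.mul h.continuous_r).mul h.continuous_W) hC
    (C' := C') fun x => by rw [mul_assoc]; exact hC' x

theorem isH1_phaseDeriv_mul (h : IsSoliton σ ω c φ W r) {b b' : ℝ → ℝ} (hb : IsH1 b b') :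
    IsH1 (fun y => phaseDeriv σ c W y * b y) fun y =>
      -(1 / (2 * σ + 2) * (2 * σ * r y * W y)) * b y + phaseDeriv σ c W y * b' y := by
  obtain ⟨C, hC⟩ := h.phaseDeriv_bound
  obtain ⟨C', hC'⟩ := h.rW_bound (-(1 / (2 * σ + 2) * (2 * σ)))
  have := h.continuous_r
  have := h.continuous_W
  exact hb.bdd_mul h.hasDerivAt_phaseDeriv (by fun_prop) hC
    (C' := C') fun x => by
      convert hC' x using 2
      ring

theorem twist_memLp (h : IsSoliton σ ω c φ W r) {a a' b b' : ℝ → ℝ} (ha : IsH1 a a')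
    (hb : IsH1 b b') : MemLp (twist σ W r a b b') 2 volume :=
  (h.memLp_sub_r_mul hb).add ((h.isH1_W_mul ha).memLp.const_mul _)

theorem isPhase_theta (h : IsSoliton σ ω c (varphi σ ω c) W r) :
    IsPhase (theta σ ω c) (phaseDeriv σ c W) := by
  refine ⟨fun x => ?_, h.continuous_phaseDeriv, h.phaseDeriv_bound⟩
  have h1 := hasDerivAt_integral_Iic h.W_integrable h.continuous_W x
  simp_rw [h.W_eq] at h1
  have h2 := ((hasDerivAt_id x).const_mul (c / 2)).sub (h1.const_mul (1 / (2 * σ + 2)))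
  rw [mul_one, ← h.W_eq] at h2
  exact h2

theorem continuous_theta (h : IsSoliton σ ω c (varphi σ ω c) W r) :
    Continuous (theta σ ω c) :=
  continuous_iff_continuousAt.2 fun x => (h.isPhase_theta.hasDerivAt x).continuousAt

theorem norm_phi (h : IsSoliton σ ω c (varphi σ ω c) W r) (x : ℝ) :
    ‖phi σ ω c x‖ = varphi σ ω c x := by
  rw [phi, phase, norm_mul, IsPolar.norm_exp_I, mul_one, Complex.norm_real,
    Real.norm_of_nonneg (h.φ_pos x).le]

theorem deriv_phi (h : IsSoliton σ ω c (varphi σ ω c) W r) (x : ℝ) :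
    deriv (phi σ ω c) x
      = ((r x : ℂ) + Complex.I * (phaseDeriv σ c W x : ℂ)) * phi σ ω c x := by
  have h1 := (h.hasDerivAt_φ x).ofReal_comp
  have h2 := ((h.isPhase_theta.hasDerivAt x).ofReal_comp.const_mul Complex.I).cexp
  have h3 : HasDerivAt (phi σ ω c) _ x := h1.mul h2
  rw [h3.deriv, phi, phase]
  push_cast
  ring

/-- The lower order terms of `H_ϕ` in polar form. -/
theorem lowerOrder_eq (h : IsSoliton σ ω c (varphi σ ω c) W r) (u ux : ℝ → ℂ)
    (a b a' b' : ℝ) (x : ℝ)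
    (hu : u x = ((a : ℂ) + Complex.I * b) * Complex.exp (Complex.I * (theta σ ω c x : ℂ)))
    (hux : ux x = (((a' - phaseDeriv σ c W x * b : ℝ) : ℂ)
      + Complex.I * ((b' + phaseDeriv σ c W x * a : ℝ) : ℂ))
        * Complex.exp (Complex.I * (theta σ ω c x : ℂ))) :
    lowerOrder σ ω c u ux x =
      (((ω * a + (W x - c) * (b' + phaseDeriv σ c W x * a)
          + 2 * σ * (W x * (phaseDeriv σ c W x * a)) : ℝ) : ℂ)
        + Complex.I * ((ω * b - (W x - c) * (a' - phaseDeriv σ c W x * b)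
          - 2 * σ * (W x * (r x * a)) : ℝ) : ℂ))
        * Complex.exp (Complex.I * (theta σ ω c x : ℂ)) := by
  have hφ := h.φ_pos x
  -- Absorbing the real power into `W` leaves an identity that is polynomial in `E`, `conj E` and
  -- `I`, following from `E * conj E = 1` and `I² = -1`.
  have hW : varphi σ ω c x ^ (2 * σ - 2) * varphi σ ω c x ^ 2 = W x := by
    rw [h.W_eq, Real.rpow_sub hφ, Real.rpow_two, div_mul_cancel₀ _ (by positivity)]
  have hW' : ((varphi σ ω c x ^ (2 * σ - 2) : ℝ) : ℂ) * (varphi σ ω c x : ℂ) ^ 2 = (W x : ℂ) := by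
    rw [← hW]; push_cast; rfl
  set E := Complex.exp (Complex.I * (theta σ ω c x : ℂ)) with hE
  have hEE : E * conj E = 1 := by
    rw [Complex.mul_conj, Complex.normSq_eq_norm_sq, hE, IsPolar.norm_exp_I]
    simp
  have hphi : phi σ ω c x = (varphi σ ω c x : ℂ) * E := rfl
  rw [lowerOrder, h.norm_phi, h.deriv_phi, hphi, hu, hux, ← h.W_eq]
  simp only [map_mul, map_add, Complex.conj_ofReal, Complex.conj_I]
  push_cast
  generalize ((varphi σ ω c x ^ (2 * σ - 2) : ℝ) : ℂ) = R at *
  generalize ((varphi σ ω c x : ℝ) : ℂ) = F at *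
  generalize conj E = E' at *
  generalize ((phaseDeriv σ c W x : ℝ) : ℂ) = τ at *
  generalize ((W x : ℝ) : ℂ) = w at *
  have hI := Complex.I_mul_I
  subst hW'
  linear_combination
    (-(Complex.I * σ * R * F ^ 2 * (r x + Complex.I * τ) * E * (a + Complex.I * b))
      - Complex.I * σ * R * F ^ 2 * (r x + Complex.I * τ) * E * (a - Complex.I * b)) * hEE
    + E * (a * c * τ - 2 * a * τ * σ * R * F ^ 2 - a * τ * R * F ^ 2 + c * b' - b' * R * F ^ 2)
      * hI

theorem polarLower_memLp (h : IsSoliton σ ω c φ W r) {a a' b b' : ℝ → ℝ} (ha : IsH1 a a')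
    (hb : IsH1 b b') :
    MemLp (fun x => ω * a x + (W x - c) * (b' x + phaseDeriv σ c W x * a x)
      + 2 * σ * (W x * (phaseDeriv σ c W x * a x))) 2 volume ∧
    MemLp (fun x => ω * b x - (W x - c) * (a' x - phaseDeriv σ c W x * b x)
      - 2 * σ * (W x * (r x * a x))) 2 volume := by
  obtain ⟨C, -, hC⟩ := h.W_bound
  have hWc : ∀ x, |W x - c| ≤ C + |c| := fun x => (abs_sub _ _).trans (by linarith [hC x])
  have hWcc : Continuous fun x => W x - c := h.continuous_W.sub continuous_const
  have hτa := (h.isH1_phaseDeriv_mul ha).memLp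
  have hτb := (h.isH1_phaseDeriv_mul hb).memLp
  have hra := (h.isH1_r_mul ha).memLp
  exact ⟨((ha.memLp.const_mul ω).add (memLp_bdd_mul hWcc hWc (hb.memLp_deriv.add hτa))).add
      ((memLp_bdd_mul h.continuous_W hC hτa).const_mul (2 * σ)),
    ((hb.memLp.const_mul ω).sub (memLp_bdd_mul hWcc hWc (ha.memLp_deriv.sub hτb))).sub
      ((memLp_bdd_mul h.continuous_W hC hra).const_mul (2 * σ))⟩

theorem lowerOrder_ae_eq (h : IsSoliton σ ω c (varphi σ ω c) W r) {u : H1} {a a' b b' : ℝ → ℝ}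
    (hu : IsPolar (theta σ ω c) (phaseDeriv σ c W) u a a' b b') :
    lowerOrder σ ω c (fn u) (der u) =ᵐ[volume] fun x =>
      (((ω * a x + (W x - c) * (b' x + phaseDeriv σ c W x * a x)
          + 2 * σ * (W x * (phaseDeriv σ c W x * a x)) : ℝ) : ℂ)
        + Complex.I * ((ω * b x - (W x - c) * (a' x - phaseDeriv σ c W x * b x)
          - 2 * σ * (W x * (r x * a x)) : ℝ) : ℂ))
        * Complex.exp (Complex.I * (theta σ ω c x : ℂ)) := by
  filter_upwards [hu.fn_eq, hu.der_eq] with x h1 h2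
  exact h.lowerOrder_eq _ _ _ _ _ _ x h1 h2

theorem lowerOrder_memLp (h : IsSoliton σ ω c (varphi σ ω c) W r) (u : H1) :
    MemLp (lowerOrder σ ω c (fn u) (der u)) 2 volume := by
  obtain ⟨a, a', b, b', hu⟩ := h.isPhase_theta.exists_isPolar u
  obtain ⟨h1, h2⟩ := h.polarLower_memLp hu.re hu.im
  exact (memLp_mul_exp_I (memLp_ofReal_add_I h1 h2) h.continuous_theta).ae_eq
    (h.lowerOrder_ae_eq hu).symm

theorem re_mul_conj_polar (a b p q t : ℝ) :
    (((a : ℂ) + Complex.I * b) * Complex.exp (Complex.I * (t : ℂ))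
      * conj (((p : ℂ) + Complex.I * q) * Complex.exp (Complex.I * (t : ℂ)))).re
      = a * p + b * q := by
  have hcs := Real.sin_sq_add_cos_sq t
  rw [exp_I_mul_ofReal]
  generalize Real.cos t = C at *
  generalize Real.sin t = S at *
  simp
  linear_combination (a * p + b * q) * hcs

theorem integrable_pairing (h : IsSoliton σ ω c (varphi σ ω c) W r) (u v : H1) :
    Integrable fun x => der u x * conj (der v x)
      + lowerOrder σ ω c (fn u) (der u) x * conj (fn v x) :=
  (integrable_mul_conj (Lp.memLp (der u)) (Lp.memLp (der v))).add
    (integrable_mul_conj (h.lowerOrder_memLp u) (Lp.memLp (fn v)))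

/-- The quadratic form of `H_ϕ` in polar form: `L̃₁₁` plus a square. -/
theorem pairingH_eq (h : IsSoliton σ ω c (varphi σ ω c) W r) {u v : H1}
    {a a' b b' p p' q q' : ℝ → ℝ}
    (hu : IsPolar (theta σ ω c) (phaseDeriv σ c W) u a a' b b')
    (hv : IsPolar (theta σ ω c) (phaseDeriv σ c W) v p p' q q') :
    pairingH σ ω c u v = energy (potV σ ω c W) a a' p p'
      + ∫ x, twist σ W r a b b' x * twist σ W r p q q' x := by
  obtain ⟨C, hC⟩ := h.isShortRange_V
  have hσ := h.σ_pos
  have h5 := Complex.reCLM.integral_comp_comm (h.integrable_pairing u v)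
  simp only [Complex.reCLM_apply] at h5
  have d1 := h.isH1_phaseDeriv_mul hu.re
  have d2 := h.isH1_phaseDeriv_mul hu.im
  have d3 := (h.isH1_W_mul hu.re).const_mul (σ / (σ + 1))
  have d4 := h.isH1_r_mul hu.im
  have i1 := hC.integrable_energy hu.re hv.re
  have i2 := integrable_mul_of_memLp (h.twist_memLp hu.re hu.im) (h.twist_memLp hv.re hv.im)
  have j1 := d1.integrable_mul_deriv hv.im
  have j2 := d2.integrable_mul_deriv hv.re
  have j3 := d3.integrable_mul_deriv hv.im
  have j4 := d4.integrable_mul_deriv hv.im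
  -- The two integrands differ by the total derivatives of `τ a q`, `τ b p`, `σ/(σ+1) W a q` and `r
  -- b q`, where `τ = θ'`. Each zero is replaced below by the vanishing integral of one of them.
  have key : energy (potV σ ω c W) a a' p p'
      + (∫ x, twist σ W r a b b' x * twist σ W r p q q' x) + 0 - 0 - 0 + 0
      = energy (potV σ ω c W) a a' p p'
      + ∫ x, twist σ W r a b b' x * twist σ W r p q q' x := by ring
  rw [pairingH, ← h5, ← key]
  nth_rewrite 1 [← d1.by_parts hv.im]
  nth_rewrite 1 [← d2.by_parts hv.re]
  nth_rewrite 1 [← d3.by_parts hv.im]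
  rw [← d4.by_parts hv.im, energy, ← integral_add i1 i2,
    ← integral_add (by exact i1.add i2) j1, ← integral_sub (by exact (i1.add i2).add j1) j2,
    ← integral_sub (by exact ((i1.add i2).add j1).sub j2) j3,
    ← integral_add (by exact (((i1.add i2).add j1).sub j2).sub j3) j4]
  refine integral_congr_ae ?_
  filter_upwards [h.lowerOrder_ae_eq hu, hu.der_eq, hv.fn_eq, hv.der_eq] with x e1 e2 e3 e4
  rw [e1, e2, e3, e4, Complex.add_re, re_mul_conj_polar, re_mul_conj_polar]
  simp only [twist, potV, potU, phaseDeriv]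
  field_simp
  ring

/-- `u` is in the kernel of `H_ϕ` as an operator from `H¹` to `H⁻¹` exactly if it belongs to `H²`
and `H_ϕ u = 0` almost everywhere. -/
theorem weakKernel_iff_strong (h : IsSoliton σ ω c (varphi σ ω c) W r) (u : H1) :
    (∀ v : H1, pairingH σ ω c u v = 0) ↔ IsStrongKernel σ ω c u := by
  constructor
  · intro hw
    have hL := h.lowerOrder_memLp u
    set L := lowerOrder σ ω c (fn u) (der u) with hLdef
    have hwd : HasWeakDeriv (der u : ℝ → ℂ) (hL.toLp L) := by
      intro ψ hψ hs
      have hψ1 := IsH1.of_test hψ hs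
      -- Pairing with `ψ` and with `i ψ` recovers the real and the imaginary part of the complex
      -- integral.
      obtain ⟨v₁, hv₁, hv₁'⟩ := exists_H1_of_isH1 hψ1 IsH1.zero
      obtain ⟨v₂, hv₂, hv₂'⟩ := exists_H1_of_isH1 IsH1.zero hψ1
      have k1 := integrable_smul_L2C (hψ.continuous_deriv (by simp)) hs.deriv (der u)
      have k2 := integrable_smul_L2C hψ.continuous hs (hL.toLp L)
      rw [eq_neg_iff_add_eq_zero, ← integral_add k1 k2]
      have e1 : ∫ x, der u x * conj (der v₁ x) + L x * conj (fn v₁ x)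
          = ∫ x, deriv ψ x • der u x + ψ x • hL.toLp L x := by
        refine integral_congr_ae ?_
        filter_upwards [hv₁, hv₁', hL.coeFn_toLp] with x h1 h2 h3
        rw [h1, h2, h3]
        simp
        ring
      have e2 : ∫ x, der u x * conj (der v₂ x) + L x * conj (fn v₂ x)
          = -Complex.I * ∫ x, deriv ψ x • der u x + ψ x • hL.toLp L x := by
        rw [← integral_const_mul]
        refine integral_congr_ae ?_
        filter_upwards [hv₂, hv₂', hL.coeFn_toLp] with x h1 h2 h3
        rw [h1, h2, h3]
        simp
        ring
      have f1 := hw v₁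
      have f2 := hw v₂
      rw [pairingH, ← hLdef, e1] at f1
      rw [pairingH, ← hLdef, e2] at f2
      refine Complex.ext f1 ?_
      simpa using f2
    refine ⟨⟨WithLp.toLp 2 (der u, hL.toLp L), hwd⟩, rfl, ?_⟩
    filter_upwards [hL.coeFn_toLp] with x hx
    change -(hL.toLp L x) + L x = 0
    rw [hx, neg_add_cancel]
  · rintro ⟨w, hw, hae⟩ v
    have h1 := integral_H1_by_parts w v
    rw [hw] at h1
    rw [pairingH, ← h1]
    congr 1
    refine integral_congr_ae ?_
    filter_upwards [hae] with x hx
    rw [neg_add_eq_zero] at hx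
    rw [hx]

/-- Orthogonality to the range of `∂ - r` means `k' = -r k`, so `φ k` is constant. Being a product
of two `H¹` functions it tends to zero, so it vanishes. -/
theorem eq_zero_of_weak_adjoint (h : IsSoliton σ ω c φ W r) {k : ℝ → ℝ} (hk : MemLp k 2 volume)
    (hw : ∀ q q' : ℝ → ℝ, IsH1 q q' → ∫ x, k x * (q' x - r x * q x) = 0) :
    k =ᵐ[volume] 0 := by
  obtain ⟨C, -, hC⟩ := h.r_bound
  have hrk : MemLp (fun x => -(r x * k x)) 2 volume := (memLp_bdd_mul h.continuous_r hC hk).neg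
  have hwd : HasWeakDeriv k fun x => -(r x * k x) := by
    intro ψ hψ hs
    have hψ1 := IsH1.of_test hψ hs
    have h1 := hw _ _ hψ1
    have i1 := integrable_mul_of_memLp hk hψ1.memLp_deriv
    have i2 := integrable_mul_of_memLp (memLp_bdd_mul h.continuous_r hC hk) hψ1.memLp
    have h2 : ∫ x, k x * (deriv ψ x - r x * ψ x)
        = (∫ x, k x * deriv ψ x) - ∫ x, r x * k x * ψ x := by
      rw [← integral_sub i1 i2]
      congr 1; funext x; ring
    rw [h2, sub_eq_zero] at h1
    simp only [smul_eq_mul, mul_neg, integral_neg, neg_neg]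
    simp_rw [mul_comm (deriv ψ _), mul_comm (ψ _)]
    exact h1
  obtain ⟨K, hK, hKH⟩ := hwd.exists_isH1 hk hrk
  have hKH' : IsH1 K fun x => -(r x * K x) :=
    hKH.congr_deriv (by filter_upwards [hK] with x hx; rw [hx])
  have hF : IsPrim (fun x => φ x * K x) fun _ => 0 :=
    (h.isH1_φ.prim.mul hKH'.prim).congr_deriv (Eventually.of_forall fun x => by simp only; ring)
  have h0 : ∀ x, φ x * K x = 0 := fun x =>
    tendsto_nhds_unique (tendsto_const_nhds.congr fun y => hF.const_of_zero x y)
      (h.isH1_φ.mul_tendsto_atTop hKH')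
  filter_upwards [hK] with x hx
  rw [hx]
  exact (mul_eq_zero.1 (h0 x)).resolve_left (h.φ_pos x).ne'

theorem hasDerivAt_kernelFactor (h : IsSoliton σ ω c φ W r) (k₂ x : ℝ) :
    HasDerivAt (fun y => k₂ - 1 / (2 * σ + 2) * W y)
      (-(1 / (2 * σ + 2) * (2 * σ * r x * W x))) x :=
  ((h.hasDerivAt_W x).const_mul (1 / (2 * σ + 2))).const_sub k₂

theorem isH1_kernelFactor_mul (h : IsSoliton σ ω c φ W r) (k₂ : ℝ) :
    IsH1 (fun y => (k₂ - 1 / (2 * σ + 2) * W y) * φ y) fun y =>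
      -(1 / (2 * σ + 2) * (2 * σ * r y * W y)) * φ y
        + (k₂ - 1 / (2 * σ + 2) * W y) * (r y * φ y) := by
  obtain ⟨C, -, hC⟩ := h.quad_bound k₂ (-(1 / (2 * σ + 2))) 0
  obtain ⟨C', hC'⟩ := h.rW_bound (-(1 / (2 * σ + 2) * (2 * σ)))
  have := h.continuous_r
  have := h.continuous_W
  exact h.isH1_φ.bdd_mul (h.hasDerivAt_kernelFactor k₂) (by fun_prop) (C := C) (C' := C')
    (fun x => by convert hC x using 2; ring) (fun x => by convert hC' x using 2; ring)

/-- The kernel of `H_ϕ` in polar form. -/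
theorem weakKernel_iff (h : IsSoliton σ ω c (varphi σ ω c) W r) (k₂ : ℝ) {χ₁ χ₂ : H1}
    (h₁ : IsPolar (theta σ ω c) (phaseDeriv σ c W) χ₁ (fun y => r y * varphi σ ω c y)
      (fun y => potU σ ω c W y * varphi σ ω c y)
      (fun y => (k₂ - 1 / (2 * σ + 2) * W y) * varphi σ ω c y)
      (fun y => -(1 / (2 * σ + 2) * (2 * σ * r y * W y)) * varphi σ ω c y
        + (k₂ - 1 / (2 * σ + 2) * W y) * (r y * varphi σ ω c y)))
    (h₂ : IsPolar (theta σ ω c) (phaseDeriv σ c W) χ₂ (fun _ => 0) (fun _ => 0)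
      (varphi σ ω c) (fun y => r y * varphi σ ω c y)) (u : H1) :
    u ∈ Submodule.span ℝ {χ₁, χ₂} ↔ ∀ v : H1, pairingH σ ω c u v = 0 := by
  have hσ := h.σ_pos
  rw [Submodule.mem_span_pair]
  constructor
  · rintro ⟨s, t, rfl⟩ v
    obtain ⟨p, p', q, q', hv⟩ := h.isPhase_theta.exists_isPolar v
    rw [h.pairingH_eq ((h₁.smul s).add (h₂.smul t)) hv]
    have e1 : energy (potV σ ω c W) (fun y => s * (r y * varphi σ ω c y) + t * 0)
        (fun y => s * (potU σ ω c W y * varphi σ ω c y) + t * 0) p p' = 0 := by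
      simp only [mul_zero, add_zero]
      rw [IsShortRange.energy_const_mul_left, h.energy_rφ hv.re, mul_zero]
    rw [e1, zero_add]
    refine integral_eq_zero_of_ae (Eventually.of_forall fun x => mul_eq_zero_of_left ?_ _)
    simp only [twist]
    field_simp
    ring
  · intro hw
    obtain ⟨a, a', b, b', hu⟩ := h.isPhase_theta.exists_isPolar u
    have hw' : ∀ p p' q q' : ℝ → ℝ, IsH1 p p' → IsH1 q q' → energy (potV σ ω c W) a a' p p'
        + ∫ x, twist σ W r a b b' x * twist σ W r p q q' x = 0 := by
      intro p p' q q' hp hq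
      obtain ⟨v, hv⟩ := h.isPhase_theta.exists_of_isH1 hp hq
      rw [← h.pairingH_eq hu hv, hw]
    -- Test functions with zero real part kill the twist; what remains is the weak kernel equation
    -- of `L̃₁₁` for `a`.
    have hk := h.eq_zero_of_weak_adjoint (h.twist_memLp hu.re hu.im) fun q q' hq => by
      have := hw' _ _ q q' IsH1.zero hq
      simpa [energy, twist] using this
    obtain ⟨k, hak⟩ := h.eq_smul_of_energy_eq_zero hu.re fun p p' hp => by
      have h1 := hw' p p' _ _ hp IsH1.zero
      rw [integral_eq_zero_of_ae (by filter_upwards [hk] with x hx; simp [hx]), add_zero] at h1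
      exact h1
    -- Subtracting `k` times the imaginary part of `χ₁` leaves a solution of `b' = r b`.
    have hd := hu.im.sub ((h.isH1_kernelFactor_mul k₂).const_mul k)
    obtain ⟨t, ht⟩ := h.eq_smul_φ hd.prim (by
      filter_upwards [hk] with x hx
      simp only [twist, hak, Pi.zero_apply] at hx ⊢
      have h1 : b' x = r x * b x - σ / (σ + 1) * (W x * (k * (r x * varphi σ ω c x))) := by
        linarith
      rw [h1]
      field_simp
      ring)
    refine ⟨k, t, ((h₁.smul k).add (h₂.smul t)).ext hu (fun x => ?_) (fun x => ?_)⟩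
    · rw [hak]; ring
    · rw [← ht x]; ring

end IsSoliton

end Linearization

end GDNLS

namespace GDNLS

/-! ### The explicit spanning functions and coercivity on the positive space. -/

section Decomposition

open Filter Topology

namespace IsSoliton

variable {σ ω c : ℝ} {φ W r : ℝ → ℝ} {m : ℝ} {e e₁ : ℝ → ℝ}

theorem potV_eq (h : IsSoliton σ ω c (varphi σ ω c) W r) : potV σ ω c W = potential σ ω c := by
  funext y
  have h1 : varphi σ ω c y ^ (4 * σ) = W y ^ 2 := by
    rw [h.W_eq, ← Real.rpow_natCast, ← Real.rpow_mul (h.φ_pos y).le]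
    congr 1
    push_cast
    ring
  rw [potV, potential, h1, h.W_eq]

theorem isEigenfunction_groundState (h : IsSoliton σ ω c (varphi σ ω c) W r)
    (he : IsGroundState (potV σ ω c W) m e e₁) : IsEigenfunction σ ω c m e := by
  refine ⟨fun h0 => ?_, e₁, _, he.isH1.memLp, he.isH1.memLp_deriv, he.isH1_deriv.memLp_deriv,
    he.isH1.prim.hasWeakDeriv, he.isH1_deriv.prim.hasWeakDeriv, Eventually.of_forall fun y => ?_⟩
  · have h1 := he.integral_sq
    rw [integral_eq_zero_of_ae (by filter_upwards [h0] with x hx; simp [hx])] at h1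
    exact zero_ne_one h1
  · rw [h.potV_eq]; ring

/-- Continuous representatives and an integration by parts turn the almost everywhere equation into
the variational identity required by `eigenfunction_unique`. -/
theorem eigenfunction_ae_eq (h : IsSoliton σ ω c (varphi σ ω c) W r)
    (he : IsGroundState (potV σ ω c W) m e e₁) {μ : ℝ} (hμ : μ < 0) {f : ℝ → ℝ}
    (hf : IsEigenfunction σ ω c μ f) : μ = m ∧ ∃ t : ℝ, f =ᵐ[volume] fun y => t * e y := by
  obtain ⟨hne, f₁, f₂, hf0, hf1, hf2, hw, hw', hE⟩ := hf
  obtain ⟨C, hC⟩ := h.isShortRange_V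
  obtain ⟨F, hF, hFH⟩ := hw.exists_isH1 hf0 hf1
  obtain ⟨G, hG, hGH⟩ := hw'.exists_isH1 hf1 hf2
  have hFG := hFH.congr_deriv hG
  have hpos : 0 < ∫ y, F y ^ 2 := by
    refine lt_of_le_of_ne (integral_nonneg fun _ => sq_nonneg _) fun h0 => hne ?_
    exact hF.trans (ae_eq_zero_of_integral_sq hFH.memLp h0.symm)
  obtain ⟨h1, t, ht⟩ := h.eigenfunction_unique he hμ hFG hpos fun g g' hg => by
    have i1 := hC.integrable_energy hFG hg
    have i2 := hGH.integrable_mul_deriv hg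
    rw [← sub_zero (energy _ _ _ _ _), ← hGH.by_parts hg, energy, ← integral_sub i1 i2,
      ← integral_const_mul]
    refine integral_congr_ae ?_
    filter_upwards [hE, hF] with y h2 h3
    rw [← h.potV_eq, h3] at h2
    linear_combination g y * h2
  refine ⟨h1, t, ?_⟩
  filter_upwards [hF] with y hy
  rw [hy, ht]

theorem groundState_integral_rφ (h : IsSoliton σ ω c φ W r)
    (he : IsGroundState (potV σ ω c W) m e e₁) : ∫ y, e y * (r y * φ y) = 0 := by
  have h1 := he.energy_eq _ _ h.isH1_rφ
  rw [energy_comm, h.energy_rφ he.isH1] at h1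
  exact (mul_eq_zero.1 h1.symm).resolve_left he.neg.ne

/-- The derivative formula is exactly the equation that makes the twist of `(e, χ₁₂)` vanish. -/
theorem isH1_chi12 (h : IsSoliton σ ω c (varphi σ ω c) W r)
    (he : IsGroundState (potV σ ω c W) m e e₁) (k : ℝ) :
    IsH1 (chi12 σ ω c e k) fun y => r y * chi12 σ ω c e k y - σ / (σ + 1) * (W y * e y) := by
  have hint := h.integrable_rpow_mul_groundState he
  have hcont : Continuous fun y => varphi σ ω c y ^ (2 * σ - 1) * e y :=
    (h.continuous_φ.rpow_const fun y => Or.inl (h.φ_pos y).ne').mul he.isH1.continuous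
  have hJ := hasDerivAt_integral_Iic hint hcont
  have hd : ∀ y, HasDerivAt (chi12 σ ω c e k)
      (r y * chi12 σ ω c e k y - σ / (σ + 1) * (W y * e y)) y := fun y => by
    have h1 := (h.hasDerivAt_φ y).fun_mul (((hJ y).const_mul (-(σ / (σ + 1)))).add_const k)
    refine h1.congr_deriv ?_
    rw [chi12, h.W_eq, Real.rpow_sub_one (h.φ_pos y).ne']
    have := (h.φ_pos y).ne'
    field_simp
    ring
  have hc : Continuous (chi12 σ ω c e k) :=
    continuous_iff_continuousAt.2 fun y => (hd y).continuousAt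
  have hJc : Continuous fun y => -(σ / (σ + 1)) *
      (∫ s in Iic y, varphi σ ω c s ^ (2 * σ - 1) * e s) + k :=
    (continuous_const.mul (continuous_iff_continuousAt.2 fun y => (hJ y).continuousAt)).add
      continuous_const
  have hm : MemLp (chi12 σ ω c e k) 2 volume := by
    have h1 := memLp_bdd_mul (C := |-(σ / (σ + 1))|
      * (∫ t, |varphi σ ω c t ^ (2 * σ - 1) * e t|) + |k|) hJc (fun y => by
        refine (abs_add_le _ _).trans ?_
        rw [abs_mul]
        gcongr
        exact abs_integral_Iic_le hint y) h.φ_memLp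
    refine h1.ae_eq (Eventually.of_forall fun y => ?_)
    simp only [chi12]
    ring
  obtain ⟨C, -, hC⟩ := h.r_bound
  refine ⟨IsPrim.of_hasDerivAt hd ?_, hm, (memLp_bdd_mul h.continuous_r hC hm).sub
    ((h.isH1_W_mul he.isH1).memLp.const_mul _)⟩
  have := h.continuous_r
  have := h.continuous_W
  have := he.isH1.continuous
  fun_prop

/-- Changing `k` adds a multiple of `φ` to `χ₁₂`, so the condition is affine in `k` with slope `∫ φ²
> 0`. -/
theorem exists_k12 (h : IsSoliton σ ω c (varphi σ ω c) W r)
    (he : IsGroundState (potV σ ω c W) m e e₁) :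
    ∃ k : ℝ, ∫ y, chi12 σ ω c e k y * varphi σ ω c y = 0 := by
  have h0 := (h.isH1_chi12 he 0).integrable_mul h.isH1_φ
  have hpos := h.φ_integral_sq_pos
  refine ⟨-(∫ y, chi12 σ ω c e 0 y * varphi σ ω c y) / ∫ y, varphi σ ω c y ^ 2, ?_⟩
  set k := -(∫ y, chi12 σ ω c e 0 y * varphi σ ω c y) / ∫ y, varphi σ ω c y ^ 2 with hk
  calc _ = ∫ y, chi12 σ ω c e 0 y * varphi σ ω c y + k * varphi σ ω c y ^ 2 := by
        congr 1; funext y; simp only [chi12]; ring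
    _ = 0 := by
        rw [integral_add h0 (h.φ_sq_integrable.const_mul _), integral_const_mul, hk,
          div_mul_cancel₀ _ hpos.ne']
        ring

theorem exists_k2 (h : IsSoliton σ ω c (varphi σ ω c) W r) :
    ∃ k : ℝ, ∫ y, (k - 1 / (2 * σ + 2) * W y) * varphi σ ω c y * varphi σ ω c y = 0 := by
  have h0 := (h.isH1_W_mul h.isH1_φ).integrable_mul h.isH1_φ
  have hpos := h.φ_integral_sq_pos
  refine ⟨1 / (2 * σ + 2) * (∫ y, W y * varphi σ ω c y * varphi σ ω c y)
    / ∫ y, varphi σ ω c y ^ 2, ?_⟩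
  set k := 1 / (2 * σ + 2) * (∫ y, W y * varphi σ ω c y * varphi σ ω c y)
    / ∫ y, varphi σ ω c y ^ 2 with hk
  calc _ = ∫ y, k * varphi σ ω c y ^ 2
        - 1 / (2 * σ + 2) * (W y * varphi σ ω c y * varphi σ ω c y) := by
        congr 1; funext y; ring
    _ = 0 := by
        rw [integral_sub (h.φ_sq_integrable.const_mul _) (h0.const_mul _), integral_const_mul,
          integral_const_mul, hk, div_mul_cancel₀ _ hpos.ne', sub_self]

/-- Coercivity of the form of `H_ϕ` under the three orthogonality conditions. -/
theorem exists_coercive_pairing (h : IsSoliton σ ω c (varphi σ ω c) W r)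
    (he : IsGroundState (potV σ ω c W) m e e₁) :
    ∃ δ : ℝ, 0 < δ ∧ ∀ (u : H1) (a a' b b' : ℝ → ℝ),
      IsPolar (theta σ ω c) (phaseDeriv σ c W) u a a' b b' →
      ∫ y, a y * e y = 0 → ∫ y, a y * (r y * varphi σ ω c y) = 0 →
      ∫ y, b y * varphi σ ω c y = 0 → δ * ‖u‖ ^ 2 ≤ pairingH σ ω c u u := by
  obtain ⟨δ₁, hδ₁, H₁⟩ := h.exists_coercive_V he
  obtain ⟨δ₂, hδ₂, H₂⟩ := h.exists_coercive_U
  obtain ⟨T, hT⟩ := h.phaseDeriv_bound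
  obtain ⟨D, -, hD⟩ := h.W_bound
  set K := (σ / (σ + 1)) ^ 2 * D ^ 2 with hK
  have hK0 : 0 ≤ K := by positivity
  set t := δ₁ / (2 * K + δ₁) with ht
  have hden : 0 < 2 * K + δ₁ := by positivity
  have ht0 : 0 < t := div_pos hδ₁ hden
  have ht1 : t ≤ 1 := (div_le_one hden).2 (by linarith)
  have htK : t * K ≤ δ₁ / 2 := by
    rw [ht, div_mul_eq_mul_div, div_le_iff₀ hden]
    nlinarith
  set ε := min (δ₁ / 2) (t * δ₂ / 2) with hε
  have hε0 : 0 < ε := lt_min (by positivity) (by positivity)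
  have hM : 0 < 2 + 2 * T ^ 2 := by positivity
  refine ⟨ε / (2 + 2 * T ^ 2), by positivity, fun u a a' b b' hu h1 h2 h3 => ?_⟩
  have hn := hu.norm_sq_le h.continuous_phaseDeriv hT
  have hA := H₁ a a' hu.re h1 h2
  have hB := H₂ b b' hu.im h3
  have hWa := (h.isH1_W_mul hu.re).memLp
  have hg := h.memLp_sub_r_mul hu.im
  have htw := h.twist_memLp hu.re hu.im
  have a1 : 0 ≤ ∫ x, a x ^ 2 := integral_nonneg fun _ => sq_nonneg _
  have a2 : 0 ≤ ∫ x, a' x ^ 2 := integral_nonneg fun _ => sq_nonneg _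
  have b1 : 0 ≤ ∫ x, b x ^ 2 := integral_nonneg fun _ => sq_nonneg _
  have b2 : 0 ≤ ∫ x, b' x ^ 2 := integral_nonneg fun _ => sq_nonneg _
  have hsq : t * ((∫ y, (b' y - r y * b y) ^ 2) / 2 - K * ∫ y, a y ^ 2)
      ≤ ∫ y, twist σ W r a b b' y * twist σ W r a b b' y := by
    have j1 := (integrable_sq_of_memLp hg).const_mul (1 / 2)
    have j2 := (integrable_sq_of_memLp hu.re.memLp).const_mul K
    have e1 : t * ((∫ y, (b' y - r y * b y) ^ 2) / 2 - K * ∫ y, a y ^ 2)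
        = ∫ y, t * (1 / 2 * (b' y - r y * b y) ^ 2 - K * a y ^ 2) := by
      rw [integral_const_mul, integral_sub j1 j2, integral_const_mul, integral_const_mul]
      ring
    rw [e1]
    refine integral_mono ((j1.sub j2).const_mul t) (integrable_mul_of_memLp htw htw) fun y => ?_
    have hW2 : (σ / (σ + 1) * (W y * a y)) ^ 2 ≤ K * a y ^ 2 := by
      have h4 : W y ^ 2 ≤ D ^ 2 := sq_le_sq' (by linarith [(abs_le.1 (hD y)).1])
        (le_of_abs_le (hD y))
      have h5 : (σ / (σ + 1) * (W y * a y)) ^ 2 = (σ / (σ + 1)) ^ 2 * W y ^ 2 * a y ^ 2 := by ring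
      rw [h5, hK]
      gcongr
    simp only [twist]
    set g := b' y - r y * b y
    set w := σ / (σ + 1) * (W y * a y)
    have h6 : 1 / 2 * g ^ 2 - K * a y ^ 2 ≤ (g + w) * (g + w) := by
      nlinarith [sq_nonneg (g + 2 * w)]
    calc t * (1 / 2 * g ^ 2 - K * a y ^ 2) ≤ t * ((g + w) * (g + w)) :=
          mul_le_mul_of_nonneg_left h6 ht0.le
      _ ≤ 1 * ((g + w) * (g + w)) := mul_le_mul_of_nonneg_right ht1 (mul_self_nonneg _)
      _ = _ := one_mul _
  rw [h.pairingH_eq hu hu]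
  have hfin : ε * (((∫ x, a x ^ 2) + ∫ x, a' x ^ 2) + ((∫ x, b x ^ 2) + ∫ x, b' x ^ 2))
      ≤ energy (potV σ ω c W) a a' a a'
        + ∫ y, twist σ W r a b b' y * twist σ W r a b b' y := by
    have e1 : ε ≤ δ₁ / 2 := min_le_left _ _
    have e2 : ε ≤ t * δ₂ / 2 := min_le_right _ _
    have e3 := mul_le_mul_of_nonneg_right e1 (add_nonneg a1 a2)
    have e4 := mul_le_mul_of_nonneg_right e2 (add_nonneg b1 b2)
    have e5 := mul_le_mul_of_nonneg_right htK a1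
    have e6 := mul_le_mul_of_nonneg_left hB ht0.le
    have e7 : 0 ≤ δ₁ / 2 * ∫ x, a' x ^ 2 := by positivity
    nlinarith
  calc ε / (2 + 2 * T ^ 2) * ‖u‖ ^ 2
      ≤ ε / (2 + 2 * T ^ 2) * ((2 + 2 * T ^ 2) * (((∫ x, a x ^ 2) + ∫ x, a' x ^ 2)
        + ((∫ x, b x ^ 2) + ∫ x, b' x ^ 2))) :=
        mul_le_mul_of_nonneg_left hn (by positivity)
    _ = ε * (((∫ x, a x ^ 2) + ∫ x, a' x ^ 2) + ((∫ x, b x ^ 2) + ∫ x, b' x ^ 2)) := by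
        field_simp
    _ ≤ _ := hfin

end IsSoliton

end Decomposition

end GDNLS

/-! ### Assembly of the decomposition. -/

theorem mainTheorem2 (σ ω c : ℝ) (hσ : 0 < σ) (hω : c ^ 2 / 4 < ω) :
    ∃ (lam : ℝ) (χ₁₁ : ℝ → ℝ) (k₁₂ k₂ : ℝ) (χm χ₁ χ₂ : GDNLS.H1)
      (N Z P : Submodule ℝ GDNLS.H1),
      -- the negative eigenvalue of `L̃₁₁`, unique and simple, with normalized eigenfunction `χ₁₁`
      0 < lam ∧
      GDNLS.IsEigenfunction σ ω c (-lam ^ 2) χ₁₁ ∧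
      (∫ y, χ₁₁ y ^ 2 = 1) ∧
      (∀ (μ : ℝ) (f : ℝ → ℝ), μ < 0 → GDNLS.IsEigenfunction σ ω c μ f →
        μ = -lam ^ 2 ∧ ∃ a : ℝ, f =ᵐ[volume] fun y => a * χ₁₁ y) ∧
      -- the constants `k₁₂` and `k₂`
      Integrable (fun s => GDNLS.varphi σ ω c s ^ (2 * σ - 1) * χ₁₁ s) volume ∧
      (∫ y, GDNLS.chi12 σ ω c χ₁₁ k₁₂ y * GDNLS.varphi σ ω c y = 0) ∧
      (∫ y, GDNLS.kernelFactor σ ω c k₂ y * GDNLS.varphi σ ω c y * GDNLS.varphi σ ω c y = 0) ∧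
      -- the explicit functions `χ₋`, `χ₁`, `χ₂` as elements of `H¹`
      (GDNLS.fn χm =ᵐ[volume] GDNLS.chiMinus σ ω c χ₁₁ k₁₂) ∧
      (GDNLS.fn χ₁ =ᵐ[volume] GDNLS.chi1 σ ω c k₂) ∧
      (GDNLS.fn χ₂ =ᵐ[volume] GDNLS.chi2 σ ω c) ∧
      -- the direct sum decomposition
      DirectSum.IsInternal ![N, Z, P] ∧
      -- the negative space
      N = Submodule.span ℝ {χm} ∧
      Module.finrank ℝ N = 1 ∧
      (∀ u ∈ N, u ≠ 0 → GDNLS.pairingH σ ω c u u < 0) ∧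
      -- the kernel, both of `H_ϕ : H¹ → H⁻¹` and of `H_ϕ` on `H²`
      Z = Submodule.span ℝ {χ₁, χ₂} ∧
      Module.finrank ℝ Z = 2 ∧
      (∀ u : GDNLS.H1, u ∈ Z ↔ ∀ v : GDNLS.H1, GDNLS.pairingH σ ω c u v = 0) ∧
      (∀ u : GDNLS.H1, u ∈ Z ↔ GDNLS.IsStrongKernel σ ω c u) ∧
      -- the positive space
      (∃ δ : ℝ, 0 < δ ∧ ∀ p ∈ P, δ * ‖p‖ ^ 2 ≤ GDNLS.pairingH σ ω c p p) := by
  open GDNLS in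
  have h := isSoliton_varphi hσ hω
  set W : ℝ → ℝ := fun y => varphi σ ω c y ^ (2 * σ) with hW
  set r := logDerivProfile σ ω c
  obtain ⟨m, e, e₁, he⟩ := h.exists_groundState
  obtain ⟨k₁₂, hk₁₂⟩ := h.exists_k12 he
  obtain ⟨k₂, hk₂⟩ := h.exists_k2
  have hθ := h.isPhase_theta
  obtain ⟨χm, hχm⟩ := hθ.exists_of_isH1 he.isH1 (h.isH1_chi12 he k₁₂)
  obtain ⟨χ₁, hχ₁⟩ := hθ.exists_of_isH1 h.isH1_rφ (h.isH1_kernelFactor_mul k₂)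
  obtain ⟨χ₂, hχ₂⟩ := hθ.exists_of_isH1 IsH1.zero h.isH1_φ
  have hL0 : MemLp (fun _ : ℝ => (0 : ℝ)) 2 volume := MemLp.zero'
  -- The dual functionals `⟨a, e⟩`, `⟨a, φ'⟩` and `⟨b, φ⟩`; `P` is their common kernel.
  obtain ⟨l₁, hl₁⟩ := IsPolar.exists_functional (τ := phaseDeriv σ c W) h.continuous_theta
    he.isH1.memLp hL0
  obtain ⟨l₂, hl₂⟩ := IsPolar.exists_functional (τ := phaseDeriv σ c W) h.continuous_theta
    h.isH1_rφ.memLp hL0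
  obtain ⟨l₃, hl₃⟩ := IsPolar.exists_functional (τ := phaseDeriv σ c W) h.continuous_theta
    hL0 h.φ_memLp
  simp only [mul_zero, integral_zero, add_zero, zero_add] at hl₁ hl₂ hl₃
  -- Eigenfunctions for the distinct eigenvalues `m` and `0` are orthogonal, which decouples `χ₋`
  -- from `χ₁`.
  have hrφe := h.groundState_integral_rφ he
  have h11 : l₁ χm = 1 := by
    rw [hl₁ _ _ _ _ _ hχm, ← he.integral_sq]; simp_rw [pow_two]
  have h12 : l₁ χ₁ = 0 := by
    rw [hl₁ _ _ _ _ _ hχ₁, ← hrφe]; simp_rw [mul_comm (e _)]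
  have h13 : l₁ χ₂ = 0 := by rw [hl₁ _ _ _ _ _ hχ₂]; simp
  have h21 : l₂ χm = 0 := by rw [hl₂ _ _ _ _ _ hχm, hrφe]
  have h22 : l₂ χ₁ ≠ 0 := by
    rw [hl₂ _ _ _ _ _ hχ₁]; simp_rw [← pow_two]; exact h.rφ_integral_sq_pos.ne'
  have h23 : l₂ χ₂ = 0 := by rw [hl₂ _ _ _ _ _ hχ₂]; simp
  have h31 : l₃ χm = 0 := by rw [hl₃ _ _ _ _ _ hχm, hk₁₂]
  have h32 : l₃ χ₁ = 0 := by rw [hl₃ _ _ _ _ _ hχ₁, hk₂]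
  have h33 : l₃ χ₂ ≠ 0 := by
    rw [hl₃ _ _ _ _ _ hχ₂]; simp_rw [← pow_two]; exact h.φ_integral_sq_pos.ne'
  have hm : -√(-m) ^ 2 = m := by
    rw [Real.sq_sqrt (by linarith [he.neg]), neg_neg]
  have hχm0 : χm ≠ 0 := fun h0 => by rw [h0, map_zero] at h11; exact zero_ne_one h11
  have hind : LinearIndependent ℝ ![χ₁, χ₂] := by
    rw [LinearIndependent.pair_iff]
    intro s t hst
    have e2 := congrArg l₂ hst
    have e3 := congrArg l₃ hst
    simp only [map_add, map_smul, map_zero, h23, h32, smul_eq_mul, mul_zero, add_zero, zero_add,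
      mul_eq_zero, h22, h33, or_false] at e2 e3
    exact ⟨e2, e3⟩
  have hker := h.weakKernel_iff k₂ hχ₁ hχ₂
  obtain ⟨δ, hδ, hcoer⟩ := h.exists_coercive_pairing he
  refine ⟨√(-m), e, k₁₂, k₂, χm, χ₁, χ₂, Submodule.span ℝ {χm}, Submodule.span ℝ {χ₁, χ₂},
    l₁.ker ⊓ l₂.ker ⊓ l₃.ker, Real.sqrt_pos.2 (by linarith [he.neg]), ?_, he.integral_sq, ?_,
    h.integrable_rpow_mul_groundState he, hk₁₂, hk₂, hχm.fn_eq, ?_, ?_,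
    isInternal_of_dual_functionals (by rw [h11]; exact one_ne_zero) h12 h13 h21 h22 h23 h31 h32 h33,
    rfl, finrank_span_singleton hχm0, ?_, rfl, ?_, hker, fun u => ?_, δ, hδ, ?_⟩
  · rw [hm]; exact h.isEigenfunction_groundState he
  · intro μ f hμ hf
    rw [hm]
    exact h.eigenfunction_ae_eq he hμ hf
  · filter_upwards [hχ₁.fn_eq] with y hy
    rw [hy, chi1, (h.hasDerivAt_φ y).deriv]
    rfl
  · filter_upwards [hχ₂.fn_eq] with y hy
    rw [hy, chi2, Complex.ofReal_zero, zero_add]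
    rfl
  · intro u hu hu0
    obtain ⟨t, rfl⟩ := Submodule.mem_span_singleton.1 hu
    have ht : t ≠ 0 := fun h0 => hu0 (by rw [h0, zero_smul])
    -- The square contributes nothing on `N`, so the form there is `t² m`.
    have e1 : ∫ x, twist σ W r (fun x => t * e x) (fun x => t * chi12 σ ω c e k₁₂ x)
        (fun x => t * (r x * chi12 σ ω c e k₁₂ x - σ / (σ + 1) * (W x * e x))) x
        * twist σ W r (fun x => t * e x) (fun x => t * chi12 σ ω c e k₁₂ x)
        (fun x => t * (r x * chi12 σ ω c e k₁₂ x - σ / (σ + 1) * (W x * e x))) x = 0 := by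
      rw [← integral_zero ℝ ℝ (μ := volume)]
      congr 1
      funext x
      refine mul_eq_zero_of_left ?_ _
      simp only [twist]
      ring
    rw [h.pairingH_eq (hχm.smul t) (hχm.smul t), e1, add_zero,
      IsShortRange.energy_const_mul_left, energy_comm, IsShortRange.energy_const_mul_left,
      he.energy_eq _ _ he.isH1]
    simp_rw [← pow_two]
    rw [he.integral_sq, mul_one, ← mul_assoc]
    exact mul_neg_of_pos_of_neg (mul_self_pos.2 ht) he.neg
  · have := finrank_span_eq_card hind
    rw [Matrix.range_cons_cons_empty] at this
    simpa using this
  · rw [hker, h.weakKernel_iff_strong]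
  · rintro p ⟨⟨hp1, hp2⟩, hp3⟩
    obtain ⟨a, a', b, b', hp⟩ := hθ.exists_isPolar p
    exact hcoer p a a' b b' hp (by rw [← hl₁ _ _ _ _ _ hp]; exact hp1)
      (by rw [← hl₂ _ _ _ _ _ hp]; exact hp2) (by rw [← hl₃ _ _ _ _ _ hp]; exact hp3)
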